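/- **Setting.** Let $\mathfrak h=\ell^2(\mathbb Z)$, $\mathfrak H=\mathfrak h\oplus\mathfrak h$, let $\mathbb T=[-\pi,\pi]$, $\hat{\mathfrak h}=L^2(\mathbb T,\tfrac{dk}{2\pi})$, $\widehat{\mathfrak H}=\hat{\mathfrak h}\oplus\hat{\mathfrak h}$, and let $\mathfrak F:\mathfrak H\to\widehat{\mathfrak H}$ be the componentwise unitary Fourier transform $f\mapsto\sum_{x}f(x)e^{ikx}$; for bounded $A$ on $\mathfrak H$ put $\widehat A=\mathfrak FA\mathfrak F^*$. Let $\sigma_0=1$ and $\sigma_1,\sigma_2,\sigma_3$ be the Pauli matrices, and let $m[u]$ be multiplication by $u\in L^\infty(\mathbb T)$. Let $\Gamma(f_1\oplus f_2)=\overline{f_2}\oplus\overline{f_1}$ and $\Theta=\theta\oplus\theta$ with $(\theta f)(x)=f(x-1)$. Fix integers $x_L\le x_R$ and let $Q_L$, $Q_R$ be multiplication (on both components) by the indicator functions of $\{x\le x_L-1\}$ and $\{x\ge x_R+1\}$. For a bounded selfadjoint operator $A$, let $1_{pp}(A)$, $1_{ac}(A)$, $1_{sc}(A)$ be the orthogonal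 projections onto its pure point, absolutely continuous and singularly continuous subspaces, let $1_0(A)$ be its spectral projection for the set $\{0\}$, and let $\mathrm{eig}(A)$ be its set of eigenvalues. Let $P=p\oplus p$, where $\mathrm{dom}(p)$ is the set of absolutely continuous $\varphi$ on $\mathbb T$ with $\varphi'\in\hat{\mathfrak h}$ and $\varphi(\pi)=\varphi(-\pi)$, and $p\varphi=-i\varphi'$. For a bounded selfadjoint $U$ on $\widehat{\mathfrak H}$, if $e^{itU}\mathrm{dom}(P)\subseteq\mathrm{dom}(P)$ for all $t\in\mathbb R$ and if the limit $V\Phi=\lim_{t\to\infty}\frac1t e^{-itU}Pe^{itU}\Phi$ exists for all $\Phi\in\mathrm{dom}(P)$, then $V$ is called the asymptotic velocity with respect to $U$. **Lemma.** Let $H$ be a bounded operator on $\mathfrak H$ with $H^*=H$, $\Gamma H\Gamma=-H$, $[H,\Theta]=0$, $Q_LHQ_R=0$, and $H\ne z1$ for all $z\in\mathbb C$. Then there are unique Pauli coefficient functions $u_0\in L^\infty(\mathbb T)$, $u=[u_1,u_2,u_3]\in L^\infty(\mathbb T)^3$ of $\widehat H$, i.e. functions with $\widehat H=\sum_{\alpha=0}^3m[u_\alpha]\sigma_\alpha$,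 and the following holds. (a) $Q_LHQ_R$ is trace class, the $u_\alpha$ are real-valued, and each $u_\alpha$ is (represented by) a $C^1$ function on $\mathbb T$ with $u_\alpha(\pi)=u_\alpha(-\pi)$ and $u_\alpha'(\pi)=u_\alpha'(-\pi)$ (one-sided derivatives at $\pm\pi$). With $uu'=\sum_{i=1}^3u_iu_i'$ and $u^2=\sum_{i=1}^3u_i^2$, exactly one of the following cases holds, and each of them occurs for some such $H$ (for every choice of $x_L\le x_R$): - Case 1: $u_0=0$, $u\ne0$ and $uu'=0$; - Case 2: $u_0=0$ and $uu'\ne0$; - Case 3: $u_0\ne0$ and $u=0$; - Case 4: $u_0\ne0$, $u\ne0$ and $uu'=0$; - Case 5: $u_0\ne0$, $uu'\ne0$ and $u_0^2\ne u^2$; - Case 6: $u_0\ne0$ and $u_0^2=u^2$. (b) The triple $[1_{pp}(H),1_{ac}(H),1_{sc}(H)]$ equals $[1,0,0]$ in Case 1, equals $[0,1,0]$ in Cases 2, 3, 4 and 5, and equals $[1_0(H),\,1-1_0(H),\,0]$ in Case 6, where, in Case 6, $\dim\mathrm{ran}(1_0(H))=\infty$ but $1_0(H)\ne1$. In particular,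 $1_{sc}(H)=0$ in all cases. (c) The asymptotic velocity with respect to $\widehat H$ exists and has a unique bounded extension $\bar V$ to $\widehat{\mathfrak H}$, and $\mathrm{eig}(\bar V)\cap\{0\}=\{0\}$ in Cases 1 and 6, whereas $\mathrm{eig}(\bar V)\cap\{0\}=\emptyset$, i.e. $0\notin\mathrm{eig}(\bar V)$, in Cases 2, 3, 4 and 5. -/

import Mathlib

open scoped ENNReal NNReal Real ComplexConjugate InnerProductSpace CompactlySupported

noncomputable section

namespace RLMover

/-! ### Scalar spectral measures and spectral subspaces of a bounded selfadjoint operator -/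

section Spectral

variable {E : Type*} [NormedAddCommGroup E] [InnerProductSpace ℂ E] [CompleteSpace E]

/-- The positive functional `f ↦ (ψ, f(A) ψ)` on real continuous functions with compact support,
where `f(A)` is given by the continuous functional calculus. -/
def spectralFunctional (A : E →L[ℂ] E) (ψ : E) : C_c(ℝ, ℝ) →ₚ[ℝ] ℝ :=
  PositiveLinearMap.mk₀
    { toFun := fun f => (⟪ψ, (cfc (fun x => f x) A) ψ⟫_ℂ).re
      map_add' := by
        intro f g
        have h : cfc (fun x => (f + g) x) A = cfc (fun x => f x) A + cfc (fun x => g x) A :=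
          cfc_add A (fun x => f x) (fun x => g x) f.continuous.continuousOn
            g.continuous.continuousOn
        simp only [h, add_apply, inner_add_right, Complex.add_re]
      map_smul' := by
        intro c f
        have h : cfc (fun x => (c • f) x) A = c • cfc (fun x => f x) A :=
          cfc_smul c (fun x => f x) A f.continuous.continuousOn
        simp only [h, smul_apply, RingHom.id_apply, smul_eq_mul]
        rw [inner_smul_right_eq_smul]
        simp }
    (by
      intro f hf
      have h : 0 ≤ cfc (fun x => f x) A := cfc_nonneg fun x _ => hf x
      rw [ContinuousLinearMap.nonneg_iff_isPositive] at h
      exact h.re_inner_nonneg_right ψ)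

/-- The spectral measure `μ_ψ` of the selfadjoint operator `A` in the state `ψ`: the Borel measure
on `ℝ` with `∫ f dμ_ψ = (ψ, f(A) ψ)` (Riesz-Markov-Kakutani). In terms of the resolution of the
identity `E_A` of `A`, one has `μ_ψ(M) = (ψ, E_A(1_M) ψ)` for all Borel sets `M`. -/
def spectralMeasure (A : E →L[ℂ] E) (ψ : E) : MeasureTheory.Measure ℝ :=
  RealRMK.rieszMeasure (spectralFunctional A ψ)

lemma integral_spectralMeasure (A : E →L[ℂ] E) (ψ : E) (f : C_c(ℝ, ℝ)) :
    ∫ x, f x ∂(spectralMeasure A ψ) = (⟪ψ, (cfc (fun x => f x) A) ψ⟫_ℂ).re :=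
  RealRMK.integral_rieszMeasure (spectralFunctional A ψ) f

instance (A : E →L[ℂ] E) (ψ : E) : (spectralMeasure A ψ).Regular :=
  RealRMK.regular_rieszMeasure _

lemma spectralMeasure_zero (A : E →L[ℂ] E) : spectralMeasure A 0 = 0 := by
  refine MeasureTheory.Measure.ext_of_integral_eq_on_compactlySupported fun f => ?_
  rw [integral_spectralMeasure]
  simp

lemma integrable_spectralMeasure (A : E →L[ℂ] E) (ψ : E) (f : C_c(ℝ, ℝ)) :
    MeasureTheory.Integrable (fun x => f x) (spectralMeasure A ψ) :=
  f.continuous.integrable_of_hasCompactSupport f.hasCompactSupport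

lemma spectralMeasure_smul (A : E →L[ℂ] E) (c : ℂ) (ψ : E) :
    spectralMeasure A (c • ψ) = (‖c‖₊ ^ 2) • spectralMeasure A ψ := by
  refine MeasureTheory.Measure.ext_of_integral_eq_on_compactlySupported fun f => ?_
  rw [MeasureTheory.integral_smul_nnreal_measure, integral_spectralMeasure,
    integral_spectralMeasure, map_smul, inner_smul_left, inner_smul_right, ← mul_assoc,
    Complex.conj_mul']
  norm_cast
  rw [Complex.re_ofReal_mul, NNReal.smul_def]
  simp

lemma spectralMeasure_parallelogram (A : E →L[ℂ] E) (ψ φ : E) :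
    spectralMeasure A (ψ + φ) + spectralMeasure A (ψ - φ)
      = (2 : ℝ≥0) • (spectralMeasure A ψ + spectralMeasure A φ) := by
  have hfin : ∀ χ η : E, MeasureTheory.IsFiniteMeasureOnCompacts
      (spectralMeasure A χ + spectralMeasure A η) := fun χ η => ⟨fun K hK => by
    rw [MeasureTheory.Measure.coe_add, Pi.add_apply]
    exact ENNReal.add_lt_top.2 ⟨hK.measure_lt_top, hK.measure_lt_top⟩⟩
  have hreg : ∀ χ η : E, (spectralMeasure A χ + spectralMeasure A η).Regular := fun χ η => by
    have := hfin χ η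
    infer_instance
  have h₁ := hreg (ψ + φ) (ψ - φ)
  have h₂ := hreg ψ φ
  refine MeasureTheory.Measure.ext_of_integral_eq_on_compactlySupported fun f => ?_
  rw [MeasureTheory.integral_smul_nnreal_measure,
    MeasureTheory.integral_add_measure (integrable_spectralMeasure ..)
      (integrable_spectralMeasure ..),
    MeasureTheory.integral_add_measure (integrable_spectralMeasure ..)
      (integrable_spectralMeasure ..)]
  simp only [integral_spectralMeasure, map_add, map_sub, inner_add_left, inner_add_right,
    inner_sub_left, inner_sub_right, Complex.add_re, Complex.sub_re, NNReal.smul_def, smul_eq_mul]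
  push_cast
  ring

lemma spectralMeasure_add_null (A : E →L[ℂ] E) {ψ φ : E} {M : Set ℝ}
    (h₁ : spectralMeasure A ψ M = 0) (h₂ : spectralMeasure A φ M = 0) :
    spectralMeasure A (ψ + φ) M = 0 := by
  have h := congrArg (fun μ => μ M) (spectralMeasure_parallelogram A ψ φ)
  simp only [MeasureTheory.Measure.coe_add, Pi.add_apply, MeasureTheory.Measure.smul_apply, h₁, h₂,
    add_zero, smul_zero, add_eq_zero] at h
  exact h.1

lemma spectralMeasure_smul_null (A : E →L[ℂ] E) (c : ℂ) {ψ : E} {M : Set ℝ}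
    (h : spectralMeasure A ψ M = 0) : spectralMeasure A (c • ψ) M = 0 := by
  rw [spectralMeasure_smul, MeasureTheory.Measure.smul_apply, h, smul_zero]

/-- The range `{ψ | μ_ψ(ℝ ∖ M) = 0}` of the spectral projection `1_M(A) = E_A(1_M)`. -/
def spectralSubspace (A : E →L[ℂ] E) (M : Set ℝ) : Submodule ℂ E where
  carrier := {ψ | spectralMeasure A ψ Mᶜ = 0}
  zero_mem' := by simp [spectralMeasure_zero]
  add_mem' := fun h₁ h₂ => spectralMeasure_add_null A h₁ h₂
  smul_mem' := fun c _ h => spectralMeasure_smul_null A c h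

/-- The pure point subspace: the vectors whose spectral measure is carried by a countable set. -/
def ppSubspace (A : E →L[ℂ] E) : Submodule ℂ E where
  carrier := {ψ | ∃ C : Set ℝ, C.Countable ∧ spectralMeasure A ψ Cᶜ = 0}
  zero_mem' := ⟨∅, Set.countable_empty, by simp [spectralMeasure_zero]⟩
  add_mem' := by
    rintro ψ φ ⟨C, hC, h₁⟩ ⟨D, hD, h₂⟩
    exact ⟨C ∪ D, hC.union hD, spectralMeasure_add_null A
      (MeasureTheory.measure_mono_null (Set.compl_subset_compl.2 Set.subset_union_left) h₁)
      (MeasureTheory.measure_mono_null (Set.compl_subset_compl.2 Set.subset_union_right) h₂)⟩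
  smul_mem' := by
    rintro c ψ ⟨C, hC, h⟩
    exact ⟨C, hC, spectralMeasure_smul_null A c h⟩

/-- The absolutely continuous subspace: the vectors whose spectral measure is absolutely
continuous with respect to the Lebesgue measure. -/
def acSubspace (A : E →L[ℂ] E) : Submodule ℂ E where
  carrier := {ψ | MeasureTheory.Measure.AbsolutelyContinuous (spectralMeasure A ψ)
    MeasureTheory.volume}
  zero_mem' := by
    intro M _
    simp [spectralMeasure_zero]
  add_mem' := fun h₁ h₂ _ hM => spectralMeasure_add_null A (h₁ hM) (h₂ hM)
  smul_mem' := fun c _ h _ hM => spectralMeasure_smul_null A c (h hM)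

/-- The singularly continuous subspace: the vectors whose spectral measure has no atoms and is
carried by a Lebesgue null set. -/
def scSubspace (A : E →L[ℂ] E) : Submodule ℂ E where
  carrier := {ψ | (∀ x : ℝ, spectralMeasure A ψ {x} = 0) ∧
    ∃ N : Set ℝ, MeasureTheory.volume N = 0 ∧ spectralMeasure A ψ Nᶜ = 0}
  zero_mem' := ⟨fun x => by simp [spectralMeasure_zero], ∅, by simp,
    by simp [spectralMeasure_zero]⟩
  add_mem' := by
    rintro ψ φ ⟨h₁, N, hN, h₁'⟩ ⟨h₂, K, hK, h₂'⟩
    exact ⟨fun x => spectralMeasure_add_null A (h₁ x) (h₂ x), N ∪ K,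
      MeasureTheory.measure_union_null hN hK, spectralMeasure_add_null A
      (MeasureTheory.measure_mono_null (Set.compl_subset_compl.2 Set.subset_union_left) h₁')
      (MeasureTheory.measure_mono_null (Set.compl_subset_compl.2 Set.subset_union_right) h₂')⟩
  smul_mem' := by
    rintro c ψ ⟨h, N, hN, h'⟩
    exact ⟨fun x => spectralMeasure_smul_null A c (h x), N, hN, spectralMeasure_smul_null A c h'⟩

/-- The orthogonal projection onto (the closure of) a subspace; the subspaces above are closed. -/
def projOnto (S : Submodule ℂ E) : E →L[ℂ] E := S.topologicalClosure.starProjection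

/-- `1_M(A)`. -/
def spectralProj (A : E →L[ℂ] E) (M : Set ℝ) : E →L[ℂ] E := projOnto (spectralSubspace A M)

/-- `1_pp(A)`. -/
def ppProj (A : E →L[ℂ] E) : E →L[ℂ] E := projOnto (ppSubspace A)

/-- `1_ac(A)`. -/
def acProj (A : E →L[ℂ] E) : E →L[ℂ] E := projOnto (acSubspace A)

/-- `1_sc(A)`. -/
def scProj (A : E →L[ℂ] E) : E →L[ℂ] E := projOnto (scSubspace A)

/-- The set of eigenvalues of `A`. -/
def eig (A : E →L[ℂ] E) : Set ℂ := {z | Module.End.HasEigenvalue (A : E →ₗ[ℂ] E) z}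

/-- `A` is trace class: `∑ (e_i, |A| e_i) < ∞` with `|A| = (A* A)^{1/2}` for all orthonormal
bases `(e_i)`. -/
def IsTraceClass (A : E →L[ℂ] E) : Prop :=
  ∀ (ι : Type) (e : HilbertBasis ι ℂ E), Summable fun i => (⟪e i, CFC.abs A (e i)⟫_ℂ).re

end Spectral

/-! ### Doubled spaces and the Pauli expansion -/

section Doubling

/-- The Hilbert space direct sum `E ⊕ E`. -/
abbrev Dbl (E : Type*) : Type _ := PiLp 2 (fun _ : Fin 2 => E)

/-- The Pauli basis `σ_0, σ_1, σ_2, σ_3` of the complex `2 × 2` matrices. -/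
def pauli : Fin 4 → Matrix (Fin 2) (Fin 2) ℂ :=
  ![!![1, 0; 0, 1], !![0, 1; 1, 0], !![0, -Complex.I; Complex.I, 0], !![1, 0; 0, -1]]

variable {E : Type*} [NormedAddCommGroup E] [InnerProductSpace ℂ E]

/-- The operator `b M` on `E ⊕ E` with entries `(b M)_{ij} = m_{ij} b`. -/
def opMatrix (b : E →L[ℂ] E) (M : Matrix (Fin 2) (Fin 2) ℂ) : Dbl E →L[ℂ] Dbl E :=
  (PiLp.continuousLinearEquiv 2 ℂ (fun _ : Fin 2 => E)).symm.toContinuousLinearMap ∘L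
    (ContinuousLinearMap.pi fun i => ∑ j, M i j • (b ∘L ContinuousLinearMap.proj j)) ∘L
    (PiLp.continuousLinearEquiv 2 ℂ (fun _ : Fin 2 => E)).toContinuousLinearMap

lemma opMatrix_apply (b : E →L[ℂ] E) (M : Matrix (Fin 2) (Fin 2) ℂ) (F : Dbl E) (i : Fin 2) :
    opMatrix b M F i = ∑ j, M i j • b (F j) := by
  simp [opMatrix]

/-- `a_0 σ_0 + a_1 σ_1 + a_2 σ_2 + a_3 σ_3`. -/
def pauliOp (a : Fin 4 → E →L[ℂ] E) : Dbl E →L[ℂ] Dbl E := ∑ α, opMatrix (a α) (pauli α)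

end Doubling

/-! ### Position space -/

/-- The 1-particle position Hilbert space `ℓ²(ℤ)`. -/
abbrev PosSpace : Type := lp (fun _ : ℤ => ℂ) 2

/-- The conjugation `Γ (f₁ ⊕ f₂) = conj f₂ ⊕ conj f₁`. -/
def Γ (F : Dbl PosSpace) : Dbl PosSpace := WithLp.toLp 2 ![star (F 1), star (F 0)]

lemma memℓp_translate (f : PosSpace) : Memℓp (fun x : ℤ => (f : ℤ → ℂ) (x - 1)) 2 := by
  have h := (lp.memℓp f).summable (by norm_num)
  exact memℓp_gen ((Equiv.subRight (1 : ℤ)).summable_iff.2 h)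

/-- The right translation `(θ f)(x) = f(x - 1)`. -/
def θ : PosSpace →L[ℂ] PosSpace :=
  LinearMap.mkContinuous
    { toFun := fun f => ⟨fun x => (f : ℤ → ℂ) (x - 1), memℓp_translate f⟩
      map_add' := fun f g => rfl
      map_smul' := fun c f => rfl } 1 (by
    intro f
    rw [one_mul]
    refine le_of_eq ?_
    rw [lp.norm_eq_tsum_rpow (by norm_num), lp.norm_eq_tsum_rpow (by norm_num)]
    congr 1
    exact (Equiv.subRight (1 : ℤ)).tsum_eq
      (fun x => ‖(f : ℤ → ℂ) x‖ ^ (2 : ℝ≥0∞).toReal))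

lemma norm_indicator_le (M : Set ℤ) (f : PosSpace) (x : ℤ) :
    ‖M.indicator (f : ℤ → ℂ) x‖ ^ (2 : ℝ≥0∞).toReal
      ≤ ‖(f : ℤ → ℂ) x‖ ^ (2 : ℝ≥0∞).toReal :=
  Real.rpow_le_rpow (norm_nonneg _) (norm_indicator_le_norm_self _ _) (by norm_num)

lemma memℓp_indicator (M : Set ℤ) (f : PosSpace) : Memℓp (M.indicator (f : ℤ → ℂ)) 2 :=
  memℓp_gen (((lp.memℓp f).summable (by norm_num)).of_nonneg_of_le
    (fun x => Real.rpow_nonneg (norm_nonneg _) _) (norm_indicator_le M f))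

/-- The multiplication operator `m[1_M]` on position space. -/
def q (M : Set ℤ) : PosSpace →L[ℂ] PosSpace :=
  LinearMap.mkContinuous
    { toFun := fun f => ⟨M.indicator (f : ℤ → ℂ), memℓp_indicator M f⟩
      map_add' := fun f g => by
        ext x
        exact congrFun (Set.indicator_add M (f : ℤ → ℂ) (g : ℤ → ℂ)) x
      map_smul' := fun c f => by
        ext x
        exact congrFun (Set.indicator_const_smul M c (f : ℤ → ℂ)) x } 1 (by
    intro f
    rw [one_mul, lp.norm_eq_tsum_rpow (by norm_num), lp.norm_eq_tsum_rpow (by norm_num)]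
    refine Real.rpow_le_rpow (tsum_nonneg fun x => Real.rpow_nonneg (norm_nonneg _) _) ?_
      (by norm_num)
    exact Summable.tsum_le_tsum (norm_indicator_le M f)
      ((memℓp_indicator M f).summable (by norm_num)) ((lp.memℓp f).summable (by norm_num)))

/-- `Θ = θ σ_0`. -/
def Θ : Dbl PosSpace →L[ℂ] Dbl PosSpace := opMatrix θ (pauli 0)

/-- `Q_M = m[1_M] σ_0`. -/
def Q (M : Set ℤ) : Dbl PosSpace →L[ℂ] Dbl PosSpace := opMatrix (q M) (pauli 0)

/-- `H_{LR} = Q_L H Q_R`, where the left reservoir is `{x ≤ x_L - 1}` and the right reservoir is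
`{x ≥ x_R + 1}`. -/
def reservoirCoupling (xL xR : ℤ) (H : Dbl PosSpace →L[ℂ] Dbl PosSpace) :
    Dbl PosSpace →L[ℂ] Dbl PosSpace :=
  Q (Set.Iic (xL - 1)) ∘L H ∘L Q (Set.Ici (xR + 1))

/-- `H* = H` and `Γ H Γ = - H`. -/
structure IsHamiltonian (H : Dbl PosSpace →L[ℂ] Dbl PosSpace) : Prop where
  selfAdjoint : IsSelfAdjoint H
  conjugation : ∀ F, Γ (H (Γ F)) = -(H F)

/-- The standing hypotheses: `H` is a translation invariant Hamiltonian without direct coupling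
of the reservoirs, and it is not a multiple of the identity. -/
structure IsAdmissible (xL xR : ℤ) (H : Dbl PosSpace →L[ℂ] Dbl PosSpace) : Prop where
  hamiltonian : IsHamiltonian H
  translation : H ∘L Θ = Θ ∘L H
  coupling : reservoirCoupling xL xR H = 0
  nontrivial : ∀ z : ℂ, H ≠ z • (1 : Dbl PosSpace →L[ℂ] Dbl PosSpace)

/-! ### Momentum space -/

instance : Fact (0 < 2 * π) := ⟨Real.two_pi_pos⟩

/-- The circle `ℝ / 2πℤ`, i.e. the interval `[-π, π]` with its end points identified. -/
abbrev Torus : Type := AddCircle (2 * π)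

/-- The normalized Lebesgue measure `dk / 2π`. -/
abbrev torusMeasure : MeasureTheory.Measure Torus := AddCircle.haarAddCircle

/-- The 1-particle momentum Hilbert space. -/
abbrev MomSpace : Type := MeasureTheory.Lp ℂ 2 torusMeasure

/-- `L^∞` of the circle. -/
abbrev LInfty : Type := MeasureTheory.Lp ℂ ∞ torusMeasure

/-- The multiplication operator `m[u]` on momentum space. -/
def mulOp (u : LInfty) : MomSpace →L[ℂ] MomSpace :=
  (ContinuousLinearMap.mul ℂ ℂ).holderL torusMeasure ∞ 2 2 u

/-- The unitary Fourier transform `f ↦ ∑ f(x) e_x` with `e_x(k) = exp(i k x)`. -/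
def fourierTransform : PosSpace ≃ₗᵢ[ℂ] MomSpace := (fourierBasis (T := 2 * π)).repr.symm

/-- The Fourier transform on the doubled space. -/
def dblFourier : Dbl PosSpace ≃ₗᵢ[ℂ] Dbl MomSpace :=
  LinearIsometryEquiv.piLpCongrRight 2 fun _ => fourierTransform

/-- The operator `Ĥ` on momentum space which is unitarily equivalent to `H` through the Fourier
transform. -/
def hat (H : Dbl PosSpace →L[ℂ] Dbl PosSpace) : Dbl MomSpace →L[ℂ] Dbl MomSpace :=
  dblFourier.toContinuousLinearEquiv.toContinuousLinearMap ∘L H ∘L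
    dblFourier.symm.toContinuousLinearEquiv.toContinuousLinearMap

/-- `u_0, …, u_3` are the Pauli coefficient functions of `Ĥ`, i.e.
`Ĥ = m[u_0] σ_0 + m[u_1] σ_1 + m[u_2] σ_2 + m[u_3] σ_3`. -/
def IsPauliSymbol (H : Dbl PosSpace →L[ℂ] Dbl PosSpace) (u : Fin 4 → LInfty) : Prop :=
  hat H = pauliOp fun α => mulOp (u α)

/-- The derivative on `[-π, π]`, one-sided at the end points. -/
def dT (g : ℝ → ℂ) (k : ℝ) : ℂ := derivWithin g (Set.Icc (-π) π) k

/-- `g` is a `C¹` function on `[-π, π]`, with `g(π) = g(-π)` and `g'(π) = g'(-π)`, which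
represents the class `u`. -/
structure IsC1Rep (u : LInfty) (g : ℝ → ℂ) : Prop where
  contDiff : ContDiffOn ℝ 1 g (Set.Icc (-π) π)
  periodic : g π = g (-π)
  periodic_deriv : dT g π = dT g (-π)
  ae_eq : ∀ᵐ k : ℝ ∂(MeasureTheory.volume.restrict (Set.Icc (-π) π)), u (k : Torus) = g k

/-- `φ ∈ dom(p)` and `ψ = p φ`, where `dom(p)` consists of the (classes of) absolutely continuous
functions `f` on `[-π, π]` with `f' ∈ L²` and `f(π) = f(-π)`, and where `p f = -i f'`. -/
def IsMomentumImage (φ ψ : MomSpace) : Prop :=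
  ∃ f : ℝ → ℂ, AbsolutelyContinuousOnInterval f (-π) π ∧ f π = f (-π) ∧
    (∀ᵐ k : ℝ ∂(MeasureTheory.volume.restrict (Set.Icc (-π) π)), φ (k : Torus) = f k) ∧
    (∀ᵐ k : ℝ ∂(MeasureTheory.volume.restrict (Set.Icc (-π) π)),
      ψ (k : Torus) = -Complex.I * deriv f k)

/-- `Φ ∈ dom(P)` and `Ψ = P Φ`, where `P = p σ_0`. -/
def IsDblMomentumImage (Φ Ψ : Dbl MomSpace) : Prop := ∀ i, IsMomentumImage (Φ i) (Ψ i)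

/-- The asymptotic velocity with respect to `U` exists and `V` is its bounded extension:
`e^{itU}` maps `dom(P)` into itself for all real `t`, and
`V Φ = lim_{t → ∞} e^{-itU} P e^{itU} Φ / t` for all `Φ ∈ dom(P)`. Here, `X t = P e^{itU} Φ`. -/
def IsAsymptoticVelocity (U V : Dbl MomSpace →L[ℂ] Dbl MomSpace) : Prop :=
  ∀ Φ : Dbl MomSpace, (∃ Ψ, IsDblMomentumImage Φ Ψ) →
    ∃ X : ℝ → Dbl MomSpace,
      (∀ t : ℝ, IsDblMomentumImage (NormedSpace.exp ((Complex.I * t) • U) Φ) (X t)) ∧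
      Filter.Tendsto
        (fun t : ℝ => ((t : ℂ)⁻¹) • NormedSpace.exp ((-(Complex.I * t)) • U) (X t))
        Filter.atTop (nhds (V Φ))

/-! ### The six cases -/

/-- Labels of the six cases. -/
inductive CaseLabel
  | one | two | three | four | five | six

/-- `u_0 = 0` on `[-π, π]`. -/
def ScalarZero (g : Fin 4 → ℝ → ℂ) : Prop := ∀ k ∈ Set.Icc (-π) π, g 0 k = 0

/-- `u = [u_1, u_2, u_3] = 0` on `[-π, π]`. -/
def VectorZero (g : Fin 4 → ℝ → ℂ) : Prop :=
  ∀ k ∈ Set.Icc (-π) π, g 1 k = 0 ∧ g 2 k = 0 ∧ g 3 k = 0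

/-- `u u' = u_1 u_1' + u_2 u_2' + u_3 u_3' = 0` on `[-π, π]`. -/
def DotDerivZero (g : Fin 4 → ℝ → ℂ) : Prop :=
  ∀ k ∈ Set.Icc (-π) π, g 1 k * dT (g 1) k + g 2 k * dT (g 2) k + g 3 k * dT (g 3) k = 0

/-- `u_0² = u² = u_1² + u_2² + u_3²` on `[-π, π]`. -/
def SquaresEq (g : Fin 4 → ℝ → ℂ) : Prop :=
  ∀ k ∈ Set.Icc (-π) π, g 0 k ^ 2 = g 1 k ^ 2 + g 2 k ^ 2 + g 3 k ^ 2

/-- The six cases, in terms of the `C¹` representatives of the Pauli coefficient functions. -/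
def InCase (g : Fin 4 → ℝ → ℂ) : CaseLabel → Prop
  | .one => ScalarZero g ∧ ¬ VectorZero g ∧ DotDerivZero g
  | .two => ScalarZero g ∧ ¬ DotDerivZero g
  | .three => ¬ ScalarZero g ∧ VectorZero g
  | .four => ¬ ScalarZero g ∧ ¬ VectorZero g ∧ DotDerivZero g
  | .five => ¬ ScalarZero g ∧ ¬ DotDerivZero g ∧ ¬ SquaresEq g
  | .six => ¬ ScalarZero g ∧ SquaresEq g

end RLMover

end

/-!
The operator `H` has matrix elements `h(x - y)`. The vanishing of the direct coupling of the
reservoirs and selfadjointness force `h` to have finite range, so that on momentum space `H` is the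
multiplication by the Hermitian matrix `u₀ + u·σ` whose coefficients are real trigonometric
polynomials (`IsAdmissible.isMatMul_hat`). The conjugation symmetry makes `u₀` odd and `u²` even
(`IsSymbol`).

The spectral measure of a vector is the image of a density on the circle under the eigenvalues
`u₀ ± |u|` of the symbol (`spectralMeasure_eq`). The spectrum is therefore absolutely continuous
if almost no point is critical for the eigenvalues, which are analytic where `u ≠ 0`: a function
with non-zero derivative pulls Lebesgue null sets back to null sets (`volume_preimage_null`), and
zeros of analytic functions which are not identically zero form a null set. What has to be excluded
is a constant eigenvalue, say `c`. Then `u² = (u₀ - c)²`, and comparing the odd parts gives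
`c u₀ = 0` (`IsSymbol.not_dispersive`): either `u₀ = 0` and `u²` is constant, and the spectrum is
pure point, or `u₀² = u²`, and the eigenvalues are `0` and `2 u₀`. In the last case the kernel of
`H` is infinite dimensional because it is translation invariant and the translation has no
eigenvectors.

For the asymptotic velocity, one differentiates `e^{itU}` in the momentum. After division by `t`,
only the derivatives of the eigenvalues survive, so that the velocity is the multiplication by
`u₀' + (u u' / u²) u·σ` (`IsSymbol.isAsymptoticVelocity`). The convergence is dominated because
`|u u'| ≤ |u| |u'|`. The velocity has a kernel if and only if one of the derivatives of the
eigenvalues vanishes on a set of positive measure.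
-/

noncomputable section

namespace RLMover

open MeasureTheory Filter Topology Set

/-! ### The fundamental interval of the circle -/

/-- The representative in `(-π, π]` of a point of the circle. -/
def rep (k : Torus) : ℝ := (AddCircle.equivIoc (2 * π) (-π) k : ℝ)

lemma neg_pi_add : -π + 2 * π = π := by ring

lemma rep_mem (k : Torus) : rep k ∈ Ioc (-π) π := by
  have h := (AddCircle.equivIoc (2 * π) (-π) k).2
  exact ⟨h.1, h.2.trans_eq neg_pi_add⟩

lemma rep_mem_Icc (k : Torus) : rep k ∈ Icc (-π) π := Ioc_subset_Icc_self (rep_mem k)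

lemma coe_rep (k : Torus) : ((rep k : ℝ) : Torus) = k := AddCircle.coe_equivIoc

lemma rep_coe {x : ℝ} (hx : x ∈ Ioc (-π) π) : rep (x : Torus) = x :=
  AddCircle.equivIoc_coe_of_mem (by rwa [neg_pi_add])

lemma measurable_rep : Measurable rep :=
  measurable_subtype_coe.comp (AddCircle.measurableEquivIoc (2 * π) (-π)).measurable

lemma torus_volume : (volume : Measure Torus) = ENNReal.ofReal (2 * π) • torusMeasure := rfl

lemma torusMeasure_null {s : Set Torus} : torusMeasure s = 0 ↔ volume s = 0 := by
  have : ENNReal.ofReal (2 * π) ≠ 0 := by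
    simpa using Real.pi_pos
  rw [torus_volume, Measure.smul_apply, smul_eq_mul, mul_eq_zero]
  tauto

lemma quasiMeasurePreserving_rep :
    Measure.QuasiMeasurePreserving rep torusMeasure (volume.restrict (Icc (-π) π)) := by
  refine ⟨measurable_rep, Measure.AbsolutelyContinuous.mk fun s hs h => ?_⟩
  rw [Measure.map_apply measurable_rep hs, torusMeasure_null]
  have h1 := (AddCircle.measurePreserving_equivIoc (2 * π) (a := -π)).measure_preimage
    (measurable_subtype_coe hs).nullMeasurableSet
  have h2 : rep ⁻¹' s = (AddCircle.equivIoc (2 * π) (-π)) ⁻¹' (Subtype.val ⁻¹' s) := rfl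
  rw [h2, h1, Measure.comap_apply _ Subtype.val_injective
    (fun _ h => measurableSet_Ioc.subtype_image h) _ (measurable_subtype_coe hs)]
  rw [Measure.restrict_apply hs] at h
  refine measure_mono_null ?_ h
  rintro _ ⟨x, hx, rfl⟩
  exact ⟨hx, x.2.1.le, x.2.2.trans_eq neg_pi_add⟩

lemma ae_rep {p : ℝ → Prop} (h : ∀ᵐ x ∂(volume.restrict (Icc (-π) π)), p x) :
    ∀ᵐ k ∂torusMeasure, p (rep k) :=
  quasiMeasurePreserving_rep.ae h

lemma ae_coe {p : Torus → Prop} (h : ∀ᵐ k ∂torusMeasure, p k) :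
    ∀ᵐ x : ℝ ∂(volume.restrict (Icc (-π) π)), p (x : Torus) := by
  have h1 := (AddCircle.measurePreserving_mk (2 * π) (-π)).quasiMeasurePreserving
  have h2 : ∀ᵐ k ∂(volume : Measure Torus), p k := torusMeasure_null.1 h
  have h3 := h1.ae h2
  rw [neg_pi_add] at h3
  rw [← Measure.restrict_congr_set Ioc_ae_eq_Icc]
  exact h3

lemma ae_mem_Ioc : ∀ᵐ x : ℝ ∂(volume.restrict (Icc (-π) π)), x ∈ Ioc (-π) π := by
  rw [← Measure.restrict_congr_set Ioc_ae_eq_Icc]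
  exact ae_restrict_mem measurableSet_Ioc

/-! ### Multiplication operators with matrix-valued symbols -/

/-- The operator `T` on `L²(𝕋) ⊕ L²(𝕋)` acts as pointwise multiplication by the matrix-valued
function `M`. Neither measurability nor boundedness of `M` is demanded. -/
def IsMatMul (T : Dbl MomSpace →L[ℂ] Dbl MomSpace) (M : Torus → Matrix (Fin 2) (Fin 2) ℂ) :
    Prop :=
  ∀ (Φ : Dbl MomSpace) (i : Fin 2), ∀ᵐ k ∂torusMeasure, T Φ i k = ∑ j, M k i j * Φ j k

namespace IsMatMul

variable {T T' : Dbl MomSpace →L[ℂ] Dbl MomSpace} {M M' : Torus → Matrix (Fin 2) (Fin 2) ℂ}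

lemma zero : IsMatMul 0 (fun _ => 0) := by
  intro Φ i
  filter_upwards [Lp.coeFn_zero ℂ 2 torusMeasure] with k _
  simp

lemma one : IsMatMul 1 (fun _ => 1) := by
  intro Φ i
  refine Eventually.of_forall fun k => ?_
  simp [Matrix.one_apply]

lemma congr (h : IsMatMul T M) (hM : ∀ᵐ k ∂torusMeasure, M k = M' k) : IsMatMul T M' := by
  intro Φ i
  filter_upwards [h Φ i, hM] with k h1 h2
  rw [h1, h2]

lemma add (h : IsMatMul T M) (h' : IsMatMul T' M') : IsMatMul (T + T') (fun k => M k + M' k) := by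
  intro Φ i
  filter_upwards [h Φ i, h' Φ i, Lp.coeFn_add (T Φ i) (T' Φ i)] with k h1 h2 h3
  have : (T + T') Φ i = T Φ i + T' Φ i := rfl
  rw [this, h3, Pi.add_apply, h1, h2, ← Finset.sum_add_distrib]
  simp [add_mul]

lemma smul (c : ℂ) (h : IsMatMul T M) : IsMatMul (c • T) (fun k => c • M k) := by
  intro Φ i
  filter_upwards [h Φ i, Lp.coeFn_smul c (T Φ i)] with k h1 h3
  have : (c • T) Φ i = c • T Φ i := rfl
  rw [this, h3, Pi.smul_apply, h1, smul_eq_mul, Finset.mul_sum]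
  simp [mul_assoc]

lemma sub (h : IsMatMul T M) (h' : IsMatMul T' M') : IsMatMul (T - T') (fun k => M k - M' k) := by
  have h1 := h.add (h'.smul (-1))
  rw [show T + (-1 : ℂ) • T' = T - T' by module] at h1
  exact h1.congr (Eventually.of_forall fun k => by module)

lemma mul (h : IsMatMul T M) (h' : IsMatMul T' M') : IsMatMul (T * T') (fun k => M k * M' k) := by
  intro Φ i
  have h2 : ∀ᵐ k ∂torusMeasure, ∀ j, T' Φ j k = ∑ l, M' k j l * Φ l k :=
    ae_all_iff.2 fun j => h' Φ j
  filter_upwards [h (T' Φ) i, h2] with k h1 h2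
  have : (T * T') Φ i = T (T' Φ) i := rfl
  rw [this, h1]
  simp only [h2, Matrix.mul_apply, Fin.sum_univ_two]
  ring

lemma pow (h : IsMatMul T M) (n : ℕ) : IsMatMul (T ^ n) (fun k => M k ^ n) := by
  induction n with
  | zero => simpa using one
  | succ n ih => simpa [pow_succ] using ih.mul h

lemma sum {ι : Type*} (s : Finset ι) {T : ι → Dbl MomSpace →L[ℂ] Dbl MomSpace}
    {M : ι → Torus → Matrix (Fin 2) (Fin 2) ℂ} (h : ∀ i ∈ s, IsMatMul (T i) (M i)) :
    IsMatMul (∑ i ∈ s, T i) (fun k => ∑ i ∈ s, M i k) := by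
  classical
  induction s using Finset.induction_on with
  | empty => simpa using zero
  | insert a s ha ih =>
    simp only [Finset.sum_insert ha]
    exact (h a (by simp)).add (ih fun i hi => h i (by simp [hi]))

lemma ext (h : IsMatMul T M) (h' : IsMatMul T' M') (hM : ∀ᵐ k ∂torusMeasure, M k = M' k) :
    T = T' := by
  ext1 Φ
  refine PiLp.ext fun i => Lp.ext ?_
  filter_upwards [h Φ i, h' Φ i, hM] with k h1 h2 h3
  rw [h1, h2, h3]

/-- Strong limits of multiplication operators multiply by the pointwise limit of the symbols: an
`L²`-convergent sequence converges pointwise almost everywhere along a subsequence. -/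
lemma of_tendsto {T : ℕ → Dbl MomSpace →L[ℂ] Dbl MomSpace}
    {M : ℕ → Torus → Matrix (Fin 2) (Fin 2) ℂ} {T₀ : Dbl MomSpace →L[ℂ] Dbl MomSpace}
    {M₀ : Torus → Matrix (Fin 2) (Fin 2) ℂ} (h : ∀ n, IsMatMul (T n) (M n))
    (hT : Tendsto T atTop (𝓝 T₀)) (hM : ∀ k, Tendsto (fun n => M n k) atTop (𝓝 (M₀ k))) :
    IsMatMul T₀ M₀ := by
  intro Φ i
  have h1 : Tendsto (fun n => T n Φ i) atTop (𝓝 (T₀ Φ i)) := by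
    have : Continuous fun S : Dbl MomSpace →L[ℂ] Dbl MomSpace => S Φ i := by fun_prop
    exact (this.tendsto T₀).comp hT
  obtain ⟨ns, hns, hlim⟩ := (tendstoInMeasure_of_tendsto_Lp h1).exists_seq_tendsto_ae
  have h2 : ∀ᵐ k ∂torusMeasure, ∀ n, T n Φ i k = ∑ j, M n k i j * Φ j k :=
    ae_all_iff.2 fun n => h n Φ i
  filter_upwards [hlim, h2] with k h3 h4
  refine tendsto_nhds_unique h3 ?_
  simp only [h4]
  refine tendsto_finsetSum _ fun j _ => Tendsto.mul_const _ ?_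
  have h5 := (hM k).comp hns.tendsto_atTop
  exact tendsto_pi_nhds.1 (tendsto_pi_nhds.1 h5 i) j

end IsMatMul

/-- The plane wave `e^{ink}` in the component `j`. -/
def planeWave (n : ℤ) (j : Fin 2) : Dbl MomSpace := PiLp.single 2 j (fourierLp 2 n)

lemma planeWave_apply (n : ℤ) (i j : Fin 2) :
    ∀ᵐ k ∂torusMeasure, planeWave n j i k = if i = j then fourier n k else 0 := by
  by_cases h : i = j
  · subst h
    simp only [planeWave, PiLp.single_eq_same, if_true]
    exact coeFn_fourierLp 2 n
  · simp only [planeWave, PiLp.single_eq_of_ne (p := 2) h, h, if_false]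
    exact Lp.coeFn_zero _ _ _

/-- A bounded operator is determined by its values on the plane waves. -/
lemma clm_ext_planeWave {E : Type*} [NormedAddCommGroup E] [NormedSpace ℂ E]
    {T T' : Dbl MomSpace →L[ℂ] E} (h : ∀ n j, T (planeWave n j) = T' (planeWave n j)) : T = T' := by
  have key : ∀ j : Fin 2, ∀ f : MomSpace, T (PiLp.single 2 j f) = T' (PiLp.single 2 j f) := by
    intro j
    let ι : MomSpace →L[ℂ] Dbl MomSpace :=
      (PiLp.continuousLinearEquiv 2 ℂ (fun _ : Fin 2 => MomSpace)).symm.toContinuousLinearMap ∘L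
        ContinuousLinearMap.single ℂ (fun _ : Fin 2 => MomSpace) j
    have hι : ∀ f, ι f = PiLp.single 2 j f := fun f => rfl
    have : T ∘L ι = T' ∘L ι := by
      refine ContinuousLinearMap.ext_on (s := range (fourierLp (T := 2 * π) 2)) ?_ ?_
      · rw [dense_iff_closure_eq]
        have := span_fourierLp_closure_eq_top (T := 2 * π) (p := 2) (by norm_num)
        have h2 := congrArg (fun S : Submodule ℂ MomSpace => (S : Set MomSpace)) this
        simpa using h2
      · rintro _ ⟨n, rfl⟩
        exact h n j
    intro f
    exact congrArg (fun S : MomSpace →L[ℂ] E => S f) this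
  ext1 Φ
  have hΦ : Φ = PiLp.single 2 0 (Φ 0) + PiLp.single 2 1 (Φ 1) := by
    refine PiLp.ext fun i => ?_
    fin_cases i <;> simp
  rw [hΦ, map_add, map_add, key, key]

/-- The symbol of a multiplication operator is unique almost everywhere. -/
lemma IsMatMul.symbol_unique {T : Dbl MomSpace →L[ℂ] Dbl MomSpace}
    {M M' : Torus → Matrix (Fin 2) (Fin 2) ℂ} (h : IsMatMul T M) (h' : IsMatMul T M') :
    ∀ᵐ k ∂torusMeasure, M k = M' k := by
  have h1 : ∀ᵐ k ∂torusMeasure, ∀ i j, M k i j = M' k i j := by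
    refine ae_all_iff.2 fun i => ae_all_iff.2 fun j => ?_
    filter_upwards [h (planeWave 0 j) i, h' (planeWave 0 j) i, planeWave_apply 0 0 j,
      planeWave_apply 0 1 j] with k h1 h2 h3 h4
    rw [h1, Fin.sum_univ_two, Fin.sum_univ_two, h3, h4] at h2
    fin_cases j <;> simpa using h2
  filter_upwards [h1] with k hk
  ext i j
  exact hk i j

lemma exists_linfty {m : Torus → ℂ} (hm : Measurable m) {C : ℝ} (hC : ∀ k, ‖m k‖ ≤ C) :
    ∃ u : LInfty, ∀ᵐ k ∂torusMeasure, u k = m k :=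
  ⟨(memLp_top_of_bound hm.aestronglyMeasurable C (Eventually.of_forall hC)).toLp m,
    MemLp.coeFn_toLp _⟩

lemma mulOp_apply (u : LInfty) (f : MomSpace) :
    ∀ᵐ k ∂torusMeasure, mulOp u f k = u k * f k :=
  (ContinuousLinearMap.mul ℂ ℂ).coeFn_holder (p := ∞) (q := 2) (r := 2) u f

lemma isMatMul_opMatrix (u : LInfty) (A : Matrix (Fin 2) (Fin 2) ℂ) :
    IsMatMul (opMatrix (mulOp u) A) (fun k => u k • A) := by
  intro Φ i
  rw [opMatrix_apply, Fin.sum_univ_two]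
  filter_upwards [mulOp_apply u (Φ 0), mulOp_apply u (Φ 1),
    Lp.coeFn_add (A i 0 • mulOp u (Φ 0)) (A i 1 • mulOp u (Φ 1)),
    Lp.coeFn_smul (A i 0) (mulOp u (Φ 0)), Lp.coeFn_smul (A i 1) (mulOp u (Φ 1))] with
    k h0 h1 h2 h3 h4
  rw [h2, Pi.add_apply, h3, h4]
  simp [h0, h1]
  ring

lemma isMatMul_pauliOp (u : Fin 4 → LInfty) :
    IsMatMul (pauliOp fun α => mulOp (u α)) (fun k => ∑ α, u α k • pauli α) :=
  IsMatMul.sum Finset.univ fun α _ => isMatMul_opMatrix (u α) (pauli α)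

/-- A bounded measurable matrix-valued function defines a bounded multiplication operator. -/
lemma exists_isMatMul {M : Torus → Matrix (Fin 2) (Fin 2) ℂ}
    (hM : ∀ i j, Measurable fun k => M k i j) {C : ℝ} (hC : ∀ k i j, ‖M k i j‖ ≤ C) :
    ∃ T, IsMatMul T M := by
  choose u hu using fun i j => exists_linfty (hM i j) (fun k => hC k i j)
  refine ⟨∑ i, ∑ j, opMatrix (mulOp (u i j)) (Matrix.single i j 1),
    (IsMatMul.sum _ fun i _ => IsMatMul.sum _ fun j _ => isMatMul_opMatrix _ _).congr ?_⟩
  have : ∀ᵐ k ∂torusMeasure, ∀ i j, u i j k = M k i j :=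
    ae_all_iff.2 fun i => ae_all_iff.2 fun j => hu i j
  filter_upwards [this] with k hk
  simp only [hk]
  conv_rhs => rw [Matrix.matrix_eq_sum_single (M k)]
  simp [Matrix.smul_single]

/-- The inner product on `L²(𝕋) ⊕ L²(𝕋)` as an integral. -/
lemma inner_eq_integral (Φ Ψ : Dbl MomSpace) :
    ⟪Φ, Ψ⟫_ℂ = ∫ k, ∑ i, conj (Φ i k) * Ψ i k ∂torusMeasure := by
  rw [PiLp.inner_apply, integral_finsetSum]
  · refine Finset.sum_congr rfl fun i _ => ?_
    rw [L2.inner_def]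
    simp [mul_comm]
  · intro i _
    have := L2.integrable_inner (𝕜 := ℂ) (Φ i) (Ψ i)
    simpa [mul_comm] using this

/-! ### Spectral decomposition of a Hermitian `2 × 2` matrix in the Pauli basis -/

section Pointwise

variable (a : Fin 4 → ℝ)

/-- `u² = u₁² + u₂² + u₃²`. -/
def vecSq : ℝ := a 1 ^ 2 + a 2 ^ 2 + a 3 ^ 2

/-- The traceless part `u₁σ₁ + u₂σ₂ + u₃σ₃`. -/
def vecMat : Matrix (Fin 2) (Fin 2) ℂ :=
  !![(a 3 : ℂ), a 1 - a 2 * Complex.I; a 1 + a 2 * Complex.I, -a 3]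

/-- The Hermitian matrix `∑ u_α σ_α`. -/
def symb : Matrix (Fin 2) (Fin 2) ℂ := ∑ α, (a α : ℂ) • pauli α

/-- The eigenvalues `u₀ ± |u|` of `∑ u_α σ_α`; the sign is `s = ±1`. -/
def lam (s : ℝ) : ℝ := a 0 + s * √(vecSq a)

/-- The eigenprojections `(1 ± u·σ / |u|) / 2`. If `u = 0`, both are `1 / 2`, which is not a
projection, but all identities used below remain valid. -/
def eproj (s : ℝ) : Matrix (Fin 2) (Fin 2) ℂ :=
  (1 / 2 : ℂ) • (1 + ((s / √(vecSq a) : ℝ) : ℂ) • vecMat a)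

/-- The function `f` of the matrix `∑ u_α σ_α`. -/
def specFun (f : ℝ → ℂ) : Matrix (Fin 2) (Fin 2) ℂ :=
  f (lam a 1) • eproj a 1 + f (lam a (-1)) • eproj a (-1)

/-- The quadratic form `(v, P v)` of the eigenprojection `P` with sign `s`. -/
def dens (s : ℝ) (v : Fin 2 → ℂ) : ℝ := (∑ i, conj (v i) * ∑ j, eproj a s i j * v j).re

lemma vecSq_nonneg : 0 ≤ vecSq a := by unfold vecSq; positivity

lemma symb_eq : symb a = (a 0 : ℂ) • 1 + vecMat a := by
  ext i j
  fin_cases i <;> fin_cases j <;>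
    simp [symb, vecMat, pauli, Fin.sum_univ_four] <;> ring

lemma vecMat_mul_self : vecMat a * vecMat a = (vecSq a : ℂ) • 1 := by
  have hI : Complex.I ^ 2 = -1 := Complex.I_sq
  ext i j
  fin_cases i <;> fin_cases j <;> simp [vecMat, vecSq] <;> ring_nf <;> simp [hI]

lemma vecMat_eq_zero (h : vecSq a = 0) : vecMat a = 0 := by
  unfold vecSq at h
  have h1 : a 1 = 0 := by nlinarith [sq_nonneg (a 1), sq_nonneg (a 2), sq_nonneg (a 3)]
  have h2 : a 2 = 0 := by nlinarith [sq_nonneg (a 1), sq_nonneg (a 2), sq_nonneg (a 3)]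
  have h3 : a 3 = 0 := by nlinarith [sq_nonneg (a 1), sq_nonneg (a 2), sq_nonneg (a 3)]
  ext i j
  fin_cases i <;> fin_cases j <;> simp [vecMat, h1, h2, h3]

lemma vecMat_mul_eproj {s : ℝ} (hs : s ^ 2 = 1) :
    vecMat a * eproj a s = ((s * √(vecSq a) : ℝ) : ℂ) • eproj a s := by
  by_cases h : vecSq a = 0
  · simp [h, vecMat_eq_zero a h]
  have hr : √(vecSq a) ≠ 0 := by
    rwa [Ne, Real.sqrt_eq_zero (vecSq_nonneg a)]
  have h2 : √(vecSq a) ^ 2 = vecSq a := Real.sq_sqrt (vecSq_nonneg a)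
  have h3 : ((s / √(vecSq a) : ℝ) : ℂ) * (vecSq a : ℂ) = ((s * √(vecSq a) : ℝ) : ℂ) := by
    rw [← Complex.ofReal_mul]
    congr 1
    field_simp
    rw [h2]
  have h4 : ((s * √(vecSq a) : ℝ) : ℂ) * ((s / √(vecSq a) : ℝ) : ℂ) = 1 := by
    rw [← Complex.ofReal_mul, ← Complex.ofReal_one]
    congr 1
    field_simp
    exact hs
  simp only [eproj, Matrix.mul_smul, mul_add, mul_one, vecMat_mul_self, smul_smul, smul_add]
  rw [mul_assoc, h3, mul_left_comm, h4, mul_one, mul_comm (1 / 2 : ℂ), add_comm]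

lemma symb_mul_eproj {s : ℝ} (hs : s ^ 2 = 1) : symb a * eproj a s = (lam a s : ℂ) • eproj a s := by
  rw [symb_eq, add_mul, vecMat_mul_eproj a hs, smul_mul_assoc, one_mul, ← add_smul, lam]
  push_cast
  rfl

lemma eproj_add : eproj a 1 + eproj a (-1) = 1 := by
  simp only [eproj]
  push_cast
  module

lemma symb_pow (n : ℕ) : symb a ^ n = specFun a (fun x => (x : ℂ) ^ n) := by
  induction n with
  | zero => simp [specFun, eproj_add]
  | succ n ih =>
    rw [pow_succ', ih]
    simp only [specFun, mul_add, Matrix.mul_smul, symb_mul_eproj a (one_pow 2),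
      symb_mul_eproj a (neg_one_sq), smul_smul, pow_succ]

lemma dens_eq (s : ℝ) (v : Fin 2 → ℂ) : dens a s v =
    (1 / 2) * (‖v 0‖ ^ 2 + ‖v 1‖ ^ 2) + (s / (2 * √(vecSq a))) *
      (a 1 * (2 * (conj (v 0) * v 1).re) + a 2 * (2 * (conj (v 0) * v 1).im) +
        a 3 * (‖v 0‖ ^ 2 - ‖v 1‖ ^ 2)) := by
  simp only [dens, eproj, vecMat, ← Complex.normSq_eq_norm_sq, Complex.normSq_apply]
  simp [Fin.sum_univ_two]
  ring

lemma dens_nonneg {s : ℝ} (hs : s ^ 2 = 1) (v : Fin 2 → ℂ) : 0 ≤ dens a s v := by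
  rw [dens_eq]
  set q := a 1 * (2 * (conj (v 0) * v 1).re) + a 2 * (2 * (conj (v 0) * v 1).im) +
        a 3 * (‖v 0‖ ^ 2 - ‖v 1‖ ^ 2) with hq
  set m := ‖v 0‖ ^ 2 + ‖v 1‖ ^ 2 with hm
  have hm0 : 0 ≤ m := by positivity
  by_cases h : vecSq a = 0
  · simp only [h, Real.sqrt_zero, mul_zero, div_zero, zero_mul, add_zero]
    positivity
  have hr : 0 < √(vecSq a) :=
    Real.sqrt_pos.2 (lt_of_le_of_ne (vecSq_nonneg a) (Ne.symm h))
  have h2 : √(vecSq a) ^ 2 = vecSq a := Real.sq_sqrt (vecSq_nonneg a)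
  have hb : (2 * (conj (v 0) * v 1).re) ^ 2 + (2 * (conj (v 0) * v 1).im) ^ 2 +
      (‖v 0‖ ^ 2 - ‖v 1‖ ^ 2) ^ 2 = m ^ 2 := by
    simp only [hm, ← Complex.normSq_eq_norm_sq, Complex.normSq_apply]
    simp
    ring
  -- the Cauchy-Schwarz inequality in `ℝ³`
  have hcs : q ^ 2 ≤ (√(vecSq a) * m) ^ 2 := by
    rw [mul_pow, h2, ← hb, vecSq, hq]
    generalize 2 * (conj (v 0) * v 1).re = x
    generalize 2 * (conj (v 0) * v 1).im = y
    generalize ‖v 0‖ ^ 2 - ‖v 1‖ ^ 2 = z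
    nlinarith [sq_nonneg (a 1 * y - a 2 * x), sq_nonneg (a 1 * z - a 3 * x),
      sq_nonneg (a 2 * z - a 3 * y)]
  have hsq : (s * q) ^ 2 ≤ (√(vecSq a) * m) ^ 2 := by rwa [mul_pow, hs, one_mul]
  have habs := abs_le.1 (abs_le_of_sq_le_sq hsq (by positivity))
  have : 1 / 2 * m + s / (2 * √(vecSq a)) * q =
      (√(vecSq a) * m + s * q) / (2 * √(vecSq a)) := by
    field_simp
  rw [this]
  exact div_nonneg (by linarith [habs.1]) (by positivity)

lemma dens_add (v : Fin 2 → ℂ) : dens a 1 v + dens a (-1) v = ‖v 0‖ ^ 2 + ‖v 1‖ ^ 2 := by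
  rw [dens_eq, dens_eq]
  ring

lemma dens_le {s : ℝ} (hs : s = 1 ∨ s = -1) (v : Fin 2 → ℂ) :
    dens a s v ≤ ‖v 0‖ ^ 2 + ‖v 1‖ ^ 2 := by
  have h := dens_add a v
  have h1 := dens_nonneg a (one_pow 2) v
  have h2 := dens_nonneg a (neg_one_sq) v
  rcases hs with rfl | rfl <;> linarith

lemma abs_lam_le {C : ℝ} (hC : ∀ α, |a α| ≤ C) {s : ℝ} (hs : s ^ 2 = 1) : |lam a s| ≤ 4 * C := by
  have hs' : |s| = 1 := by
    rw [← sq_abs] at hs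
    nlinarith [abs_nonneg s]
  have hC0 : 0 ≤ C := (abs_nonneg _).trans (hC 0)
  have h1 : √(vecSq a) ≤ 3 * C := by
    refine Real.sqrt_le_iff.2 ⟨by positivity, ?_⟩
    have h : ∀ α, a α ^ 2 ≤ C ^ 2 := fun α => sq_le_sq' (abs_le.1 (hC α)).1 (abs_le.1 (hC α)).2
    have := h 1
    have := h 2
    have := h 3
    unfold vecSq
    nlinarith
  calc |lam a s| ≤ |a 0| + |s * √(vecSq a)| := abs_add_le _ _
    _ ≤ C + 3 * C := by
      rw [abs_mul, hs', one_mul, abs_of_nonneg (Real.sqrt_nonneg _)]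
      exact add_le_add (hC 0) h1
    _ = 4 * C := by ring

end Pointwise

/-! ### Spectral measures of multiplication operators -/

section FunctionalCalculus

variable {E : Type*} [NormedAddCommGroup E] [InnerProductSpace ℂ E] [CompleteSpace E]

/-- The continuous functional calculus `f(A)`. -/
def contFun (A : E →L[ℂ] E) (f : ℝ → ℝ) : E →L[ℂ] E := cfc f A

lemma integral_spectralMeasure_contFun (A : E →L[ℂ] E) (ψ : E) (f : C_c(ℝ, ℝ)) :
    ∫ x, f x ∂(spectralMeasure A ψ) = (⟪ψ, contFun A f ψ⟫_ℂ).re :=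
  integral_spectralMeasure A ψ f

/-- By the Weierstrass approximation theorem, `f(A)` is a norm limit of polynomials in `A` which
converge to `f` on a prescribed interval. -/
lemma exists_polynomial_tendsto_contFun {A : E →L[ℂ] E} (hA : IsSelfAdjoint A) {f : ℝ → ℝ}
    (hf : Continuous f) (K : ℝ) :
    ∃ p : ℕ → Polynomial ℝ,
      (∀ x, |x| ≤ K → Tendsto (fun n => (p n).eval x) atTop (𝓝 (f x))) ∧
      Tendsto (fun n => Polynomial.aeval A (p n)) atTop (𝓝 (contFun A f)) := by
  set R : ℝ := max (‖A‖ * ‖(1 : E →L[ℂ] E)‖) K with hR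
  have hex : ∀ n : ℕ, ∃ p : Polynomial ℝ, ∀ x ∈ Icc (-R) R, |p.eval x - f x| < 1 / ((n : ℝ) + 1) :=
    fun n => exists_polynomial_near_of_continuousOn (-R) R f hf.continuousOn _
      Nat.one_div_pos_of_nat
  choose p hp using hex
  refine ⟨p, fun x hx => ?_, ?_⟩
  · rw [tendsto_iff_norm_sub_tendsto_zero]
    exact squeeze_zero (fun _ => norm_nonneg _)
      (fun n => (hp n x (abs_le.1 (hx.trans (le_max_right _ _)))).le)
      tendsto_one_div_add_atTop_nhds_zero_nat
  · rw [tendsto_iff_norm_sub_tendsto_zero]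
    refine squeeze_zero (fun _ => norm_nonneg _) (fun n => ?_) tendsto_one_div_add_atTop_nhds_zero_nat
    rw [contFun, ← cfc_polynomial (p n) A hA, ← cfc_sub _ _ A]
    refine norm_cfc_le Nat.one_div_pos_of_nat.le fun x hx => ?_
    have hxR : |x| ≤ R := (spectrum.norm_le_norm_mul_of_mem hx).trans (le_max_left _ _)
    exact (hp n x (abs_le.1 hxR)).le

end FunctionalCalculus

lemma hat_add (A B : Dbl PosSpace →L[ℂ] Dbl PosSpace) : hat (A + B) = hat A + hat B := by
  ext1 Φ
  simp [hat]

lemma hat_smul (c : ℂ) (A : Dbl PosSpace →L[ℂ] Dbl PosSpace) : hat (c • A) = c • hat A := by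
  ext1 Φ
  simp [hat]

lemma hat_mul (A B : Dbl PosSpace →L[ℂ] Dbl PosSpace) : hat (A * B) = hat A * hat B := by
  ext1 Φ
  simp [hat]

lemma hat_one : hat 1 = 1 := by
  ext1 Φ
  simp [hat]

lemma hat_pow (A : Dbl PosSpace →L[ℂ] Dbl PosSpace) (n : ℕ) : hat (A ^ n) = hat A ^ n := by
  induction n with
  | zero => simp [hat_one]
  | succ n ih => rw [pow_succ, pow_succ, hat_mul, ih]

lemma hat_zero : hat 0 = 0 := by
  ext1 Φ
  simp [hat]

lemma hat_sum {ι : Type*} (s : Finset ι) (A : ι → Dbl PosSpace →L[ℂ] Dbl PosSpace) :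
    hat (∑ i ∈ s, A i) = ∑ i ∈ s, hat (A i) := by
  classical
  induction s using Finset.induction_on with
  | empty => simp [hat_zero]
  | insert a s ha ih => simp [Finset.sum_insert ha, hat_add, ih]

lemma continuous_hat : Continuous hat := by
  unfold hat
  fun_prop

lemma hat_apply (A : Dbl PosSpace →L[ℂ] Dbl PosSpace) (ψ : Dbl PosSpace) :
    hat A (dblFourier ψ) = dblFourier (A ψ) := by
  simp [hat]

lemma inner_hat (A : Dbl PosSpace →L[ℂ] Dbl PosSpace) (ψ : Dbl PosSpace) :
    ⟪ψ, A ψ⟫_ℂ = ⟪dblFourier ψ, hat A (dblFourier ψ)⟫_ℂ := by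
  rw [hat_apply, LinearIsometryEquiv.inner_map_map]

section SpectralMeasure

variable {H : Dbl PosSpace →L[ℂ] Dbl PosSpace} {a : Torus → Fin 4 → ℝ}

lemma isMatMul_aeval (hM : IsMatMul (hat H) (fun k => symb (a k))) (p : Polynomial ℝ) :
    IsMatMul (hat (Polynomial.aeval H p))
      (fun k => specFun (a k) (fun x => ((p.eval x : ℝ) : ℂ))) := by
  have h1 : hat (Polynomial.aeval H p) =
      ∑ i ∈ Finset.range (p.natDegree + 1), (p.coeff i : ℂ) • hat H ^ i := by
    rw [Polynomial.aeval_eq_sum_range, hat_sum]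
    refine Finset.sum_congr rfl fun i _ => ?_
    rw [← hat_pow, ← hat_smul]
    rfl
  rw [h1]
  refine (IsMatMul.sum _ fun i _ => (hM.pow i).smul (p.coeff i : ℂ)).congr
    (Eventually.of_forall fun k => ?_)
  simp only [symb_pow, specFun, Polynomial.eval_eq_sum_range, Complex.ofReal_sum, smul_add,
    smul_smul, Finset.sum_add_distrib, Finset.sum_smul, Complex.ofReal_mul, Complex.ofReal_pow]

/-- The continuous functional calculus acts on the eigenvalues of the symbol. -/
lemma isMatMul_contFun (hH : IsSelfAdjoint H) (hM : IsMatMul (hat H) (fun k => symb (a k))) {C : ℝ}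
    (hC : ∀ k α, |a k α| ≤ C) {f : ℝ → ℝ} (hf : Continuous f) :
    IsMatMul (hat (contFun H f)) (fun k => specFun (a k) (fun x => (f x : ℂ))) := by
  obtain ⟨p, hp, hlim⟩ := exists_polynomial_tendsto_contFun hH hf (4 * C)
  refine IsMatMul.of_tendsto (fun n => isMatMul_aeval hM (p n))
    ((continuous_hat.tendsto _).comp hlim) fun k => ?_
  have h1 := hp _ (abs_lam_le (a k) (hC k) (one_pow 2))
  have h2 := hp _ (abs_lam_le (a k) (hC k) neg_one_sq)
  exact (((Complex.continuous_ofReal.tendsto _).comp h1).smul_const _).add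
    (((Complex.continuous_ofReal.tendsto _).comp h2).smul_const _)

/-- The part of the spectral measure in the state `Φ` which comes from the eigenvalue `lam a s` of
the symbol. -/
def specPart (a : Torus → Fin 4 → ℝ) (Φ : Dbl MomSpace) (s : ℝ) : Measure ℝ :=
  Measure.map (fun k => lam (a k) s)
    (torusMeasure.withDensity fun k => ENNReal.ofReal (dens (a k) s fun i => Φ i k))

lemma measurable_vecSq (ha : ∀ α, Measurable fun k => a k α) : Measurable fun k => vecSq (a k) := by
  unfold vecSq
  have := ha 1
  have := ha 2
  have := ha 3
  fun_prop

lemma measurable_lam (ha : ∀ α, Measurable fun k => a k α) (s : ℝ) : Measurable fun k => lam (a k) s := by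
  unfold lam
  exact (ha 0).add ((measurable_vecSq ha).sqrt.const_mul s)

lemma measurable_dens (ha : ∀ α, Measurable fun k => a k α) (Φ : Dbl MomSpace) (s : ℝ) :
    Measurable fun k => dens (a k) s fun i => Φ i k := by
  have h0 : Measurable fun k => Φ 0 k := (Lp.stronglyMeasurable (Φ 0)).measurable
  have h1 : Measurable fun k => Φ 1 k := (Lp.stronglyMeasurable (Φ 1)).measurable
  have hw := measurable_vecSq ha
  have := ha 1
  have := ha 2
  have := ha 3
  simp only [dens_eq]
  have hc : Measurable fun k => conj (Φ 0 k) * Φ 1 k :=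
    (Complex.continuous_conj.measurable.comp h0).mul h1
  have hre := Complex.measurable_re.comp hc
  have him := Complex.measurable_im.comp hc
  simp only [Function.comp_def] at hre him
  fun_prop

lemma integrable_normSq (Φ : Dbl MomSpace) :
    Integrable (fun k => ‖Φ 0 k‖ ^ 2 + ‖Φ 1 k‖ ^ 2) torusMeasure :=
  ((Lp.memLp (Φ 0)).integrable_norm_pow (by norm_num)).add
    ((Lp.memLp (Φ 1)).integrable_norm_pow (by norm_num))

lemma integrable_dens (ha : ∀ α, Measurable fun k => a k α) (Φ : Dbl MomSpace) {s : ℝ} (hs : s = 1 ∨ s = -1) :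
    Integrable (fun k => dens (a k) s fun i => Φ i k) torusMeasure := by
  have hs2 : s ^ 2 = 1 := by rcases hs with rfl | rfl <;> norm_num
  refine (integrable_normSq Φ).mono' (measurable_dens ha Φ s).aestronglyMeasurable
    (Eventually.of_forall fun k => ?_)
  rw [Real.norm_of_nonneg (dens_nonneg _ hs2 _)]
  exact dens_le _ hs _

lemma isFiniteMeasure_specPart (ha : ∀ α, Measurable fun k => a k α) (Φ : Dbl MomSpace) {s : ℝ} (hs : s = 1 ∨ s = -1) :
    IsFiniteMeasure (specPart a Φ s) := by
  have := isFiniteMeasure_withDensity_ofReal (integrable_dens ha Φ hs).2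
  exact Measure.isFiniteMeasure_map _ _

lemma integral_specPart (ha : ∀ α, Measurable fun k => a k α) (Φ : Dbl MomSpace) {s : ℝ} (hs : s = 1 ∨ s = -1) {f : ℝ → ℝ}
    (hf : Continuous f) :
    ∫ x, f x ∂(specPart a Φ s) =
      ∫ k, f (lam (a k) s) * dens (a k) s (fun i => Φ i k) ∂torusMeasure := by
  have hs2 : s ^ 2 = 1 := by rcases hs with rfl | rfl <;> norm_num
  rw [specPart, integral_map (measurable_lam ha s).aemeasurable hf.aestronglyMeasurable]
  rw [integral_withDensity_eq_integral_toReal_smul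
    (measurable_dens ha Φ s).ennreal_ofReal (Eventually.of_forall fun k => ENNReal.ofReal_lt_top)]
  refine integral_congr_ae (Eventually.of_forall fun k => ?_)
  simp only [ENNReal.toReal_ofReal (dens_nonneg (a k) hs2 _), smul_eq_mul, mul_comm]

/-- The spectral measure of the state `ψ` is the sum of the images under the two eigenvalues of the
symbol of the measures with densities `(ψ(k), P_±(k) ψ(k))`. -/
theorem spectralMeasure_eq (ha : ∀ α, Measurable fun k => a k α) (hH : IsSelfAdjoint H)
    (hM : IsMatMul (hat H) (fun k => symb (a k)))
    {C : ℝ} (hC : ∀ k α, |a k α| ≤ C) (ψ : Dbl PosSpace) :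
    spectralMeasure H ψ = specPart a (dblFourier ψ) 1 + specPart a (dblFourier ψ) (-1) := by
  set Φ := dblFourier ψ with hΦ
  have hf1 := isFiniteMeasure_specPart ha Φ (Or.inl rfl)
  have hf2 := isFiniteMeasure_specPart ha Φ (Or.inr rfl)
  refine Measure.ext_of_integral_eq_on_compactlySupported fun f => ?_
  have hi : ∀ μ : Measure ℝ, [IsFiniteMeasure μ] → Integrable (fun x => f x) μ := fun μ _ =>
    f.continuous.integrable_of_hasCompactSupport f.hasCompactSupport
  obtain ⟨K, hK⟩ := f.hasCompactSupport.exists_bound_of_continuous f.continuous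
  have hint : ∀ s : ℝ, s = 1 ∨ s = -1 → Integrable
      (fun k => f (lam (a k) s) * dens (a k) s (fun i => Φ i k)) torusMeasure := by
    intro s hs
    refine (integrable_dens ha Φ hs).bdd_mul
      (f.continuous.measurable.comp (measurable_lam ha s)).aestronglyMeasurable
      (Eventually.of_forall fun k => hK _)
  rw [integral_spectralMeasure_contFun, integral_add_measure (hi _) (hi _),
    integral_specPart ha Φ (Or.inl rfl) (f := f) f.continuous,
    integral_specPart ha Φ (Or.inr rfl) (f := f) f.continuous, ← integral_add (hint 1 (Or.inl rfl))
    (hint (-1) (Or.inr rfl)), inner_hat, ← hΦ, inner_eq_integral]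
  have hTΦ := fun i => isMatMul_contFun hH hM hC (f := f) f.continuous Φ i
  have hae : ∀ᵐ k ∂torusMeasure, ∑ i, conj (Φ i k) * hat (contFun H f) Φ i k =
      ∑ i, conj (Φ i k) * ∑ j, specFun (a k) (fun x => (f x : ℂ)) i j * Φ j k := by
    filter_upwards [hTΦ 0, hTΦ 1] with k h0 h1
    rw [Fin.sum_univ_two, Fin.sum_univ_two, h0, h1]
  have hpt : ∀ k, (∑ i, conj (Φ i k) * ∑ j, specFun (a k) (fun x => (f x : ℂ)) i j * Φ j k).re =
      f (lam (a k) 1) * dens (a k) 1 (fun i => Φ i k) +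
        f (lam (a k) (-1)) * dens (a k) (-1) (fun i => Φ i k) := by
    intro k
    simp only [dens, ← Complex.re_ofReal_mul, ← Complex.add_re]
    congr 1
    simp only [specFun, Fin.sum_univ_two, Matrix.add_apply, Matrix.smul_apply, smul_eq_mul]
    ring
  have hI : Integrable (fun k => ∑ i, conj (Φ i k) * hat (contFun H f) Φ i k)
      torusMeasure := by
    refine integrable_finsetSum _ fun i _ => ?_
    have := L2.integrable_inner (𝕜 := ℂ) (Φ i) (hat (contFun H f) Φ i)
    simpa [mul_comm] using this
  have hre := integral_re hI
  simp only [RCLike.re_to_complex] at hre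
  rw [← hre]
  refine integral_congr_ae ?_
  filter_upwards [hae] with k hk
  rw [hk, hpt]

lemma specPart_null (ha : ∀ α, Measurable fun k => a k α) (Φ : Dbl MomSpace) {s : ℝ} (hs : s ^ 2 = 1) {B : Set ℝ}
    (hB : MeasurableSet B) : specPart a Φ s B = 0 ↔
      ∀ᵐ k ∂torusMeasure, lam (a k) s ∈ B → dens (a k) s (fun i => Φ i k) = 0 := by
  have hpre := measurable_lam ha s hB
  rw [specPart, Measure.map_apply (measurable_lam ha s) hB, withDensity_apply _ hpre,
    lintegral_eq_zero_iff (measurable_dens ha Φ s).ennreal_ofReal,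
    Filter.EventuallyEq, ae_restrict_iff' hpre]
  refine eventually_congr (Eventually.of_forall fun k => ?_)
  simp only [mem_preimage, Pi.zero_apply, ENNReal.ofReal_eq_zero]
  exact imp_congr_right fun _ => ⟨fun h => le_antisymm h (dens_nonneg _ hs _), fun h => h.le⟩

/-- The null sets of the spectral measure. -/
lemma spectralMeasure_null (ha : ∀ α, Measurable fun k => a k α) (hH : IsSelfAdjoint H)
    (hM : IsMatMul (hat H) (fun k => symb (a k))) {C : ℝ} (hC : ∀ k α, |a k α| ≤ C)
    (ψ : Dbl PosSpace) {B : Set ℝ} (hB : MeasurableSet B) :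
    spectralMeasure H ψ B = 0 ↔ ∀ᵐ k ∂torusMeasure,
      (lam (a k) 1 ∈ B → dens (a k) 1 (fun i => dblFourier ψ i k) = 0) ∧
      (lam (a k) (-1) ∈ B → dens (a k) (-1) (fun i => dblFourier ψ i k) = 0) := by
  rw [spectralMeasure_eq ha hH hM hC, Measure.add_apply, add_eq_zero,
    specPart_null ha _ (one_pow 2) hB, specPart_null ha _ neg_one_sq hB, ← eventually_and]

lemma eq_zero_of_spectralMeasure_univ (ha : ∀ α, Measurable fun k => a k α) (hH : IsSelfAdjoint H)
    (hM : IsMatMul (hat H) (fun k => symb (a k))) {C : ℝ} (hC : ∀ k α, |a k α| ≤ C)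
    {ψ : Dbl PosSpace} (h : spectralMeasure H ψ univ = 0) : ψ = 0 := by
  rw [spectralMeasure_null ha hH hM hC ψ MeasurableSet.univ] at h
  have h0 : dblFourier ψ = 0 := by
    refine PiLp.ext fun i => Lp.ext ?_
    have hz : ((0 : Dbl MomSpace) i) = 0 := rfl
    rw [hz]
    filter_upwards [h, Lp.coeFn_zero ℂ 2 torusMeasure] with k hk hk0
    have hsum := dens_add (a k) (fun i => dblFourier ψ i k)
    rw [hk.1 trivial, hk.2 trivial] at hsum
    rw [hk0]
    have h1 : ‖dblFourier ψ 0 k‖ = 0 := by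
      nlinarith [sq_nonneg ‖dblFourier ψ 0 k‖, sq_nonneg ‖dblFourier ψ 1 k‖]
    have h2 : ‖dblFourier ψ 1 k‖ = 0 := by
      nlinarith [sq_nonneg ‖dblFourier ψ 0 k‖, sq_nonneg ‖dblFourier ψ 1 k‖]
    fin_cases i
    · exact norm_eq_zero.1 h1
    · exact norm_eq_zero.1 h2
  simpa using h0

end SpectralMeasure

/-! ### Spectral subspaces in the extreme cases -/

section Abstract

variable {E : Type*} [NormedAddCommGroup E] [InnerProductSpace ℂ E] [CompleteSpace E]

lemma projOnto_top : projOnto (⊤ : Submodule ℂ E) = 1 := by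
  have h : (⊤ : Submodule ℂ E).topologicalClosure = ⊤ :=
    top_le_iff.1 (Submodule.le_topologicalClosure _)
  unfold projOnto
  ext x
  have hx : x ∈ (⊤ : Submodule ℂ E).topologicalClosure := by rw [h]; trivial
  exact Submodule.starProjection_eq_self_iff.2 hx

lemma projOnto_bot : projOnto (⊥ : Submodule ℂ E) = 0 := by
  have h : (⊥ : Submodule ℂ E).topologicalClosure = ⊥ := by simp
  unfold projOnto
  ext x
  have hx : ∀ y ∈ (⊥ : Submodule ℂ E).topologicalClosure, ⟪y, x⟫_ℂ = 0 := by
    rw [h]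
    rintro y hy
    rw [(Submodule.mem_bot ℂ).1 hy, inner_zero_left]
  exact (Submodule.starProjection_apply_eq_zero_iff _).2 ((Submodule.mem_orthogonal _ _).2 hx)

variable {A : E →L[ℂ] E}

lemma measure_univ_eq_zero {μ : Measure ℝ} {B : Set ℝ} (h : μ B = 0) (h' : μ Bᶜ = 0) :
    μ univ = 0 := by
  rw [← union_compl_self B]
  exact measure_union_null h h'

lemma projections_of_pp (hA : ∀ ψ, spectralMeasure A ψ univ = 0 → ψ = 0)
    (h : ppSubspace A = ⊤) : ppProj A = 1 ∧ acProj A = 0 ∧ scProj A = 0 := by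
  have hC : ∀ ψ, ∃ C : Set ℝ, C.Countable ∧ spectralMeasure A ψ Cᶜ = 0 := fun ψ => by
    have : ψ ∈ ppSubspace A := h ▸ Submodule.mem_top
    exact this
  have hac : acSubspace A = ⊥ := by
    refine (Submodule.eq_bot_iff _).2 fun ψ hψ => hA ψ ?_
    obtain ⟨C, hC, h0⟩ := hC ψ
    exact measure_univ_eq_zero (hψ (hC.measure_zero volume)) h0
  have hsc : scSubspace A = ⊥ := by
    refine (Submodule.eq_bot_iff _).2 fun ψ hψ => hA ψ ?_
    obtain ⟨C, hC, h0⟩ := hC ψ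
    refine measure_univ_eq_zero ?_ h0
    rw [← biUnion_of_singleton C]
    exact (measure_biUnion_null_iff hC).2 fun x _ => hψ.1 x
  rw [ppProj, acProj, scProj, h, hac, hsc]
  exact ⟨projOnto_top, projOnto_bot, projOnto_bot⟩

lemma projections_of_ac (hA : ∀ ψ, spectralMeasure A ψ univ = 0 → ψ = 0)
    (h : acSubspace A = ⊤) : ppProj A = 0 ∧ acProj A = 1 ∧ scProj A = 0 := by
  have hac : ∀ ψ, spectralMeasure A ψ ≪ volume := fun ψ => by
    have : ψ ∈ acSubspace A := h ▸ Submodule.mem_top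
    exact this
  have hpp : ppSubspace A = ⊥ := by
    refine (Submodule.eq_bot_iff _).2 fun ψ hψ => hA ψ ?_
    obtain ⟨C, hC, h0⟩ := hψ
    exact measure_univ_eq_zero (hac ψ (hC.measure_zero volume)) h0
  have hsc : scSubspace A = ⊥ := by
    refine (Submodule.eq_bot_iff _).2 fun ψ hψ => hA ψ ?_
    obtain ⟨N, hN, h0⟩ := hψ.2
    exact measure_univ_eq_zero (hac ψ hN) h0
  rw [ppProj, acProj, scProj, h, hpp, hsc]
  exact ⟨projOnto_bot, projOnto_top, projOnto_bot⟩

/-- If all spectral measures are absolutely continuous away from `0`, then `0` is the only possible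
eigenvalue and there is no singularly continuous spectrum. -/
lemma subspaces_of_ac_off_zero (hA : ∀ ψ, spectralMeasure A ψ univ = 0 → ψ = 0)
    (h : ∀ ψ B, volume B = 0 → (0 : ℝ) ∉ B → spectralMeasure A ψ B = 0) :
    ppSubspace A = spectralSubspace A {0} ∧ scSubspace A = ⊥ := by
  refine ⟨le_antisymm ?_ ?_, ?_⟩
  · rintro ψ ⟨C, hC, h0⟩
    have h1 : spectralMeasure A ψ (C \ {0}) = 0 :=
      h ψ _ ((hC.mono sdiff_subset).measure_zero volume) (by simp)
    refine measure_mono_null (fun x hx => ?_) (measure_union_null h0 h1)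
    by_cases hxC : x ∈ C
    · exact Or.inr ⟨hxC, hx⟩
    · exact Or.inl hxC
  · intro ψ hψ
    exact ⟨{0}, countable_singleton 0, hψ⟩
  · refine (Submodule.eq_bot_iff _).2 fun ψ hψ => hA ψ ?_
    obtain ⟨N, hN, h0⟩ := hψ.2
    have h1 : spectralMeasure A ψ (N \ {0}) = 0 :=
      h ψ _ (measure_mono_null sdiff_subset hN) (by simp)
    refine measure_mono_null (fun x _ => ?_)
      (measure_union_null h0 (measure_union_null h1 (hψ.1 0)))
    by_cases hxN : x ∈ N
    · by_cases hx0 : x = 0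
      · exact Or.inr (Or.inr hx0)
      · exact Or.inr (Or.inl ⟨hxN, hx0⟩)
    · exact Or.inl hxN

end Abstract

/-! ### Real analytic functions of one variable -/

lemma ae_ne_zero_of_analytic {f : ℝ → ℝ} (hf : AnalyticOnNhd ℝ f univ) (h : ∃ x, f x ≠ 0) :
    ∀ᵐ x, f x ≠ 0 := by
  obtain ⟨x₀, hx₀⟩ := h
  have h1 := hf.preimage_zero_mem_codiscreteWithin hx₀ (mem_univ _) isConnected_univ
  have h2 := ae_restrict_le_codiscreteWithin (μ := (volume : Measure ℝ)) MeasurableSet.univ h1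
  rw [Measure.restrict_univ] at h2
  filter_upwards [h2] with x hx
  simpa using hx

/-- Where its derivative does not vanish, a function pulls Lebesgue null sets back to null sets:
locally it has a Lipschitz inverse. -/
lemma volume_preimage_null {f f' : ℝ → ℝ} {S : Set ℝ}
    (h : ∀ x ∈ S, HasStrictDerivAt f (f' x) x ∧ f' x ≠ 0) {B : Set ℝ} (hB : volume B = 0) :
    volume (S ∩ f ⁻¹' B) = 0 := by
  refine measure_null_of_locally_null _ fun x hx => ?_
  obtain ⟨hd, hne⟩ := h x hx.1
  set c : ℝ≥0 := ‖f' x‖₊ / 2 with hc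
  have hcpos : 0 < c := by
    have : 0 < ‖f' x‖₊ := nnnorm_pos.2 hne
    positivity
  obtain ⟨t, ht, happ⟩ := hd.hasStrictFDerivAt.approximates_deriv_on_nhds (Or.inr hcpos)
  have hlow : ∀ y ∈ t, ∀ z ∈ t, dist y z ≤ (c⁻¹ : ℝ≥0) * dist (f y) (f z) := by
    intro y hy z hz
    have h1 := happ y hy z hz
    have h2 : ‖(ContinuousLinearMap.toSpanSingleton ℝ (f' x)) (y - z)‖ = 2 * c * ‖y - z‖ := by
      rw [ContinuousLinearMap.toSpanSingleton_apply, norm_smul, hc]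
      push_cast
      ring
    have h3 := norm_sub_norm_le ((ContinuousLinearMap.toSpanSingleton ℝ (f' x)) (y - z))
      (f y - f z)
    rw [norm_sub_rev] at h1
    rw [h2] at h3
    rw [Real.dist_eq, Real.dist_eq, ← Real.norm_eq_abs, ← Real.norm_eq_abs, NNReal.coe_inv,
      inv_mul_eq_div, le_div_iff₀ (by exact_mod_cast hcpos)]
    nlinarith
  refine ⟨t ∩ (S ∩ f ⁻¹' B), inter_mem (mem_nhdsWithin_of_mem_nhds ht) self_mem_nhdsWithin, ?_⟩
  have hinj : InjOn f t := by
    intro y hy z hz hyz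
    have := hlow y hy z hz
    rw [hyz, dist_self, mul_zero] at this
    exact dist_le_zero.1 this
  have hinv : ∀ y ∈ t, Function.invFunOn f t (f y) = y := fun y hy =>
    hinj.leftInvOn_invFunOn hy
  have hlip : LipschitzOnWith c⁻¹ (Function.invFunOn f t) (f '' t) := by
    refine LipschitzOnWith.of_dist_le_mul ?_
    rintro _ ⟨y, hy, rfl⟩ _ ⟨z, hz, rfl⟩
    rw [hinv y hy, hinv z hz]
    exact hlow y hy z hz
  have hsub : t ∩ (S ∩ f ⁻¹' B) ⊆ Function.invFunOn f t '' (B ∩ f '' t) := by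
    rintro y ⟨hy, -, hyB⟩
    exact ⟨f y, ⟨hyB, y, hy, rfl⟩, hinv y hy⟩
  refine measure_mono_null hsub ?_
  have h4 := (hlip.mono inter_subset_right).hausdorffMeasure_image_le (d := 1) (s := B ∩ f '' t)
    zero_le_one
  rw [MeasureTheory.hausdorffMeasure_real, measure_mono_null inter_subset_left hB, mul_zero] at h4
  exact le_antisymm h4 zero_le

/-! ### Analytic symbols -/

/-- The Pauli coefficient functions of the operators under consideration: real analytic, periodic
functions for which `u₀` is odd and `u²` is even. -/
structure IsSymbol (u : Fin 4 → ℝ → ℝ) : Prop where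
  analytic : ∀ α, AnalyticOnNhd ℝ (u α) univ
  periodic : ∀ α, Function.Periodic (u α) (2 * π)
  odd : ∀ x, u 0 (-x) = -u 0 x
  even : ∀ x, vecSq (fun α => u α (-x)) = vecSq (fun α => u α x)

/-- The function `u² = u₁² + u₂² + u₃²`. -/
def usq (u : Fin 4 → ℝ → ℝ) (x : ℝ) : ℝ := vecSq fun α => u α x

/-- `4 u₀'² u² - ((u²)')²`, which is `4 u²` times the product of the derivatives of the eigenvalues
`u₀ ± |u|`. -/
def discr (u : Fin 4 → ℝ → ℝ) (x : ℝ) : ℝ := 4 * deriv (u 0) x ^ 2 * usq u x - deriv (usq u) x ^ 2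

/-- The symbol has no constant eigenvalue: the derivatives of the eigenvalues `u₀ ± |u|` do not
vanish, except possibly on a null set. The case `u = 0` is separate because `discr` vanishes there. -/
def Dispersive (u : Fin 4 → ℝ → ℝ) : Prop :=
  (∃ x, discr u x ≠ 0) ∨ ((∀ x, usq u x = 0) ∧ ∃ x, deriv (u 0) x ≠ 0)

/-- The values of the coefficient functions on the circle. -/
def onTorus (u : Fin 4 → ℝ → ℝ) (k : Torus) (α : Fin 4) : ℝ := u α (rep k)

namespace IsSymbol

variable {u : Fin 4 → ℝ → ℝ}

lemma analytic_usq (hu : IsSymbol u) : AnalyticOnNhd ℝ (usq u) univ := by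
  unfold usq vecSq
  exact (((hu.analytic 1).pow 2).add ((hu.analytic 2).pow 2)).add ((hu.analytic 3).pow 2)

lemma analytic_discr (hu : IsSymbol u) : AnalyticOnNhd ℝ (discr u) univ := by
  unfold discr
  exact ((analyticOnNhd_const.mul ((hu.analytic 0).deriv.pow 2)).mul hu.analytic_usq).sub
    (hu.analytic_usq.deriv.pow 2)

lemma continuous (hu : IsSymbol u) (α : Fin 4) : Continuous (u α) :=
  continuousOn_univ.1 (hu.analytic α).continuousOn

lemma measurable (hu : IsSymbol u) (α : Fin 4) : Measurable fun k => onTorus u k α :=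
  (hu.continuous α).measurable.comp measurable_rep

lemma exists_bound {f : ℝ → ℝ} (hf : Continuous f) : ∃ C, ∀ k, |f (rep k)| ≤ C := by
  obtain ⟨C, hC⟩ := isCompact_Icc.exists_bound_of_continuousOn (s := Icc (-π) π) hf.continuousOn
  exact ⟨C, fun k => hC _ (rep_mem_Icc k)⟩

lemma bounded (hu : IsSymbol u) : ∃ C, ∀ k α, |onTorus u k α| ≤ C := by
  choose C hC using fun α => exists_bound (hu.continuous α)
  refine ⟨∑ α, |C α|, fun k α => ((hC α k).trans (le_abs_self _)).trans ?_⟩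
  exact Finset.single_le_sum (f := fun α => |C α|) (fun _ _ => abs_nonneg _) (Finset.mem_univ α)

lemma hasDerivAt (hu : IsSymbol u) (α : Fin 4) (x : ℝ) : HasDerivAt (u α) (deriv (u α) x) x :=
  (hu.analytic α x (mem_univ _)).differentiableAt.hasDerivAt

lemma hasDerivAt_usq (hu : IsSymbol u) (x : ℝ) : HasDerivAt (usq u) (deriv (usq u) x) x :=
  (hu.analytic_usq x (mem_univ _)).differentiableAt.hasDerivAt

lemma deriv_usq (hu : IsSymbol u) (x : ℝ) : deriv (usq u) x =
    2 * (u 1 x * deriv (u 1) x + u 2 x * deriv (u 2) x + u 3 x * deriv (u 3) x) := by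
  have h := (((hu.hasDerivAt 1 x).pow 2).add ((hu.hasDerivAt 2 x).pow 2)).add
    ((hu.hasDerivAt 3 x).pow 2)
  have h2 : usq u = fun x => u 1 x ^ 2 + u 2 x ^ 2 + u 3 x ^ 2 := rfl
  rw [h2]
  refine h.deriv.trans ?_
  push_cast
  ring

lemma hasStrictDerivAt_lam (hu : IsSymbol u) (s : ℝ) {x : ℝ} (hx : usq u x ≠ 0) :
    HasStrictDerivAt (fun x => lam (fun α => u α x) s)
      (deriv (u 0) x + s * (deriv (usq u) x / (2 * √(usq u x)))) x := by
  have h0 := (hu.analytic 0 x (mem_univ _)).hasStrictDerivAt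
  have h1 := (hu.analytic_usq x (mem_univ _)).hasStrictDerivAt
  have h2 := (Real.hasStrictDerivAt_sqrt hx).comp x h1
  have h3 := h0.add (h2.const_mul s)
  have h4 : 1 / (2 * √(usq u x)) * deriv (usq u) x = deriv (usq u) x / (2 * √(usq u x)) := by ring
  rw [h4] at h3
  exact h3

lemma deriv_lam_ne_zero {s : ℝ} (hs : s ^ 2 = 1) {x : ℝ} (hx : usq u x ≠ 0)
    (hd : discr u x ≠ 0) : deriv (u 0) x + s * (deriv (usq u) x / (2 * √(usq u x))) ≠ 0 := by
  intro h
  apply hd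
  have h2 : √(usq u x) ^ 2 = usq u x := Real.sq_sqrt (vecSq_nonneg _)
  have hr : √(usq u x) ≠ 0 := Real.sqrt_ne_zero'.2 (lt_of_le_of_ne (vecSq_nonneg _) (Ne.symm hx))
  have h3 : deriv (u 0) x * (2 * √(usq u x)) = -(s * deriv (usq u) x) := by
    field_simp at h
    linarith
  have h4 := congrArg (· ^ 2) h3
  simp only [mul_pow, neg_sq, h2, hs] at h4
  unfold discr
  linarith

lemma exists_usq_ne_zero (h : ∃ x, discr u x ≠ 0) : ∃ x, usq u x ≠ 0 := by
  by_contra! hw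
  obtain ⟨x, hx⟩ := h
  have h1 : usq u = fun _ => 0 := funext hw
  apply hx
  simp [discr, h1]

/-- For a dispersive symbol, the eigenvalues pull Lebesgue null sets back to null sets. -/
lemma ae_lam_notMem (hu : IsSymbol u) (hd : Dispersive u) {s : ℝ} (hs : s ^ 2 = 1) {B : Set ℝ}
    (hB : volume B = 0) : ∀ᵐ k ∂torusMeasure, lam (onTorus u k) s ∉ B := by
  suffices h : ∀ᵐ x, lam (fun α => u α x) s ∉ B from
    ae_rep (p := fun x => lam (fun α => u α x) s ∉ B) (ae_restrict_of_ae h)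
  rcases hd with hd | ⟨hw, h0⟩
  · have h1 := volume_preimage_null (f := fun x => lam (fun α => u α x) s)
      (f' := fun x => deriv (u 0) x + s * (deriv (usq u) x / (2 * √(usq u x))))
      (S := {x | usq u x ≠ 0 ∧ discr u x ≠ 0})
      (fun x hx => ⟨hu.hasStrictDerivAt_lam s hx.1, deriv_lam_ne_zero hs hx.1 hx.2⟩) hB
    filter_upwards [measure_eq_zero_iff_ae_notMem.1 h1,
      ae_ne_zero_of_analytic hu.analytic_discr hd,
      ae_ne_zero_of_analytic hu.analytic_usq (exists_usq_ne_zero hd)] with x hx h2 h3 hmem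
    exact hx (show x ∈ _ ∩ _ from And.intro (And.intro h3 h2) hmem)
  · have h1 := volume_preimage_null (f := u 0) (f' := deriv (u 0)) (S := {x | deriv (u 0) x ≠ 0})
      (fun x hx => ⟨(hu.analytic 0 x (mem_univ _)).hasStrictDerivAt, hx⟩) hB
    filter_upwards [measure_eq_zero_iff_ae_notMem.1 h1,
      ae_ne_zero_of_analytic (hu.analytic 0).deriv h0] with x hx h2 hmem
    have h3 : lam (fun α => u α x) s = u 0 x := by
      have := hw x
      unfold usq at this
      simp [lam, this]
    rw [h3] at hmem
    exact hx ⟨h2, hmem⟩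

lemma eq_zero_of_deriv_eq_zero (hu : IsSymbol u) (h : ∀ x, deriv (u 0) x = 0) (x : ℝ) :
    u 0 x = 0 := by
  have h1 := is_const_of_deriv_eq_zero
    (fun x => (hu.hasDerivAt 0 x).differentiableAt) h x (-x)
  rw [hu.odd] at h1
  linarith

/-- A symbol is dispersive unless `u₀ = 0` and `u²` is constant, or `u₀² = u²`: if one of the
eigenvalues `u₀ ± |u|` is constant, then `u² = (u₀ + c)²` for some `c`, and parity forces
`c u₀ = 0`. -/
theorem not_dispersive (hu : IsSymbol u) (hd : ¬Dispersive u) :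
    ((∀ x, u 0 x = 0) ∧ ∀ x, deriv (usq u) x = 0) ∨ ∀ x, usq u x = u 0 x ^ 2 := by
  unfold Dispersive at hd
  push Not at hd
  obtain ⟨hD, hw0⟩ := hd
  by_cases hu0 : ∀ x, deriv (u 0) x = 0
  · refine Or.inl ⟨hu.eq_zero_of_deriv_eq_zero hu0, fun x => ?_⟩
    have := hD x
    rw [discr, hu0] at this
    nlinarith
  right
  have hu0' := hu0
  push Not at hu0
  have hw : ∃ x, usq u x ≠ 0 := by
    by_contra! h
    obtain ⟨x, hx⟩ := hu0
    exact hx (hw0 h x)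
  obtain ⟨x₀, hx1, hx2⟩ := ((ae_ne_zero_of_analytic (hu.analytic 0).deriv hu0).and
    (ae_ne_zero_of_analytic hu.analytic_usq hw)).exists
  -- on the open set `S`, the function `f` is a differentiable square root of `u²` with `f' = u₀'`
  set S := {x | deriv (u 0) x ≠ 0 ∧ usq u x ≠ 0} with hS
  have hSo : IsOpen S := by
    have h1 : Continuous (deriv (u 0)) := continuousOn_univ.1 (hu.analytic 0).deriv.continuousOn
    have h2 : Continuous (usq u) := continuousOn_univ.1 hu.analytic_usq.continuousOn
    exact (isOpen_ne_fun h1 continuous_const).inter (isOpen_ne_fun h2 continuous_const)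
  obtain ⟨ε, hε, hball⟩ := Metric.isOpen_iff.1 hSo x₀ ⟨hx1, hx2⟩
  set f : ℝ → ℝ := fun x => deriv (usq u) x / (2 * deriv (u 0) x) with hf
  have hfsq : ∀ x ∈ S, f x ^ 2 = usq u x := by
    rintro x ⟨h1, h2⟩
    have := hD x
    rw [discr] at this
    simp only [hf]
    field_simp
    linarith
  have hfd : ∀ x ∈ S, DifferentiableAt ℝ f x := by
    rintro x ⟨h1, h2⟩
    have d1 : DifferentiableAt ℝ (deriv (usq u)) x :=
      (hu.analytic_usq.deriv x (mem_univ _)).differentiableAt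
    have d2 : DifferentiableAt ℝ (deriv (u 0)) x :=
      ((hu.analytic 0).deriv x (mem_univ _)).differentiableAt
    exact d1.div (d2.const_mul 2) (by simpa using h1)
  have hfder : ∀ x ∈ S, deriv f x = deriv (u 0) x := by
    intro x hx
    have e1 : (fun y => f y ^ 2) =ᶠ[𝓝 x] usq u :=
      Filter.eventually_of_mem (hSo.mem_nhds hx) hfsq
    have e2 := e1.deriv_eq
    have e3 := ((hfd x hx).hasDerivAt.pow 2).deriv
    have e5 : deriv (fun y => f y ^ 2) x = 2 * f x * deriv f x := by
      refine e3.trans ?_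
      push_cast
      ring
    have hfx : f x ≠ 0 := by
      intro h0
      apply hx.2
      rw [← hfsq x hx, h0]
      norm_num
    have e4 : deriv (usq u) x = 2 * deriv (u 0) x * f x := by
      have := hx.1
      simp only [hf]
      field_simp
    rw [e5, e4] at e2
    have : f x * (deriv f x - deriv (u 0) x) = 0 := by linarith
    rcases mul_eq_zero.1 this with h | h
    · exact absurd h hfx
    · linarith
  have hconst : ∀ x ∈ Metric.ball x₀ ε, f x - u 0 x = f x₀ - u 0 x₀ := by
    intro x hx
    refine IsOpen.is_const_of_deriv_eq_zero (f := fun x => f x - u 0 x) Metric.isOpen_ball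
      (convex_ball x₀ ε).isPreconnected (fun y hy => ?_) (fun y hy => ?_) hx
      (Metric.mem_ball_self hε)
    · exact ((hfd y (hball hy)).sub (hu.hasDerivAt 0 y).differentiableAt).differentiableWithinAt
    · have := ((hfd y (hball hy)).hasDerivAt.sub (hu.hasDerivAt 0 y)).deriv
      refine this.trans ?_
      rw [hfder y (hball hy), sub_self]
      rfl
  set c := f x₀ - u 0 x₀ with hc
  have hglob : EqOn (usq u) (fun x => (u 0 x + c) ^ 2) univ := by
    refine hu.analytic_usq.eqOn_of_preconnected_of_eventuallyEq
      (((hu.analytic 0).add analyticOnNhd_const).pow 2) isPreconnected_univ (mem_univ x₀) ?_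
    filter_upwards [Metric.ball_mem_nhds x₀ hε] with x hx
    rw [← hfsq x (hball hx), ← hconst x hx]
    simp
  have hpar : ∀ x, c * u 0 x = 0 := by
    intro x
    have h1 := hglob (mem_univ x)
    have h2 := hglob (mem_univ (-x))
    have h3 : usq u (-x) = usq u x := hu.even x
    simp only [hu.odd] at h2
    rw [h3, h1] at h2
    simp only at h2
    nlinarith
  have hc0 : c = 0 := by
    by_contra hne
    apply hu0'
    have : u 0 = fun _ => 0 := funext fun x => (mul_eq_zero.1 (hpar x)).resolve_left hne
    simp [this]
  intro x
  have := hglob (mem_univ x)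
  simpa [hc0] using this

end IsSymbol

/-! ### Pure point, absolutely continuous and mixed spectrum -/

section Projections

variable {H : Dbl PosSpace →L[ℂ] Dbl PosSpace} {u : Fin 4 → ℝ → ℝ}

lemma eq_zero_of_null (hu : IsSymbol u) (hH : IsSelfAdjoint H)
    (hM : IsMatMul (hat H) (fun k => symb (onTorus u k))) (ψ : Dbl PosSpace)
    (h : spectralMeasure H ψ univ = 0) : ψ = 0 := by
  obtain ⟨C, hC⟩ := hu.bounded
  exact eq_zero_of_spectralMeasure_univ hu.measurable hH hM hC h

/-- A dispersive symbol has purely absolutely continuous spectrum. -/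
theorem projections_of_dispersive (hu : IsSymbol u) (hH : IsSelfAdjoint H)
    (hM : IsMatMul (hat H) (fun k => symb (onTorus u k))) (hd : Dispersive u) :
    ppProj H = 0 ∧ acProj H = 1 ∧ scProj H = 0 := by
  obtain ⟨C, hC⟩ := hu.bounded
  refine projections_of_ac (eq_zero_of_null hu hH hM) (top_le_iff.1 fun ψ _ => ?_)
  refine Measure.AbsolutelyContinuous.mk fun B hB h0 => ?_
  rw [spectralMeasure_null hu.measurable hH hM hC ψ hB]
  filter_upwards [hu.ae_lam_notMem hd (one_pow 2) h0, hu.ae_lam_notMem hd neg_one_sq h0] with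
    k h1 h2
  exact ⟨fun h => absurd h h1, fun h => absurd h h2⟩

/-- If both eigenvalues of the symbol are constant, the spectrum is pure point. -/
theorem projections_of_const (hu : IsSymbol u) (hH : IsSelfAdjoint H)
    (hM : IsMatMul (hat H) (fun k => symb (onTorus u k))) (h0 : ∀ x, u 0 x = 0)
    (hw : ∀ x, deriv (usq u) x = 0) : ppProj H = 1 ∧ acProj H = 0 ∧ scProj H = 0 := by
  obtain ⟨C, hC⟩ := hu.bounded
  refine projections_of_pp (eq_zero_of_null hu hH hM) (top_le_iff.1 fun ψ _ => ?_)
  have hconst : ∀ x, usq u x = usq u 0 := fun x =>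
    is_const_of_deriv_eq_zero (fun x => (hu.hasDerivAt_usq x).differentiableAt) hw x 0
  have hlam : ∀ k s, lam (onTorus u k) s = s * √(usq u 0) := by
    intro k s
    have h1 : onTorus u k 0 = 0 := h0 _
    have h2 : vecSq (onTorus u k) = usq u 0 := hconst (rep k)
    rw [lam, h1, h2, zero_add]
  have hfin : ({1 * √(usq u 0), -1 * √(usq u 0)} : Set ℝ).Finite := toFinite _
  refine ⟨_, hfin.countable, ?_⟩
  rw [spectralMeasure_null hu.measurable hH hM hC ψ hfin.measurableSet.compl]
  refine Eventually.of_forall fun k => ?_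
  rw [hlam, hlam]
  simp

/-! ### The kernel when `u₀² = u²` -/

lemma norm_vecMat_le (a : Fin 4 → ℝ) (i j : Fin 2) : ‖vecMat a i j‖ ≤ √(vecSq a) := by
  refine Real.le_sqrt_of_sq_le ?_
  rw [← Complex.normSq_eq_norm_sq, Complex.normSq_apply, vecSq]
  fin_cases i <;> fin_cases j <;> simp [vecMat] <;>
    nlinarith [sq_nonneg (a 1), sq_nonneg (a 2), sq_nonneg (a 3)]

lemma vecMat_isHermitian (a : Fin 4 → ℝ) : (vecMat a).IsHermitian := by
  ext i j
  fin_cases i <;> fin_cases j <;> simp [vecMat] <;> ring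

/-- The projection `(1 - u·σ / u₀) / 2` onto the kernel of `∑ u_α σ_α` when `u₀² = u²`. -/
def kerMat (a : Fin 4 → ℝ) : Matrix (Fin 2) (Fin 2) ℂ :=
  (1 / 2 : ℂ) • (1 - (((a 0)⁻¹ : ℝ) : ℂ) • vecMat a)

lemma kerMat_isHermitian (a : Fin 4 → ℝ) : (kerMat a).IsHermitian := by
  have h : Matrix.conjTranspose ((1 / 2 : ℂ) • (1 - (((a 0)⁻¹ : ℝ) : ℂ) • vecMat a)) =
      (1 / 2 : ℂ) • (1 - (((a 0)⁻¹ : ℝ) : ℂ) • vecMat a) := by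
    rw [Matrix.conjTranspose_smul, Matrix.conjTranspose_sub, Matrix.conjTranspose_smul,
      (vecMat_isHermitian a).eq, Matrix.conjTranspose_one]
    simp
  exact h

lemma kerMat_trace (a : Fin 4 → ℝ) : (kerMat a).trace = 1 := by
  simp [kerMat, Matrix.trace_fin_two, vecMat]

lemma symb_trace (a : Fin 4 → ℝ) : (symb a).trace = 2 * a 0 := by
  simp [symb_eq, Matrix.trace_fin_two, vecMat]
  ring

section

variable {a : Fin 4 → ℝ}

lemma symb_eq_kerMat (h0 : a 0 ≠ 0) : symb a = (2 * (a 0 : ℂ)) • (1 - kerMat a) := by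
  have h1 : (a 0 : ℂ) * (((a 0)⁻¹ : ℝ) : ℂ) = 1 := by
    rw [← Complex.ofReal_mul, mul_inv_cancel₀ h0, Complex.ofReal_one]
  have h2 : (2 * (a 0 : ℂ)) • (1 - kerMat a) =
      (a 0 : ℂ) • 1 + ((a 0 : ℂ) * (((a 0)⁻¹ : ℝ) : ℂ)) • vecMat a := by
    unfold kerMat
    module
  rw [h2, h1, one_smul, symb_eq]

lemma kerMat_mul_self (h0 : a 0 ≠ 0) (hw : vecSq a = a 0 ^ 2) : kerMat a * kerMat a = kerMat a := by
  have h1 : ((((a 0)⁻¹ : ℝ) : ℂ) * (((a 0)⁻¹ : ℝ) : ℂ)) * (vecSq a : ℂ) = 1 := by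
    rw [hw, ← Complex.ofReal_mul, ← Complex.ofReal_mul, ← Complex.ofReal_one]
    congr 1
    field_simp
  have h2 : ((((a 0)⁻¹ : ℝ) : ℂ) • vecMat a) * ((((a 0)⁻¹ : ℝ) : ℂ) • vecMat a) = 1 := by
    rw [smul_mul_smul_comm, vecMat_mul_self, smul_smul, h1, one_smul]
  unfold kerMat
  rw [smul_mul_smul_comm]
  simp only [mul_sub, sub_mul, mul_one, one_mul, h2]
  module

lemma symb_mul_kerMat (h0 : a 0 ≠ 0) (hw : vecSq a = a 0 ^ 2) : symb a * kerMat a = 0 := by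
  rw [symb_eq_kerMat h0, smul_mul_assoc, sub_mul, one_mul, kerMat_mul_self h0 hw, sub_self,
    smul_zero]

lemma eproj_eq_kerMat (h0 : a 0 ≠ 0) {s : ℝ} (hs : s ^ 2 = 1) (hl : lam a s = 0) :
    eproj a s = kerMat a := by
  unfold lam at hl
  have hr : √(vecSq a) ≠ 0 := by
    intro h
    rw [h, mul_zero, add_zero] at hl
    exact h0 hl
  have hs0 : s ≠ 0 := by
    rintro rfl
    norm_num at hs
  have h1 : s / √(vecSq a) = -(a 0)⁻¹ := by
    rw [eq_neg_of_add_eq_zero_left hl]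
    field_simp
    linear_combination hs
  rw [eproj, kerMat, h1]
  push_cast
  module

lemma eproj_eq_one_sub_kerMat (h0 : a 0 ≠ 0) (hw : vecSq a = a 0 ^ 2) {s : ℝ} (hs : s ^ 2 = 1)
    (hl : lam a s ≠ 0) : eproj a s = 1 - kerMat a := by
  unfold lam at hl
  have h2 : √(vecSq a) ^ 2 = vecSq a := Real.sq_sqrt (vecSq_nonneg a)
  have hr : √(vecSq a) ≠ 0 := by
    intro h
    rw [h, hw] at h2
    exact h0 (by simpa using h2.symm)
  have h3 : (a 0 + s * √(vecSq a)) * (a 0 - s * √(vecSq a)) = 0 := by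
    rw [hw] at h2
    rw [hw]
    linear_combination (-1) * s ^ 2 * h2 - a 0 ^ 2 * hs
  have h4 : a 0 = s * √(vecSq a) := by
    rcases mul_eq_zero.1 h3 with h | h
    · exact absurd h hl
    · linarith
  have hs0 : s ≠ 0 := by
    rintro rfl
    norm_num at hs
  have h1 : s / √(vecSq a) = (a 0)⁻¹ := by
    rw [h4]
    field_simp
    linear_combination hs
  rw [eproj, kerMat, h1]
  module

lemma lam_cases (h0 : a 0 ≠ 0) (hw : vecSq a = a 0 ^ 2) :
    (lam a 1 = 0 ∧ lam a (-1) ≠ 0) ∨ (lam a 1 ≠ 0 ∧ lam a (-1) = 0) := by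
  have h2 : √(vecSq a) ^ 2 = vecSq a := Real.sq_sqrt (vecSq_nonneg a)
  have h3 : lam a 1 * lam a (-1) = 0 := by
    unfold lam
    linear_combination (-1) * h2 - hw
  have h4 : lam a 1 + lam a (-1) = 2 * a 0 := by
    unfold lam
    ring
  rcases mul_eq_zero.1 h3 with h | h
  · refine Or.inl ⟨h, fun h' => h0 ?_⟩
    rw [h, h'] at h4
    linarith
  · refine Or.inr ⟨fun h' => h0 ?_, h⟩
    rw [h, h'] at h4
    linarith

lemma lam_ne_zero_eq (h0 : a 0 ≠ 0) (hw : vecSq a = a 0 ^ 2) {s : ℝ} (hs : s = 1 ∨ s = -1)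
    (hl : lam a s ≠ 0) : lam a s = 2 * a 0 := by
  have h4 : lam a 1 + lam a (-1) = 2 * a 0 := by
    unfold lam
    ring
  rcases lam_cases h0 hw with ⟨h1, h2⟩ | ⟨h1, h2⟩ <;> rcases hs with rfl | rfl
  · exact absurd h1 hl
  · linarith
  · linarith
  · exact absurd h2 hl

/-- For a projection `P`, `(v, P v) = ‖P v‖²` vanishes only if `P v = 0`. -/
lemma dens_eq_zero_iff {s : ℝ} {P : Matrix (Fin 2) (Fin 2) ℂ} (hP : P.IsHermitian)
    (hPP : P * P = P) (he : eproj a s = P) (v : Fin 2 → ℂ) :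
    dens a s v = 0 ↔ P.mulVec v = 0 := by
  have h1 : dens a s v = ∑ i, ‖P.mulVec v i‖ ^ 2 := by
    have h2 : ∑ i, conj (v i) * ∑ j, eproj a s i j * v j = star v ⬝ᵥ P.mulVec v := by
      rw [he]
      rfl
    have h3 : star v ⬝ᵥ P.mulVec v = star (P.mulVec v) ⬝ᵥ P.mulVec v := by
      rw [Matrix.star_mulVec, hP.eq, ← Matrix.dotProduct_mulVec, Matrix.mulVec_mulVec, hPP]
    rw [dens, h2, h3, dotProduct, Complex.re_sum]
    refine Finset.sum_congr rfl fun i _ => ?_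
    rw [Pi.star_apply, Complex.star_def, Complex.conj_mul']
    norm_cast
  rw [h1, Finset.sum_eq_zero_iff_of_nonneg fun i _ => by positivity]
  simp [funext_iff]

lemma one_sub_kerMat_isHermitian (a : Fin 4 → ℝ) : (1 - kerMat a).IsHermitian := by
  have h : Matrix.conjTranspose (1 - kerMat a) = 1 - kerMat a := by
    rw [Matrix.conjTranspose_sub, (kerMat_isHermitian a).eq, Matrix.conjTranspose_one]
  exact h

lemma dens_zero_iff_mem (h0 : a 0 ≠ 0) (hw : vecSq a = a 0 ^ 2) (v : Fin 2 → ℂ) :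
    ((lam a 1 ∈ ({0} : Set ℝ) → dens a 1 v = 0) ∧ (lam a (-1) ∈ ({0} : Set ℝ) → dens a (-1) v = 0))
      ↔ (kerMat a).mulVec v = 0 := by
  have hk := kerMat_mul_self h0 hw
  rcases lam_cases h0 hw with ⟨h1, h2⟩ | ⟨h1, h2⟩
  · have := dens_eq_zero_iff (kerMat_isHermitian a) hk (eproj_eq_kerMat h0 (one_pow 2) h1) v
    simp [h1, h2, this]
  · have := dens_eq_zero_iff (kerMat_isHermitian a) hk (eproj_eq_kerMat h0 neg_one_sq h2) v
    simp [h1, h2, this]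

lemma dens_zero_iff_notMem (h0 : a 0 ≠ 0) (hw : vecSq a = a 0 ^ 2) (v : Fin 2 → ℂ) :
    ((lam a 1 ∈ ({0} : Set ℝ)ᶜ → dens a 1 v = 0) ∧
      (lam a (-1) ∈ ({0} : Set ℝ)ᶜ → dens a (-1) v = 0)) ↔ (symb a).mulVec v = 0 := by
  have hk := kerMat_mul_self h0 hw
  have hk' : (1 - kerMat a) * (1 - kerMat a) = 1 - kerMat a := by
    simp [mul_sub, sub_mul, hk]
  have ha : (2 * (a 0 : ℂ)) ≠ 0 := by simpa using h0
  rw [symb_eq_kerMat h0, Matrix.smul_mulVec, smul_eq_zero_iff_right ha]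
  rcases lam_cases h0 hw with ⟨h1, h2⟩ | ⟨h1, h2⟩
  · have := dens_eq_zero_iff (one_sub_kerMat_isHermitian a) hk'
      (eproj_eq_one_sub_kerMat h0 hw neg_one_sq h2) v
    simp [h1, h2, this]
  · have := dens_eq_zero_iff (one_sub_kerMat_isHermitian a) hk'
      (eproj_eq_one_sub_kerMat h0 hw (one_pow 2) h1) v
    simp [h1, h2, this]

end

/-- The value of `Φ` at the point `k`. -/
def at_ (Φ : Dbl MomSpace) (k : Torus) : Fin 2 → ℂ := fun i => Φ i k

lemma IsMatMul.at_eq {T : Dbl MomSpace →L[ℂ] Dbl MomSpace} {M : Torus → Matrix (Fin 2) (Fin 2) ℂ}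
    (h : IsMatMul T M) (Φ : Dbl MomSpace) :
    ∀ᵐ k ∂torusMeasure, at_ (T Φ) k = (M k).mulVec (at_ Φ k) := by
  filter_upwards [h Φ 0, h Φ 1] with k h0 h1
  ext i
  fin_cases i
  · exact h0
  · exact h1

lemma eq_zero_iff_at (Φ : Dbl MomSpace) : Φ = 0 ↔ ∀ᵐ k ∂torusMeasure, at_ Φ k = 0 := by
  have hz : ∀ᵐ k ∂torusMeasure, at_ (0 : Dbl MomSpace) k = 0 := by
    filter_upwards [Lp.coeFn_zero ℂ 2 torusMeasure] with k hk
    ext i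
    exact hk
  constructor
  · rintro rfl
    exact hz
  · intro h
    refine PiLp.ext fun i => Lp.ext ?_
    filter_upwards [h, hz] with k h1 h2
    exact (congrFun h1 i).trans (congrFun h2 i).symm

lemma Θ_apply (F : Dbl PosSpace) (i : Fin 2) (x : ℤ) :
    (Θ F i : ℤ → ℂ) x = (F i : ℤ → ℂ) (x - 1) := by
  have h : Θ F i = θ (F i) := by
    rw [Θ, opMatrix_apply, Fin.sum_univ_two]
    fin_cases i <;> simp [pauli]
  rw [h]
  rfl

/-- The translation has no eigenvectors: from `f(x - 1) = z f(x)` one gets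
`f(x - n) f(x + n) = f(x)²`, which tends to zero as `n → ∞`. -/
lemma eq_zero_of_Θ_eq_smul {F : Dbl PosSpace} {z : ℂ} (h : Θ F = z • F) : F = 0 := by
  refine PiLp.ext fun i => lp.ext (funext fun x => ?_)
  set f : ℤ → ℂ := (F i : ℤ → ℂ) with hf
  have h1 : ∀ y, f (y - 1) = z * f y := by
    intro y
    rw [hf, ← Θ_apply, h]
    rfl
  have h2 : ∀ (n : ℕ) y, f (y - n) = z ^ n * f y := by
    intro n
    induction n with
    | zero => simp
    | succ n ih =>
      intro y
      rw [show y - ((n + 1 : ℕ) : ℤ) = y - n - 1 by push_cast; ring, h1, ih, pow_succ]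
      ring
  have h3 : ∀ n : ℕ, f (x - n) * f (x + n) = f x ^ 2 := by
    intro n
    have h4 := h2 n x
    have h5 := h2 n (x + n)
    rw [add_sub_cancel_right] at h5
    rw [h4, mul_right_comm, mul_comm _ (f (x + n)), mul_comm (f (x + n)), ← h5, sq]
  have hsum : Summable fun y => ‖f y‖ ^ (2 : ℝ≥0∞).toReal :=
    (lp.memℓp (F i)).summable (by norm_num)
  have hlim : Tendsto f cofinite (𝓝 0) := by
    have h6 := hsum.tendsto_cofinite_zero
    rw [tendsto_zero_iff_norm_tendsto_zero]
    have h7 := h6.sqrt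
    simpa [Real.sqrt_sq] using h7
  have hinj1 : Function.Injective fun n : ℕ => x - (n : ℤ) := fun n m hnm => by
    simpa using hnm
  have hinj2 : Function.Injective fun n : ℕ => x + (n : ℤ) := fun n m hnm => by
    simpa using hnm
  have hl1 : Tendsto (fun n : ℕ => f (x - n)) atTop (𝓝 0) := by
    rw [← Nat.cofinite_eq_atTop]
    exact hlim.comp hinj1.tendsto_cofinite
  have hl2 : Tendsto (fun n : ℕ => f (x + n)) atTop (𝓝 0) := by
    rw [← Nat.cofinite_eq_atTop]
    exact hlim.comp hinj2.tendsto_cofinite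
  have hl3 := hl1.mul hl2
  simp only [h3, mul_zero] at hl3
  have := tendsto_nhds_unique hl3 tendsto_const_nhds
  exact pow_eq_zero_iff (two_ne_zero) |>.1 this.symm

/-- A non-zero translation invariant subspace is infinite dimensional. -/
lemma not_finiteDimensional_of_invariant {K : Submodule ℂ (Dbl PosSpace)} (hK : K ≠ ⊥)
    (hΘ : ∀ ψ ∈ K, Θ ψ ∈ K) : ¬FiniteDimensional ℂ K := by
  intro hfin
  have : Nontrivial K := (Submodule.nontrivial_iff_ne_bot).2 hK
  obtain ⟨z, hz⟩ := Module.End.exists_eigenvalue ((Θ : Dbl PosSpace →ₗ[ℂ] Dbl PosSpace).restrict hΘ)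
  obtain ⟨v, hv⟩ := hz.exists_hasEigenvector
  apply hv.2
  have h1 := congrArg Subtype.val hv.apply_eq_smul
  exact Subtype.ext (eq_zero_of_Θ_eq_smul h1)

lemma kerMat_norm_le {a : Fin 4 → ℝ} (hw : vecSq a = a 0 ^ 2) (i j : Fin 2) :
    ‖kerMat a i j‖ ≤ 1 := by
  have h1 : ‖vecMat a i j‖ ≤ |a 0| := by
    have := norm_vecMat_le a i j
    rwa [hw, Real.sqrt_sq_eq_abs] at this
  have h2 : ‖(((a 0)⁻¹ : ℝ) : ℂ) * vecMat a i j‖ ≤ 1 := by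
    rw [norm_mul, Complex.norm_real, norm_inv, Real.norm_eq_abs]
    by_cases h0 : a 0 = 0
    · simp [h0]
    · rw [inv_mul_le_iff₀ (abs_pos.2 h0), mul_one]
      exact h1
  have h3 : ‖(1 : Matrix (Fin 2) (Fin 2) ℂ) i j‖ ≤ 1 := by
    rw [Matrix.one_apply]
    split_ifs <;> simp
  have h4 : kerMat a i j = (1 / 2 : ℂ) * ((1 : Matrix (Fin 2) (Fin 2) ℂ) i j -
      (((a 0)⁻¹ : ℝ) : ℂ) * vecMat a i j) := rfl
  rw [h4, norm_mul]
  have h5 := norm_sub_le ((1 : Matrix (Fin 2) (Fin 2) ℂ) i j) ((((a 0)⁻¹ : ℝ) : ℂ) * vecMat a i j)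
  have h6 : ‖(1 / 2 : ℂ)‖ = 1 / 2 := by norm_num
  rw [h6]
  linarith

lemma measurable_vecMat {a : Torus → Fin 4 → ℝ} (ha : ∀ α, Measurable fun k => a k α)
    (i j : Fin 2) : Measurable fun k => vecMat (a k) i j := by
  have h1 := Complex.measurable_ofReal.comp (ha 1)
  have h2 := Complex.measurable_ofReal.comp (ha 2)
  have h3 := Complex.measurable_ofReal.comp (ha 3)
  simp only [Function.comp_def] at h1 h2 h3
  fin_cases i <;> fin_cases j <;> simp only [vecMat, Fin.zero_eta, Fin.mk_one, Matrix.of_apply,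
    Matrix.cons_val', Matrix.cons_val_zero, Matrix.cons_val_one, Matrix.cons_val_fin_one] <;>
    fun_prop

lemma exists_isMatMul_kerMat (hu : IsSymbol u) (hw : ∀ x, usq u x = u 0 x ^ 2) :
    ∃ N, IsMatMul N (fun k => kerMat (onTorus u k)) := by
  refine exists_isMatMul (fun i j => ?_) (C := 1) fun k i j => kerMat_norm_le (hw (rep k)) i j
  have h := measurable_vecMat hu.measurable i j
  have h0 := Complex.measurable_ofReal.comp (hu.measurable 0).inv
  have h4 : ∀ k, kerMat (onTorus u k) i j = (1 / 2 : ℂ) * ((1 : Matrix (Fin 2) (Fin 2) ℂ) i j -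
      (((onTorus u k 0)⁻¹ : ℝ) : ℂ) * vecMat (onTorus u k) i j) := fun k => rfl
  simp only [h4]
  simp only [Function.comp_def, Pi.inv_apply] at h0
  fun_prop

lemma ae_zero_ne (hu : IsSymbol u) (h0 : ∃ x, u 0 x ≠ 0) :
    ∀ᵐ k ∂torusMeasure, onTorus u k 0 ≠ 0 :=
  ae_rep (p := fun x => u 0 x ≠ 0) (ae_restrict_of_ae (ae_ne_zero_of_analytic (hu.analytic 0) h0))

lemma projOnto_orthogonal (K : Submodule ℂ (Dbl PosSpace)) : projOnto Kᗮ = 1 - projOnto K := by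
  unfold projOnto
  have h : Kᗮ.topologicalClosure = K.topologicalClosureᗮ := by
    rw [Submodule.orthogonal_closure]
    exact (Submodule.isClosed_orthogonal K).submodule_topologicalClosure_eq
  rw [← Submodule.starProjection_orthogonal']
  congr 1

/-- If `u₀² = u²`, the symbol has the eigenvalues `0` and `2 u₀`. The spectral subspace of `{0}` is the
kernel of `H`, and on its orthogonal complement the spectrum is absolutely continuous. -/
theorem projections_of_sq_eq (hu : IsSymbol u) (hH : IsSelfAdjoint H)
    (hM : IsMatMul (hat H) (fun k => symb (onTorus u k))) (hΘ : H ∘L Θ = Θ ∘L H)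
    (h0 : ∃ x, u 0 x ≠ 0) (hw : ∀ x, usq u x = u 0 x ^ 2) :
    ppProj H = spectralProj H {0} ∧ acProj H = 1 - spectralProj H {0} ∧ scProj H = 0 ∧
      ¬FiniteDimensional ℂ (spectralProj H {0}).range ∧ spectralProj H {0} ≠ 1 := by
  obtain ⟨C, hC⟩ := hu.bounded
  obtain ⟨N, hN⟩ := exists_isMatMul_kerMat hu hw
  have hae := ae_zero_ne hu h0
  have hwk : ∀ k, vecSq (onTorus u k) = onTorus u k 0 ^ 2 := fun k => hw (rep k)
  have hnd := eq_zero_of_null hu hH hM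
  set K := spectralSubspace H {0} with hKdef
  -- away from `0`, the eigenvalues agree with the non-constant analytic function `2 u₀`
  have hoff : ∀ ψ B, volume B = 0 → (0 : ℝ) ∉ B → spectralMeasure H ψ B = 0 := by
    intro ψ B hB h0B
    have hmeas : MeasurableSet (toMeasurable volume B \ {0}) :=
      (measurableSet_toMeasurable _ _).diff (measurableSet_singleton 0)
    refine measure_mono_null (t := toMeasurable volume B \ {0})
      (fun x hx => ⟨subset_toMeasurable _ _ hx, fun h => h0B (h ▸ hx)⟩) ?_
    rw [spectralMeasure_null hu.measurable hH hM hC ψ hmeas]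
    have hder : ∃ x, deriv (u 0) x ≠ 0 := by
      by_contra! h
      obtain ⟨x, hx⟩ := h0
      exact hx (hu.eq_zero_of_deriv_eq_zero h x)
    have h1 := volume_preimage_null (f := fun x => 2 * u 0 x) (f' := fun x => 2 * deriv (u 0) x)
      (S := {x | deriv (u 0) x ≠ 0})
      (fun x hx => ⟨(hu.analytic 0 x (mem_univ _)).hasStrictDerivAt.const_mul 2,
        mul_ne_zero two_ne_zero hx⟩) ((measure_toMeasurable B).trans hB)
    have h2 : ∀ᵐ x, 2 * u 0 x ∉ toMeasurable volume B := by
      filter_upwards [measure_eq_zero_iff_ae_notMem.1 h1,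
        ae_ne_zero_of_analytic (hu.analytic 0).deriv hder] with x hx h3 hmem
      exact hx (show x ∈ _ ∩ _ from And.intro h3 hmem)
    have h3 : ∀ᵐ k ∂torusMeasure, 2 * onTorus u k 0 ∉ toMeasurable volume B :=
      ae_rep (p := fun x => 2 * u 0 x ∉ toMeasurable volume B) (ae_restrict_of_ae h2)
    filter_upwards [h3, hae] with k hk hk0
    constructor
    · rintro ⟨h4, h5⟩
      rw [lam_ne_zero_eq hk0 (hwk k) (Or.inl rfl) h5] at h4
      exact absurd h4 hk
    · rintro ⟨h4, h5⟩
      rw [lam_ne_zero_eq hk0 (hwk k) (Or.inr rfl) h5] at h4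
      exact absurd h4 hk
  obtain ⟨hpp, hsc⟩ := subspaces_of_ac_off_zero hnd hoff
  have hatom : ∀ ψ, spectralMeasure H ψ {0} = 0 ↔
      ∀ᵐ k ∂torusMeasure, (kerMat (onTorus u k)).mulVec (at_ (dblFourier ψ) k) = 0 := by
    intro ψ
    rw [spectralMeasure_null hu.measurable hH hM hC ψ (measurableSet_singleton 0)]
    constructor <;> intro h <;> filter_upwards [h, hae] with k hk hk0
    · exact (dens_zero_iff_mem hk0 (hwk k) _).1 hk
    · exact (dens_zero_iff_mem hk0 (hwk k) _).2 hk
  have hmemK : ∀ ψ, ψ ∈ K ↔ H ψ = 0 := by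
    intro ψ
    have h1 : ψ ∈ K ↔ spectralMeasure H ψ {0}ᶜ = 0 := Iff.rfl
    have h2 : H ψ = 0 ↔ hat H (dblFourier ψ) = 0 := by
      rw [hat_apply]
      simp
    rw [h1, h2, eq_zero_iff_at,
      spectralMeasure_null hu.measurable hH hM hC ψ (measurableSet_singleton 0).compl]
    constructor <;> intro h <;> filter_upwards [h, hae, hM.at_eq (dblFourier ψ)] with k hk hk0 hk1
    · rw [hk1]
      exact (dens_zero_iff_notMem hk0 (hwk k) _).1 hk
    · rw [hk1] at hk
      exact (dens_zero_iff_notMem hk0 (hwk k) _).2 hk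
  have hNK : ∀ Φ, dblFourier.symm (N Φ) ∈ K := by
    intro Φ
    rw [hmemK]
    have h1 : dblFourier (H (dblFourier.symm (N Φ))) = 0 := by
      rw [← hat_apply, LinearIsometryEquiv.apply_symm_apply, eq_zero_iff_at]
      filter_upwards [hM.at_eq (N Φ), hN.at_eq Φ, hae] with k h1 h2 h3
      rw [h1, h2, Matrix.mulVec_mulVec, symb_mul_kerMat h3 (hwk k), Matrix.zero_mulVec]
    simpa using h1
  -- `N` is symmetric
  have hsymm : ∀ Φ Ψ, ⟪N Φ, Ψ⟫_ℂ = ⟪Φ, N Ψ⟫_ℂ := by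
    intro Φ Ψ
    rw [inner_eq_integral, inner_eq_integral]
    refine integral_congr_ae ?_
    filter_upwards [hN Φ 0, hN Φ 1, hN Ψ 0, hN Ψ 1] with k h1 h2 h3 h4
    have hh : ∀ i j, conj (kerMat (onTorus u k) i j) = kerMat (onTorus u k) j i := fun i j =>
      (kerMat_isHermitian (onTorus u k)).apply j i
    simp only [Fin.sum_univ_two, h1, h2, h3, h4, map_add, map_mul, hh]
    ring
  have hNfix : ∀ ψ ∈ K, N (dblFourier ψ) = dblFourier ψ := by
    intro ψ hψ
    rw [hmemK] at hψ
    have h2 : hat H (dblFourier ψ) = 0 := by rw [hat_apply, hψ, map_zero]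
    rw [eq_zero_iff_at] at h2
    refine PiLp.ext fun i => Lp.ext ?_
    filter_upwards [h2, hM.at_eq (dblFourier ψ), hae, hN.at_eq (dblFourier ψ)] with k h3 h4 h5 h6
    have ha : (2 * (onTorus u k 0 : ℂ)) ≠ 0 := by simpa using h5
    rw [h4, symb_eq_kerMat h5, Matrix.smul_mulVec, smul_eq_zero_iff_right ha, Matrix.sub_mulVec,
      Matrix.one_mulVec, sub_eq_zero, ← h6] at h3
    exact (congrFun h3 i).symm
  have hac : acSubspace H = Kᗮ := by
    apply le_antisymm
    · intro ψ hψ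
      rw [Submodule.mem_orthogonal]
      intro φ hφ
      have h1 : N (dblFourier ψ) = 0 := by
        rw [eq_zero_iff_at]
        filter_upwards [(hatom ψ).1 (hψ (by simp)), hN.at_eq (dblFourier ψ)] with k h1 h2
        rw [h2, h1]
      rw [← LinearIsometryEquiv.inner_map_map dblFourier, ← hNfix φ hφ, hsymm, h1,
        inner_zero_right]
    · intro ψ hψ B hB
      rw [Submodule.mem_orthogonal] at hψ
      have h1 := hψ _ (hNK (dblFourier ψ))
      rw [← LinearIsometryEquiv.inner_map_map dblFourier, LinearIsometryEquiv.apply_symm_apply] at h1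
      have h2 : N (dblFourier ψ) = 0 := by
        have h3 := hNfix _ (hNK (dblFourier ψ))
        rw [LinearIsometryEquiv.apply_symm_apply] at h3
        rw [← inner_self_eq_zero (𝕜 := ℂ), hsymm, h3, ← hsymm]
        exact h1
      have h3 : spectralMeasure H ψ {0} = 0 := by
        rw [hatom]
        filter_upwards [(eq_zero_iff_at _).1 h2, hN.at_eq (dblFourier ψ)] with k h4 h5
        rw [← h5, h4]
      have h4 := hoff ψ (B \ {0}) (measure_mono_null sdiff_subset hB) (by simp)
      refine measure_mono_null (fun x hx => ?_) (measure_union_null h4 h3)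
      by_cases hx0 : x = 0
      · exact Or.inr hx0
      · exact Or.inl ⟨hx, hx0⟩
  have hKclosed : K.topologicalClosure = K := by
    have : (K : Set (Dbl PosSpace)) = {ψ | H ψ = 0} := ext hmemK
    refine IsClosed.submodule_topologicalClosure_eq ?_
    rw [this]
    exact isClosed_eq H.continuous continuous_const
  have hrange : (spectralProj H {0}).range = K := by
    rw [spectralProj, projOnto, ← hKdef]
    refine (Submodule.range_starProjection _).trans hKclosed
  refine ⟨by rw [ppProj, hpp, spectralProj], ?_, by rw [scProj, hsc, projOnto_bot], ?_, ?_⟩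
  · rw [acProj, hac, projOnto_orthogonal, spectralProj]
  · rw [hrange]
    refine not_finiteDimensional_of_invariant (fun hbot => ?_) fun ψ hψ => ?_
    · have hN0 : N = 0 := by
        ext1 Φ
        have h1 := hNK Φ
        rw [hbot, Submodule.mem_bot] at h1
        simpa using h1
      rw [hN0] at hN
      obtain ⟨k, hk⟩ := (hN.symbol_unique IsMatMul.zero).exists
      have h1 := kerMat_trace (onTorus u k)
      rw [hk] at h1
      simp at h1
    · rw [hmemK] at hψ ⊢
      have h1 : H (Θ ψ) = Θ (H ψ) := congrArg (fun T : Dbl PosSpace →L[ℂ] Dbl PosSpace => T ψ) hΘ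
      rw [h1, hψ, map_zero]
  · intro h1
    rw [h1] at hrange
    have hH0 : H = 0 := by
      ext1 ψ
      have h2 : ψ ∈ K := by
        rw [← hrange]
        exact ⟨ψ, rfl⟩
      exact (hmemK ψ).1 h2
    rw [hH0, hat_zero] at hM
    obtain ⟨k, hk, hk0⟩ := ((hM.symbol_unique IsMatMul.zero).and hae).exists
    have h2 := symb_trace (onTorus u k)
    rw [hk] at h2
    simp at h2
    exact hk0 h2

end Projections

/-! ### Exponentials of multiplication operators -/

section Exponential

/-- The matrix with the eigenvalues `c` and `d` in the eigenspaces of `∑ u_α σ_α`; the value `c`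
belongs to `u₀ + |u|`. -/
def comb (a : Fin 4 → ℝ) (c d : ℂ) : Matrix (Fin 2) (Fin 2) ℂ := c • eproj a 1 + d • eproj a (-1)

lemma eproj_mul_self {a : Fin 4 → ℝ} (h : vecSq a ≠ 0) {s : ℝ} (hs : s ^ 2 = 1) :
    eproj a s * eproj a s = eproj a s := by
  have hr : √(vecSq a) ≠ 0 := Real.sqrt_ne_zero'.2 (lt_of_le_of_ne (vecSq_nonneg a) (Ne.symm h))
  have h1 := vecMat_mul_eproj a hs
  have h2 : ((s / √(vecSq a) : ℝ) : ℂ) * ((s * √(vecSq a) : ℝ) : ℂ) = 1 := by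
    rw [← Complex.ofReal_mul, ← Complex.ofReal_one]
    congr 1
    field_simp
    exact hs
  have h3 : eproj a s * eproj a s =
      (1 / 2 : ℂ) • (eproj a s + ((s / √(vecSq a) : ℝ) : ℂ) • (vecMat a * eproj a s)) := by
    conv_lhs => arg 1; rw [eproj]
    rw [smul_mul_assoc, add_mul, one_mul, smul_mul_assoc]
  rw [h3, h1, smul_smul, h2]
  module

lemma eproj_mul_eproj {a : Fin 4 → ℝ} (h : vecSq a ≠ 0) {s : ℝ} (hs : s ^ 2 = 1) :
    eproj a s * eproj a (-s) = 0 := by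
  have h1 := eproj_mul_self h hs
  have h2 : eproj a (-s) = 1 - eproj a s := by
    simp only [eproj]
    push_cast
    module
  rw [h2, mul_sub, mul_one, h1, sub_self]

lemma comb_mul {a : Fin 4 → ℝ} (h : vecSq a ≠ 0) (c d c' d' : ℂ) :
    comb a c d * comb a c' d' = comb a (c * c') (d * d') := by
  have h1 := eproj_mul_eproj h (one_pow 2)
  have h2 := eproj_mul_eproj h neg_one_sq
  rw [neg_neg] at h2
  simp only [comb, add_mul, mul_add, smul_mul_smul_comm, eproj_mul_self h (one_pow 2),
    eproj_mul_self h neg_one_sq, h1, h2, smul_zero, add_zero, zero_add]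

lemma comb_self (a : Fin 4 → ℝ) (c : ℂ) : comb a c c = c • 1 := by
  rw [comb, ← smul_add, eproj_add]

lemma specFun_eq_comb (a : Fin 4 → ℝ) (f : ℝ → ℂ) :
    specFun a f = comb a (f (lam a 1)) (f (lam a (-1))) := rfl

lemma lam_of_vecSq {a : Fin 4 → ℝ} (h : vecSq a = 0) (s : ℝ) : lam a s = a 0 := by
  simp [lam, h]

lemma specFun_mul (a : Fin 4 → ℝ) (f g : ℝ → ℂ) :
    specFun a f * specFun a g = specFun a (fun x => f x * g x) := by
  by_cases h : vecSq a = 0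
  · simp only [specFun_eq_comb, lam_of_vecSq h, comb_self, smul_mul_smul_comm, mul_one]
  · simp only [specFun_eq_comb, comb_mul h]

/-- The function `x ↦ e^{itx}`. -/
def phase (t : ℝ) (x : ℝ) : ℂ := Complex.exp (Complex.I * t * x)

lemma norm_phase (t x : ℝ) : ‖phase t x‖ = 1 := by
  have : Complex.I * t * x = ((t * x : ℝ) : ℂ) * Complex.I := by
    push_cast
    ring
  rw [phase, this, Complex.norm_exp_ofReal_mul_I]

lemma phase_neg_mul (t x : ℝ) : phase (-t) x * phase t x = 1 := by
  rw [phase, phase, ← Complex.exp_add]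
  simp

lemma phase_sub_le (t x y : ℝ) : ‖phase t x - phase t y‖ ≤ |t| * |x - y| := by
  have h1 : phase t x - phase t y =
      phase t y * (Complex.exp (Complex.I * ((t * (x - y) : ℝ) : ℂ)) - 1) := by
    rw [phase, phase, mul_sub, ← Complex.exp_add, mul_one]
    congr 2
    push_cast
    ring
  rw [h1, norm_mul, norm_phase, one_mul, ← abs_mul]
  exact Real.norm_exp_I_mul_ofReal_sub_one_le

attribute [local instance] Matrix.linftyOpNormedRing Matrix.linftyOpNormedAlgebra

lemma hasSum_specFun_phase (a : Fin 4 → ℝ) (t : ℝ) :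
    HasSum (fun n : ℕ => ((n.factorial : ℂ)⁻¹) • ((Complex.I * t) • symb a) ^ n)
      (specFun a (phase t)) := by
  have h1 : ∀ x : ℝ, HasSum (fun n : ℕ => ((n.factorial : ℂ)⁻¹) * (Complex.I * t * x) ^ n)
      (phase t x) := by
    intro x
    have := NormedSpace.exp_series_hasSum_exp' (𝕂 := ℂ) (Complex.I * t * x : ℂ)
    rw [← Complex.exp_eq_exp_ℂ] at this
    exact this
  have h2 := ((h1 (lam a 1)).smul_const (eproj a 1)).add
    ((h1 (lam a (-1))).smul_const (eproj a (-1)))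
  have h3 : ∀ n : ℕ, ((n.factorial : ℂ)⁻¹) • ((Complex.I * t) • symb a) ^ n =
      (((n.factorial : ℂ)⁻¹) * (Complex.I * t * lam a 1) ^ n) • eproj a 1 +
        (((n.factorial : ℂ)⁻¹) * (Complex.I * t * lam a (-1)) ^ n) • eproj a (-1) := by
    intro n
    rw [smul_pow, symb_pow, specFun]
    simp only [smul_add, smul_smul, mul_pow, mul_assoc]
  simp only [h3]
  exact h2

lemma exp_symb (a : Fin 4 → ℝ) (t : ℝ) :
    NormedSpace.exp ((Complex.I * t) • symb a) = specFun a (phase t) :=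
  (NormedSpace.exp_series_hasSum_exp' (𝕂 := ℂ) ((Complex.I * t) • symb a)).unique
    (hasSum_specFun_phase a t)

lemma IsSymbol.contDiff {u : Fin 4 → ℝ → ℝ} (hu : IsSymbol u) (α : Fin 4) :
    ContDiff ℝ 1 (u α) :=
  (hu.analytic α).contDiff

/-- Although the eigenvalues and eigenprojections need not be smooth, the exponential is, since it
is a power series in the symbol. -/
lemma IsSymbol.contDiff_exp {u : Fin 4 → ℝ → ℝ} (hu : IsSymbol u) (t : ℝ) (i j : Fin 2) :
    ContDiff ℝ 1 (fun x => specFun (fun α => u α x) (phase t) i j) := by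
  have h1 : ContDiff ℝ 1 (fun x => (Complex.I * t) • symb (fun α => u α x)) := by
    refine ContDiff.const_smul _ (ContDiff.sum fun α _ => ContDiff.fun_smul ?_ contDiff_const)
    exact Complex.ofRealCLM.contDiff.comp (hu.contDiff α)
  have h2 : ContDiff ℂ 1 (NormedSpace.exp : Matrix (Fin 2) (Fin 2) ℂ → Matrix (Fin 2) (Fin 2) ℂ) :=
    contDiff_iff_contDiffAt.2 fun x => (NormedSpace.exp_analytic (𝕂 := ℂ) x).contDiffAt
  have h3 := (h2.restrict_scalars ℝ).comp h1
  simp only [Function.comp_def, exp_symb] at h3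
  have h4 : IsBoundedLinearMap ℝ (fun A : Matrix (Fin 2) (Fin 2) ℂ => A i j) := by
    let l : Matrix (Fin 2) (Fin 2) ℂ →ₗ[ℝ] ℂ :=
      { toFun := fun A => A i j
        map_add' := fun _ _ => rfl
        map_smul' := fun _ _ => rfl }
    exact (LinearMap.toContinuousLinearMap l).isBoundedLinearMap
  exact h4.contDiff.comp h3

end Exponential

/-- The group `e^{itĤ}` acts by multiplication with the exponential of the symbol. -/
lemma isMatMul_exp {T : Dbl MomSpace →L[ℂ] Dbl MomSpace} {a : Torus → Fin 4 → ℝ}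
    (hM : IsMatMul T (fun k => symb (a k))) (t : ℝ) :
    IsMatMul (NormedSpace.exp ((Complex.I * t) • T)) (fun k => specFun (a k) (phase t)) := by
  have h1 := (NormedSpace.exp_series_hasSum_exp' (𝕂 := ℂ) ((Complex.I * t) • T)).tendsto_sum_nat
  refine IsMatMul.of_tendsto (fun n => IsMatMul.sum _ fun m _ =>
    (((hM.smul (Complex.I * t)).pow m).smul _)) h1 fun k => ?_
  exact (hasSum_specFun_phase (a k) t).tendsto_sum_nat

/-! ### The asymptotic velocity: pointwise estimates -/

/-- The derivatives `(u₀', u₁', u₂', u₃')` of the coefficient functions. -/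
def derivVec (u : Fin 4 → ℝ → ℝ) (x : ℝ) (α : Fin 4) : ℝ := deriv (u α) x

/-- The symbol `u₀' + (u u' / u²) u·σ` of the asymptotic velocity. Its eigenvalues are the
derivatives of the eigenvalues `u₀ ± |u|`. At the zeros of `u²`, the quotient by zero is zero, so that
the value is `u₀'`; this is the correct velocity if `u` vanishes identically, and otherwise it
concerns only a null set. -/
def velMat (u : Fin 4 → ℝ → ℝ) (x : ℝ) : Matrix (Fin 2) (Fin 2) ℂ :=
  ((deriv (u 0) x : ℝ) : ℂ) • 1 +
    ((deriv (usq u) x / (2 * usq u x) : ℝ) : ℂ) • vecMat (fun α => u α x)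

/-- The derivative of the unit vector `u·σ / |u|` where `u` does not vanish. -/
def dirDeriv (u : Fin 4 → ℝ → ℝ) (x : ℝ) : Matrix (Fin 2) (Fin 2) ℂ :=
  (((√(usq u x))⁻¹ : ℝ) : ℂ) • vecMat (derivVec u x) +
    ((-(deriv (usq u) x / (2 * √(usq u x))) / usq u x : ℝ) : ℂ) • vecMat (fun α => u α x)

/-- The entrywise derivative in the momentum of `e^{it ∑ u_α σ_α}`. -/
def expDeriv (u : Fin 4 → ℝ → ℝ) (t x : ℝ) : Matrix (Fin 2) (Fin 2) ℂ :=
  Matrix.of fun i j => deriv (fun y => specFun (fun α => u α y) (phase t) i j) x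

/-- The symbol of `t⁻¹ e^{-itU} (-i ∂_k e^{itU})`. -/
def velApprox (u : Fin 4 → ℝ → ℝ) (t x : ℝ) : Matrix (Fin 2) (Fin 2) ℂ :=
  ((t : ℂ)⁻¹ * -Complex.I) • (specFun (fun α => u α x) (phase (-t)) * expDeriv u t x)

namespace IsSymbol

variable {u : Fin 4 → ℝ → ℝ}

lemma hasDerivAt_vecMat (hu : IsSymbol u) (x : ℝ) (i j : Fin 2) :
    HasDerivAt (fun y => vecMat (fun α => u α y) i j) (vecMat (derivVec u x) i j) x := by
  have h1 := (hu.hasDerivAt 1 x).ofReal_comp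
  have h2 := (hu.hasDerivAt 2 x).ofReal_comp
  have h3 := (hu.hasDerivAt 3 x).ofReal_comp
  fin_cases i <;> fin_cases j
  · exact h3
  · exact h1.sub (h2.mul_const Complex.I)
  · exact h1.add (h2.mul_const Complex.I)
  · exact h3.neg

lemma hasDerivAt_eproj (hu : IsSymbol u) {x : ℝ} (hx : usq u x ≠ 0) (s : ℝ) (i j : Fin 2) :
    HasDerivAt (fun y => eproj (fun α => u α y) s i j) ((s / 2 : ℂ) * dirDeriv u x i j) x := by
  have hr : √(usq u x) ≠ 0 := Real.sqrt_ne_zero'.2 (lt_of_le_of_ne (vecSq_nonneg _) (Ne.symm hx))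
  have h2 : √(usq u x) ^ 2 = usq u x := Real.sq_sqrt (vecSq_nonneg _)
  have h1 := ((hu.hasDerivAt_usq x).sqrt hx).inv hr
  rw [h2] at h1
  have h3 := (h1.ofReal_comp.mul (hu.hasDerivAt_vecMat x i j)).const_mul (s / 2 : ℂ)
  have h4 := h3.const_add ((1 / 2 : ℂ) * (1 : Matrix (Fin 2) (Fin 2) ℂ) i j)
  refine (h4.congr_deriv ?_).congr_of_eventuallyEq (Eventually.of_forall fun y => ?_)
  · simp only [dirDeriv, Matrix.add_apply, Matrix.smul_apply, smul_eq_mul, Pi.inv_apply]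
    ring
  · simp only [eproj, Matrix.add_apply, Matrix.smul_apply, smul_eq_mul, usq, Pi.mul_apply,
      Pi.inv_apply]
    push_cast
    ring

/-- The derivative of the eigenvalue with sign `s`. -/
def lamDeriv (u : Fin 4 → ℝ → ℝ) (s x : ℝ) : ℝ :=
  deriv (u 0) x + s * (deriv (usq u) x / (2 * √(usq u x)))

lemma expDeriv_eq (hu : IsSymbol u) {x : ℝ} (hx : usq u x ≠ 0) (t : ℝ) :
    expDeriv u t x = comb (fun α => u α x)
      (phase t (lam (fun α => u α x) 1) * (Complex.I * t * lamDeriv u 1 x))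
      (phase t (lam (fun α => u α x) (-1)) * (Complex.I * t * lamDeriv u (-1) x)) +
      ((1 / 2 : ℂ) * (phase t (lam (fun α => u α x) 1) - phase t (lam (fun α => u α x) (-1)))) •
        dirDeriv u x := by
  ext i j
  have hphase : ∀ s, HasDerivAt (fun y => phase t (lam (fun α => u α y) s))
      (phase t (lam (fun α => u α x) s) * (Complex.I * t * lamDeriv u s x)) x := by
    intro s
    exact (((hu.hasStrictDerivAt_lam s hx).hasDerivAt.ofReal_comp).const_mul
      (Complex.I * t)).cexp
  have h := ((hphase 1).mul (hu.hasDerivAt_eproj hx 1 i j)).add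
    ((hphase (-1)).mul (hu.hasDerivAt_eproj hx (-1) i j))
  refine h.deriv.trans ?_
  simp only [comb, Matrix.add_apply, Matrix.smul_apply, smul_eq_mul]
  push_cast
  ring

lemma velMat_eq {x : ℝ} (hx : usq u x ≠ 0) :
    velMat u x = comb (fun α => u α x) (lamDeriv u 1 x) (lamDeriv u (-1) x) := by
  have hr : √(usq u x) ≠ 0 := Real.sqrt_ne_zero'.2 (lt_of_le_of_ne (vecSq_nonneg _) (Ne.symm hx))
  have h2 : √(usq u x) ^ 2 = usq u x := Real.sq_sqrt (vecSq_nonneg _)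
  have h1 : deriv (usq u) x / (2 * usq u x) =
      deriv (usq u) x / (2 * √(usq u x)) * (1 / √(usq u x)) := by
    conv_lhs => rw [← h2]
    field_simp
  have h3 : vecSq (fun α => u α x) = usq u x := rfl
  rw [velMat, h1]
  simp only [comb, eproj, lamDeriv, h3, neg_div]
  push_cast
  module

lemma velApprox_sub (hu : IsSymbol u) {x : ℝ} (hx : usq u x ≠ 0) {t : ℝ} (ht : t ≠ 0) :
    velApprox u t x - velMat u x = (-Complex.I / (2 * t) *
      (phase t (lam (fun α => u α x) 1) - phase t (lam (fun α => u α x) (-1)))) •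
        (specFun (fun α => u α x) (phase (-t)) * dirDeriv u x) := by
  have ht' : (t : ℂ) ≠ 0 := by exact_mod_cast ht
  rw [velApprox, hu.expDeriv_eq hx, velMat_eq hx, mul_add, Matrix.mul_smul, specFun_eq_comb,
    comb_mul hx, ← mul_assoc, phase_neg_mul, one_mul, ← mul_assoc, phase_neg_mul, one_mul]
  have h1 : ∀ y : ℝ, (t : ℂ)⁻¹ * -Complex.I * (Complex.I * t * y) = y := by
    intro y
    field_simp
    rw [Complex.I_sq]
    ring
  have h2 : ∀ c d : ℝ, ((t : ℂ)⁻¹ * -Complex.I) • comb (fun α => u α x) (Complex.I * t * c)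
      (Complex.I * t * d) = comb (fun α => u α x) c d := by
    intro c d
    simp only [comb, smul_add, smul_smul, h1]
  rw [smul_add, h2, add_sub_cancel_left, smul_smul]
  congr 1
  field_simp

lemma abs_deriv_usq_le (hu : IsSymbol u) (x : ℝ) :
    |deriv (usq u) x| ≤ 2 * √(usq u x) * √(vecSq (derivVec u x)) := by
  have h : |u 1 x * deriv (u 1) x + u 2 x * deriv (u 2) x + u 3 x * deriv (u 3) x| ≤
      √(usq u x) * √(vecSq (derivVec u x)) := by
    rw [← Real.sqrt_mul (show 0 ≤ usq u x from vecSq_nonneg _)]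
    refine Real.abs_le_sqrt ?_
    unfold usq vecSq derivVec
    nlinarith [sq_nonneg (u 1 x * deriv (u 2) x - u 2 x * deriv (u 1) x),
      sq_nonneg (u 1 x * deriv (u 3) x - u 3 x * deriv (u 1) x),
      sq_nonneg (u 2 x * deriv (u 3) x - u 3 x * deriv (u 2) x)]
  rw [hu.deriv_usq, abs_mul, abs_two, mul_assoc]
  exact mul_le_mul_of_nonneg_left h zero_le_two

lemma norm_dirDeriv_le (hu : IsSymbol u) {x : ℝ} (hx : usq u x ≠ 0) (i j : Fin 2) :
    ‖dirDeriv u x i j‖ ≤ 2 * √(vecSq (derivVec u x)) / √(usq u x) := by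
  set r := √(usq u x) with hr'
  set B := √(vecSq (derivVec u x)) with hB
  have hr : 0 < r := Real.sqrt_pos.2 (lt_of_le_of_ne (vecSq_nonneg _) (Ne.symm hx))
  have h2 : usq u x = r ^ 2 := (Real.sq_sqrt (vecSq_nonneg _)).symm
  have h3 : ‖vecMat (fun α => u α x) i j‖ ≤ r := norm_vecMat_le _ i j
  have h4 : ‖vecMat (derivVec u x) i j‖ ≤ B := norm_vecMat_le _ i j
  have h5 : |deriv (usq u) x| ≤ 2 * r * B := hu.abs_deriv_usq_le x
  have h6 : ‖((r⁻¹ : ℝ) : ℂ) * vecMat (derivVec u x) i j‖ ≤ B / r := by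
    rw [norm_mul, Complex.norm_real, Real.norm_of_nonneg (by positivity), inv_mul_eq_div]
    gcongr
  have h7 : ‖((-(deriv (usq u) x / (2 * r)) / usq u x : ℝ) : ℂ) *
      vecMat (fun α => u α x) i j‖ ≤ B / r := by
    rw [norm_mul, Complex.norm_real, Real.norm_eq_abs, abs_div, abs_neg, abs_div, h2,
      abs_of_pos (show 0 < 2 * r by positivity), abs_of_pos (show 0 < r ^ 2 by positivity)]
    calc |deriv (usq u) x| / (2 * r) / r ^ 2 * ‖vecMat (fun α => u α x) i j‖
        ≤ (2 * r * B) / (2 * r) / r ^ 2 * r := by gcongr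
      _ = B / r := by field_simp
  calc ‖dirDeriv u x i j‖ ≤ B / r + B / r := (norm_add_le _ _).trans (add_le_add h6 h7)
    _ = 2 * B / r := by ring

lemma norm_eproj_le (a : Fin 4 → ℝ) {s : ℝ} (hs : |s| = 1) (i j : Fin 2) : ‖eproj a s i j‖ ≤ 1 := by
  have h1 := norm_vecMat_le a i j
  have h2 : ‖((s / √(vecSq a) : ℝ) : ℂ) * vecMat a i j‖ ≤ 1 := by
    rw [norm_mul, Complex.norm_real, Real.norm_eq_abs, abs_div, hs,
      abs_of_nonneg (Real.sqrt_nonneg _), one_div_mul_eq_div]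
    exact div_le_one_of_le₀ h1 (Real.sqrt_nonneg _)
  have h3 : ‖(1 : Matrix (Fin 2) (Fin 2) ℂ) i j‖ ≤ 1 := by
    rw [Matrix.one_apply]
    split_ifs <;> simp
  have h4 : eproj a s i j = (1 / 2 : ℂ) * ((1 : Matrix (Fin 2) (Fin 2) ℂ) i j +
      ((s / √(vecSq a) : ℝ) : ℂ) * vecMat a i j) := rfl
  rw [h4, norm_mul]
  have h5 := norm_add_le ((1 : Matrix (Fin 2) (Fin 2) ℂ) i j)
    (((s / √(vecSq a) : ℝ) : ℂ) * vecMat a i j)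
  have h6 : ‖(1 / 2 : ℂ)‖ = 1 / 2 := by norm_num
  rw [h6]
  linarith

lemma norm_specFun_phase_le (a : Fin 4 → ℝ) (t : ℝ) (i j : Fin 2) :
    ‖specFun a (phase t) i j‖ ≤ 2 := by
  have h1 : ‖phase t (lam a 1) * eproj a 1 i j‖ ≤ 1 := by
    rw [norm_mul, norm_phase, one_mul]
    exact norm_eproj_le a (by simp) i j
  have h2 : ‖phase t (lam a (-1)) * eproj a (-1) i j‖ ≤ 1 := by
    rw [norm_mul, norm_phase, one_mul]
    exact norm_eproj_le a (by simp) i j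
  calc ‖specFun a (phase t) i j‖ ≤ 1 + 1 := (norm_add_le _ _).trans (add_le_add h1 h2)
    _ = 2 := by norm_num

/-- The difference quotient `(e^{itλ₊} - e^{itλ₋}) / t` is bounded by `2 |u|`, which compensates the
singularity `1 / |u|` of the derivative of the eigenprojections, and by `2 / t`. -/
lemma norm_velApprox_sub_le (hu : IsSymbol u) {x : ℝ} (hx : usq u x ≠ 0) {t : ℝ} (ht : 0 < t)
    (i j : Fin 2) :
    ‖(velApprox u t x - velMat u x) i j‖ ≤ 8 * √(vecSq (derivVec u x)) ∧
      ‖(velApprox u t x - velMat u x) i j‖ ≤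
        (8 * √(vecSq (derivVec u x)) / √(usq u x)) / t := by
  set r := √(usq u x) with hr'
  set B := √(vecSq (derivVec u x)) with hB
  have hr : 0 < r := Real.sqrt_pos.2 (lt_of_le_of_ne (vecSq_nonneg _) (Ne.symm hx))
  set δ := phase t (lam (fun α => u α x) 1) - phase t (lam (fun α => u α x) (-1)) with hδ
  have hδ1 : ‖δ‖ ≤ 2 := by
    refine (norm_sub_le _ _).trans ?_
    rw [norm_phase, norm_phase]
    norm_num
  have hδ2 : ‖δ‖ ≤ t * (2 * r) := by
    refine (phase_sub_le _ _ _).trans_eq ?_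
    have : lam (fun α => u α x) 1 - lam (fun α => u α x) (-1) = 2 * r := by
      unfold lam
      rw [hr', usq]
      ring
    rw [this, abs_of_pos ht, abs_of_pos (by positivity)]
  have hP : ‖(specFun (fun α => u α x) (phase (-t)) * dirDeriv u x) i j‖ ≤ 8 * B / r := by
    rw [Matrix.mul_apply]
    refine (norm_sum_le_of_le _ (n := fun _ => 2 * (2 * B / r)) fun l _ => ?_).trans_eq ?_
    · rw [norm_mul]
      exact mul_le_mul (norm_specFun_phase_le _ _ _ _) (hu.norm_dirDeriv_le hx _ _)
        (norm_nonneg _) zero_le_two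
    · rw [Fin.sum_univ_two]
      ring
  have hc : ‖-Complex.I / (2 * (t : ℂ)) * δ‖ = ‖δ‖ / (2 * t) := by
    rw [norm_mul, norm_div, norm_neg, Complex.norm_I, norm_mul, Complex.norm_real,
      Real.norm_of_nonneg ht.le, Complex.norm_ofNat]
    ring
  rw [hu.velApprox_sub hx ht.ne', Matrix.smul_apply, smul_eq_mul, norm_mul, hc]
  constructor
  · calc ‖δ‖ / (2 * t) * ‖(specFun (fun α => u α x) (phase (-t)) * dirDeriv u x) i j‖
        ≤ (t * (2 * r)) / (2 * t) * (8 * B / r) := by gcongr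
      _ = 8 * B := by field_simp
  · calc ‖δ‖ / (2 * t) * ‖(specFun (fun α => u α x) (phase (-t)) * dirDeriv u x) i j‖
        ≤ 2 / (2 * t) * (8 * B / r) := by gcongr
      _ = 8 * B / r / t := by field_simp

lemma velApprox_eq_of_usq (hu : IsSymbol u) (hw : ∀ x, usq u x = 0) {t : ℝ} (ht : t ≠ 0) (x : ℝ) :
    velApprox u t x = velMat u x := by
  have ht' : (t : ℂ) ≠ 0 := by exact_mod_cast ht
  have h1 : ∀ s y, specFun (fun α => u α y) (phase s) = phase s (u 0 y) • 1 := by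
    intro s y
    rw [specFun_eq_comb, lam_of_vecSq (hw y), lam_of_vecSq (hw y), comb_self]
  have h2 : expDeriv u t x = (phase t (u 0 x) * (Complex.I * t * deriv (u 0) x)) • 1 := by
    ext i j
    have h3 : HasDerivAt (fun y => phase t (u 0 y))
        (phase t (u 0 x) * (Complex.I * t * deriv (u 0) x)) x :=
      ((hu.hasDerivAt 0 x).ofReal_comp.const_mul (Complex.I * t)).cexp
    have h4 := (h3.mul_const ((1 : Matrix (Fin 2) (Fin 2) ℂ) i j)).deriv
    simp only [expDeriv, h1, Matrix.of_apply, Matrix.smul_apply, smul_eq_mul]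
    exact h4
  rw [velApprox, h1, h2, velMat, vecMat_eq_zero _ (hw x), smul_zero, add_zero, smul_mul_smul_comm,
    smul_smul, one_mul, ← mul_assoc (phase (-t) _), phase_neg_mul, one_mul]
  congr 1
  field_simp
  rw [Complex.I_sq]
  ring

lemma norm_velMat_le (hu : IsSymbol u) (x : ℝ) (i j : Fin 2) :
    ‖velMat u x i j‖ ≤ |deriv (u 0) x| + √(vecSq (derivVec u x)) := by
  set r := √(usq u x) with hr'
  set B := √(vecSq (derivVec u x)) with hB
  have h3 : ‖vecMat (fun α => u α x) i j‖ ≤ r := norm_vecMat_le _ i j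
  have h5 : |deriv (usq u) x| ≤ 2 * r * B := hu.abs_deriv_usq_le x
  have h2 : usq u x = r ^ 2 := (Real.sq_sqrt (vecSq_nonneg _)).symm
  have h7 : ‖((deriv (usq u) x / (2 * usq u x) : ℝ) : ℂ) * vecMat (fun α => u α x) i j‖ ≤ B := by
    by_cases hr : r = 0
    · rw [h2, hr]
      simp [hB]
    · have hr0 : 0 < r := lt_of_le_of_ne (Real.sqrt_nonneg _) (Ne.symm hr)
      rw [norm_mul, Complex.norm_real, Real.norm_eq_abs, abs_div, h2,
        abs_of_pos (show 0 < 2 * r ^ 2 by positivity)]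
      calc |deriv (usq u) x| / (2 * r ^ 2) * ‖vecMat (fun α => u α x) i j‖
          ≤ (2 * r * B) / (2 * r ^ 2) * r := by gcongr
        _ = B := by field_simp
  have h8 : ‖((deriv (u 0) x : ℝ) : ℂ) * (1 : Matrix (Fin 2) (Fin 2) ℂ) i j‖ ≤ |deriv (u 0) x| := by
    rw [norm_mul, Complex.norm_real, Real.norm_eq_abs, Matrix.one_apply]
    split_ifs <;> simp
  exact (norm_add_le _ _).trans (add_le_add h8 h7)

end IsSymbol

/-! ### The asymptotic velocity -/

lemma norm_sq_eq_integral (Φ : Dbl MomSpace) :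
    ‖Φ‖ ^ 2 = ∫ k, (‖Φ 0 k‖ ^ 2 + ‖Φ 1 k‖ ^ 2) ∂torusMeasure := by
  have h1 : ((‖Φ‖ ^ 2 : ℝ) : ℂ) = ⟪Φ, Φ⟫_ℂ := by
    rw [inner_self_eq_norm_sq_to_K]
    push_cast
    rfl
  apply Complex.ofReal_injective
  rw [h1, inner_eq_integral, ← integral_complex_ofReal]
  refine integral_congr_ae (Eventually.of_forall fun k => ?_)
  simp only [Fin.sum_univ_two, Complex.conj_mul']
  push_cast
  rfl

/-- Multiplication operators converge strongly if their symbols converge almost everywhere and stay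
bounded; the rate `1 / t` is allowed to depend on the point. -/
lemma tendsto_of_symbol_bound {T : ℝ → Dbl MomSpace →L[ℂ] Dbl MomSpace}
    {D : ℝ → Torus → Matrix (Fin 2) (Fin 2) ℂ} (hT : ∀ t, IsMatMul (T t) (D t)) {C : ℝ}
    (h : ∀ᵐ k ∂torusMeasure, ∃ K, ∀ t > 0, ∀ i j, ‖D t k i j‖ ≤ C ∧ ‖D t k i j‖ ≤ K / t)
    (Φ : Dbl MomSpace) : Tendsto (fun t => T t Φ) atTop (𝓝 0) := by
  have hsq : Tendsto (fun t => ‖T t Φ‖ ^ 2) atTop (𝓝 0) := by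
    have hae : ∀ t, (fun k => ‖T t Φ 0 k‖ ^ 2 + ‖T t Φ 1 k‖ ^ 2) =ᵐ[torusMeasure]
        fun k => ‖∑ j, D t k 0 j * Φ j k‖ ^ 2 + ‖∑ j, D t k 1 j * Φ j k‖ ^ 2 := by
      intro t
      filter_upwards [hT t Φ 0, hT t Φ 1] with k h0 h1
      rw [h0, h1]
    have hint : ∀ t, ‖T t Φ‖ ^ 2 =
        ∫ k, (‖∑ j, D t k 0 j * Φ j k‖ ^ 2 + ‖∑ j, D t k 1 j * Φ j k‖ ^ 2) ∂torusMeasure :=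
      fun t => (norm_sq_eq_integral _).trans (integral_congr_ae (hae t))
    simp only [hint]
    have hz : (0 : ℝ) = ∫ _ : Torus, (0 : ℝ) ∂torusMeasure := by simp
    rw [hz]
    -- the elementary bound on a matrix with small entries
    have hmat : ∀ (A : Matrix (Fin 2) (Fin 2) ℂ) (c : ℝ) (v : Fin 2 → ℂ), (∀ i j, ‖A i j‖ ≤ c) →
        ‖∑ j, A 0 j * v j‖ ^ 2 + ‖∑ j, A 1 j * v j‖ ^ 2 ≤
          4 * c ^ 2 * (‖v 0‖ ^ 2 + ‖v 1‖ ^ 2) := by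
      intro A c v hA
      have hrow : ∀ i, ‖∑ j, A i j * v j‖ ≤ c * (‖v 0‖ + ‖v 1‖) := by
        intro i
        rw [Fin.sum_univ_two, mul_add]
        refine (norm_add_le _ _).trans (add_le_add ?_ ?_) <;> rw [norm_mul] <;>
          exact mul_le_mul_of_nonneg_right (hA _ _) (norm_nonneg _)
      have hc : 0 ≤ c := (norm_nonneg _).trans (hA 0 0)
      have hpos : 0 ≤ c * (‖v 0‖ + ‖v 1‖) := by positivity
      have h0 := pow_le_pow_left₀ (norm_nonneg _) (hrow 0) 2
      have h1 := pow_le_pow_left₀ (norm_nonneg _) (hrow 1) 2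
      nlinarith [mul_nonneg (sq_nonneg c) (sq_nonneg (‖v 0‖ - ‖v 1‖))]
    refine tendsto_integral_filter_of_dominated_convergence
      (fun k => 4 * C ^ 2 * (‖Φ 0 k‖ ^ 2 + ‖Φ 1 k‖ ^ 2)) (Eventually.of_forall fun t => ?_) ?_
      ((integrable_normSq Φ).const_mul _) ?_
    · exact (integrable_normSq (T t Φ)).aestronglyMeasurable.congr (hae t)
    · filter_upwards [eventually_gt_atTop (0 : ℝ)] with t ht
      filter_upwards [h] with k hk
      obtain ⟨K, hK⟩ := hk
      rw [Real.norm_of_nonneg (by positivity)]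
      exact hmat (D t k) C (fun j => Φ j k) fun i j => (hK t ht i j).1
    · filter_upwards [h] with k hk
      obtain ⟨K, hK⟩ := hk
      have hlim : Tendsto (fun t : ℝ => 4 * (K / t) ^ 2 * (‖Φ 0 k‖ ^ 2 + ‖Φ 1 k‖ ^ 2)) atTop
          (𝓝 0) := by
        have h1 : Tendsto (fun t : ℝ => K / t) atTop (𝓝 0) := tendsto_const_nhds.div_atTop tendsto_id
        simpa using ((h1.pow 2).const_mul 4).mul_const (‖Φ 0 k‖ ^ 2 + ‖Φ 1 k‖ ^ 2)
      refine squeeze_zero' (Eventually.of_forall fun t => by positivity) ?_ hlim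
      filter_upwards [eventually_gt_atTop (0 : ℝ)] with t ht
      exact hmat (D t k) (K / t) (fun j => Φ j k) fun i j => (hK t ht i j).2
  have h1 := hsq.sqrt
  simp only [Real.sqrt_sq (norm_nonneg _), Real.sqrt_zero] at h1
  exact tendsto_zero_iff_norm_tendsto_zero.2 h1

/-- The derivative of an element of the domain of the momentum operator is unique. -/
lemma IsMomentumImage.unique {φ ψ ψ' : MomSpace} (h : IsMomentumImage φ ψ)
    (h' : IsMomentumImage φ ψ') : ψ = ψ' := by
  obtain ⟨f, hf, -, hf1, hf2⟩ := h
  obtain ⟨g, hg, -, hg1, hg2⟩ := h'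
  have hle : -π ≤ π := by linarith [Real.pi_pos]
  have hfc := hf.continuousOn
  have hgc := hg.continuousOn
  rw [uIcc_of_le hle] at hfc hgc
  have heq : EqOn f g (Icc (-π) π) := by
    refine Measure.eqOn_Icc_of_ae_eq (μ := volume) (by linarith [Real.pi_pos]) ?_ hfc hgc
    filter_upwards [hf1, hg1] with x h1 h2
    rw [← h1, h2]
  have hder : ∀ᵐ x : ℝ ∂(volume.restrict (Icc (-π) π)), ψ (x : Torus) = ψ' (x : Torus) := by
    have hIoo : ∀ᵐ x : ℝ ∂(volume.restrict (Icc (-π) π)), x ∈ Ioo (-π) π := by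
      rw [← Measure.restrict_congr_set Ioo_ae_eq_Icc]
      exact ae_restrict_mem measurableSet_Ioo
    filter_upwards [hf2, hg2, hIoo] with x h1 h2 hx
    have h3 : f =ᶠ[𝓝 x] g :=
      Filter.eventually_of_mem (isOpen_Ioo.mem_nhds hx) fun y hy => heq (Ioo_subset_Icc_self hy)
    rw [h1, h2, h3.deriv_eq]
  refine Lp.ext ?_
  filter_upwards [ae_rep hder] with k hk
  rwa [coe_rep] at hk

/-- Plane waves belong to the domain of the momentum operator. -/
lemma exists_isMomentumImage_planeWave (n : ℤ) (j : Fin 2) :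
    ∃ Ψ, IsDblMomentumImage (planeWave n j) Ψ := by
  refine ⟨(n : ℂ) • planeWave n j, fun i => ?_⟩
  have hpi : (2 * π : ℂ) ≠ 0 := by
    have := Real.pi_pos.ne'
    exact_mod_cast mul_ne_zero two_ne_zero this
  refine ⟨fun x => if i = j then fourier n (x : Torus) else 0, ?_, ?_, ?_, ?_⟩
  · have hc : ContDiff ℝ 1 fun x : ℝ => if i = j then fourier n (x : Torus) else 0 := by
      by_cases h : i = j
      · simp only [h, if_true, fourier_coe_apply]
        have h1 : ContDiff ℝ 1 fun x : ℝ => (x : ℂ) := Complex.ofRealCLM.contDiff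
        exact ((contDiff_const.mul h1).div_const _).cexp
      · simp only [h, if_false]
        exact contDiff_const
    exact hc.contDiffOn.absolutelyContinuousOnInterval
  · have : ((π : ℝ) : Torus) = ((-π : ℝ) : Torus) := by
      rw [← sub_eq_zero, ← AddCircle.coe_sub, show π - -π = 2 * π by ring]
      exact AddCircle.coe_period _
    simp only [this]
  · exact ae_coe (planeWave_apply n i j)
  · have h1 : ∀ᵐ k ∂torusMeasure, ((n : ℂ) • planeWave n j) i k =
        n * if i = j then fourier n k else 0 := by
      filter_upwards [planeWave_apply n i j, Lp.coeFn_smul (n : ℂ) (planeWave n j i)] with k h1 h2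
      have h3 : ((n : ℂ) • planeWave n j) i = (n : ℂ) • planeWave n j i := rfl
      rw [h3, h2, Pi.smul_apply, h1, smul_eq_mul]
    filter_upwards [ae_coe h1] with x hx
    rw [hx]
    by_cases h : i = j
    · simp only [h, if_true]
      rw [(hasDerivAt_fourier (2 * π) n x).deriv]
      push_cast
      field_simp
      rw [Complex.I_sq]
      ring
    · simp [h]

/-- The asymptotic velocity is unique, because plane waves span a dense subspace. -/
theorem IsAsymptoticVelocity.unique {U V V' : Dbl MomSpace →L[ℂ] Dbl MomSpace}
    (h : IsAsymptoticVelocity U V) (h' : IsAsymptoticVelocity U V') : V = V' := by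
  refine clm_ext_planeWave fun n j => ?_
  obtain ⟨X, hX, hl⟩ := h _ (exists_isMomentumImage_planeWave n j)
  obtain ⟨X', hX', hl'⟩ := h' _ (exists_isMomentumImage_planeWave n j)
  have hXX : X = X' := funext fun t => PiLp.ext fun i => (hX t i).unique (hX' t i)
  rw [hXX] at hl
  exact tendsto_nhds_unique hl hl'

namespace IsSymbol

variable {u : Fin 4 → ℝ → ℝ}

lemma specFun_phase_periodic (hu : IsSymbol u) (t : ℝ) :
    specFun (fun α => u α π) (phase t) = specFun (fun α => u α (-π)) (phase t) := by
  have h : ∀ α, u α π = u α (-π) := fun α => by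
    have := hu.periodic α (-π)
    rwa [neg_pi_add] at this
  simp only [h]

lemma measurable_derivVec (u : Fin 4 → ℝ → ℝ) (α : Fin 4) :
    Measurable fun k => derivVec u (rep k) α :=
  (_root_.measurable_deriv (u α)).comp measurable_rep

lemma continuous_derivVec (hu : IsSymbol u) (α : Fin 4) : Continuous (deriv (u α)) :=
  continuousOn_univ.1 (hu.analytic α).deriv.continuousOn

lemma exists_isMatMul_velMat (hu : IsSymbol u) : ∃ V, IsMatMul V (fun k => velMat u (rep k)) := by
  have hc : Continuous fun x => |deriv (u 0) x| + √(vecSq (derivVec u x)) := by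
    have h0 := hu.continuous_derivVec 0
    have h1 := hu.continuous_derivVec 1
    have h2 := hu.continuous_derivVec 2
    have h3 := hu.continuous_derivVec 3
    unfold vecSq derivVec
    fun_prop
  obtain ⟨C, hC⟩ := exists_bound hc
  refine exists_isMatMul (fun i j => ?_) (C := C) fun k i j =>
    (hu.norm_velMat_le _ i j).trans ((le_abs_self _).trans (hC k))
  have h1 := measurable_vecMat hu.measurable i j
  have h2 := Complex.measurable_ofReal.comp (measurable_derivVec u 0)
  have h3 : Measurable fun k => deriv (usq u) (rep k) / (2 * usq u (rep k)) :=
    ((_root_.measurable_deriv (usq u)).comp measurable_rep).div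
      ((measurable_vecSq hu.measurable).const_mul 2)
  have h4 := Complex.measurable_ofReal.comp h3
  exact (h2.mul_const _).add (h4.mul h1)

lemma exists_isMatMul_expDeriv (hu : IsSymbol u) (t : ℝ) :
    ∃ T, IsMatMul T (fun k => expDeriv u t (rep k)) := by
  have hc : ∀ i j, Continuous (deriv fun y => specFun (fun α => u α y) (phase t) i j) :=
    fun i j => (hu.contDiff_exp t i j).continuous_deriv (by norm_num)
  choose C hC using fun i j => isCompact_Icc.exists_bound_of_continuousOn (s := Icc (-π) π)
    (hc i j).continuousOn
  refine exists_isMatMul (fun i j => (hc i j).measurable.comp measurable_rep)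
    (C := ∑ i, ∑ j, |C i j|) fun k i j => ?_
  refine ((hC i j _ (rep_mem_Icc k)).trans (le_abs_self _)).trans ?_
  exact (Finset.single_le_sum (f := fun j => |C i j|) (fun _ _ => abs_nonneg _)
    (Finset.mem_univ j)).trans (Finset.single_le_sum (f := fun i => ∑ j, |C i j|)
    (fun _ _ => Finset.sum_nonneg fun _ _ => abs_nonneg _) (Finset.mem_univ i))

/-- The group `e^{itU}` preserves the domain of the momentum operator, and the product rule
holds. -/
lemma isDblMomentumImage_exp (hu : IsSymbol u) {t : ℝ} {T T' : Dbl MomSpace →L[ℂ] Dbl MomSpace}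
    (hT : IsMatMul T (fun k => specFun (onTorus u k) (phase t)))
    (hT' : IsMatMul T' (fun k => expDeriv u t (rep k))) {Φ Ψ : Dbl MomSpace}
    (h : IsDblMomentumImage Φ Ψ) : IsDblMomentumImage (T Φ) (T Ψ + (-Complex.I) • T' Φ) := by
  choose f hf1 hf2 hf3 hf4 using h
  intro i
  set e : Fin 2 → ℝ → ℂ := fun j x => specFun (fun α => u α x) (phase t) i j with he
  have hec : ∀ j, ContDiff ℝ 1 (e j) := fun j => hu.contDiff_exp t i j
  have hdiff : ∀ j, ∀ᵐ x : ℝ ∂(volume.restrict (Icc (-π) π)), DifferentiableAt ℝ (f j) x := by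
    intro j
    have h1 := (hf1 j).boundedVariationOn.ae_differentiableAt_of_mem_uIcc
    rw [uIcc_of_le (by linarith [Real.pi_pos])] at h1
    exact (ae_restrict_iff' measurableSet_Icc).2 h1
  refine ⟨fun x => e 0 x * f 0 x + e 1 x * f 1 x, ?_, ?_, ?_, ?_⟩
  · exact ((hec 0).contDiffOn.absolutelyContinuousOnInterval.smul (hf1 0)).add
      ((hec 1).contDiffOn.absolutelyContinuousOnInterval.smul (hf1 1))
  · simp only [he, hu.specFun_phase_periodic, hf2]
  · filter_upwards [ae_coe (hT Φ i), hf3 0, hf3 1, ae_mem_Ioc] with x h1 h2 h3 h4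
    rw [h1, Fin.sum_univ_two, h2, h3]
    have ho : onTorus u (x : Torus) = fun α => u α x :=
      funext fun α => by rw [onTorus, rep_coe h4]
    simp only [ho, he]
  · have hX : ∀ᵐ k ∂torusMeasure, (T Ψ + (-Complex.I) • T' Φ) i k =
        T Ψ i k + (-Complex.I) * T' Φ i k := by
      filter_upwards [Lp.coeFn_add (T Ψ i) ((-Complex.I) • T' Φ i),
        Lp.coeFn_smul (-Complex.I) (T' Φ i)] with k h1 h2
      have h3 : (T Ψ + (-Complex.I) • T' Φ) i = T Ψ i + (-Complex.I) • T' Φ i := rfl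
      rw [h3, h1, Pi.add_apply, h2, Pi.smul_apply, smul_eq_mul]
    filter_upwards [ae_coe hX, ae_coe (hT Ψ i), ae_coe (hT' Φ i), hf3 0, hf3 1, hf4 0, hf4 1,
      hdiff 0, hdiff 1, ae_mem_Ioc] with x h1 h2 h3 h4 h5 h6 h7 h8 h9 h10
    have hd : ∀ j, HasDerivAt (e j) (deriv (e j) x) x := fun j =>
      ((hec j).differentiable (by norm_num) x).hasDerivAt
    have hder := (((hd 0).mul h8.hasDerivAt).add ((hd 1).mul h9.hasDerivAt)).deriv
    have hder' : deriv (fun x => e 0 x * f 0 x + e 1 x * f 1 x) x =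
      deriv (e 0) x * f 0 x + e 0 x * deriv (f 0) x +
        (deriv (e 1) x * f 1 x + e 1 x * deriv (f 1) x) := hder
    rw [h1, h2, h3, hder', Fin.sum_univ_two, Fin.sum_univ_two, h4, h5, h6, h7]
    have ho : onTorus u (x : Torus) = fun α => u α x :=
      funext fun α => by rw [onTorus, rep_coe h10]
    simp only [ho, rep_coe h10, expDeriv, Matrix.of_apply, he]
    ring

/-- The asymptotic velocity exists and is the multiplication operator with symbol `velMat u`. -/
theorem isAsymptoticVelocity (hu : IsSymbol u) {U V : Dbl MomSpace →L[ℂ] Dbl MomSpace}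
    (hU : IsMatMul U (fun k => symb (onTorus u k)))
    (hV : IsMatMul V (fun k => velMat u (rep k))) : IsAsymptoticVelocity U V := by
  rintro Φ ⟨Ψ, hΨ⟩
  choose T' hT' using hu.exists_isMatMul_expDeriv
  set E : ℝ → Dbl MomSpace →L[ℂ] Dbl MomSpace := fun t => NormedSpace.exp ((Complex.I * t) • U)
    with hE
  have hEM : ∀ t, IsMatMul (E t) (fun k => specFun (onTorus u k) (phase t)) :=
    fun t => isMatMul_exp hU t
  have hneg : ∀ t : ℝ, NormedSpace.exp ((-(Complex.I * t)) • U) = E (-t) := by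
    intro t
    simp only [hE]
    push_cast
    rw [mul_neg]
  have hinv : ∀ t, E (-t) * E t = 1 := by
    intro t
    refine ((hEM (-t)).mul (hEM t)).ext IsMatMul.one (Eventually.of_forall fun k => ?_)
    simp only [specFun_mul, phase_neg_mul]
    rw [specFun_eq_comb, comb_self, one_smul]
  refine ⟨fun t => E t Ψ + (-Complex.I) • T' t Φ, fun t => ?_, ?_⟩
  · exact hu.isDblMomentumImage_exp (hEM t) (hT' t) hΨ
  set A : ℝ → Dbl MomSpace →L[ℂ] Dbl MomSpace := fun t =>
    ((t : ℂ)⁻¹ * -Complex.I) • (E (-t) * T' t) with hA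
  have hAM : ∀ t, IsMatMul (A t) (fun k => velApprox u t (rep k)) := fun t =>
    ((hEM (-t)).mul (hT' t)).smul _
  have hbc : Continuous fun x => 8 * √(vecSq (derivVec u x)) := by
    have h1 := hu.continuous_derivVec 1
    have h2 := hu.continuous_derivVec 2
    have h3 := hu.continuous_derivVec 3
    unfold vecSq derivVec
    fun_prop
  obtain ⟨C, hC⟩ := exists_bound hbc
  have hAV : Tendsto (fun t => (A t - V) Φ) atTop (𝓝 0) := by
    refine tendsto_of_symbol_bound (fun t => (hAM t).sub hV) (C := C) ?_ Φ
    by_cases hw : ∀ x, usq u x = 0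
    · refine Eventually.of_forall fun k => ⟨0, fun t ht i j => ?_⟩
      rw [hu.velApprox_eq_of_usq hw ht.ne', sub_self]
      simp only [Matrix.zero_apply, norm_zero, zero_div, le_refl, and_true]
      exact (abs_nonneg _).trans (hC k)
    · push Not at hw
      filter_upwards [ae_rep (ae_restrict_of_ae (ae_ne_zero_of_analytic hu.analytic_usq hw))] with
        k hk
      refine ⟨_, fun t ht i j => ⟨?_, (hu.norm_velApprox_sub_le hk ht i j).2⟩⟩
      exact ((hu.norm_velApprox_sub_le hk ht i j).1.trans (le_abs_self _)).trans (hC k)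
  have hΨlim : Tendsto (fun t : ℝ => ((t : ℂ)⁻¹) • Ψ) atTop (𝓝 0) := by
    have h1 : Tendsto (fun t : ℝ => ((t⁻¹ : ℝ) : ℂ)) atTop (𝓝 ((0 : ℝ) : ℂ)) :=
      (Complex.continuous_ofReal.tendsto 0).comp tendsto_inv_atTop_zero
    have h2 := h1.smul_const Ψ
    simpa using h2
  have hsum := (hΨlim.add hAV).add_const (V Φ)
  rw [zero_add, zero_add] at hsum
  refine hsum.congr fun t => ?_
  have h1 : E (-t) (E t Ψ) = Ψ := congrArg (fun S : Dbl MomSpace →L[ℂ] Dbl MomSpace => S Ψ) (hinv t)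
  have h2 : A t Φ = ((t : ℂ)⁻¹ * -Complex.I) • E (-t) (T' t Φ) := rfl
  rw [hneg, map_add, map_smul, h1, sub_apply, h2]
  module

end IsSymbol

/-! ### The kernel of the asymptotic velocity -/

lemma zero_mem_eig_iff {E : Type*} [NormedAddCommGroup E] [InnerProductSpace ℂ E]
    (A : E →L[ℂ] E) : (0 : ℂ) ∈ eig A ↔ ∃ v, v ≠ 0 ∧ A v = 0 := by
  constructor
  · intro h
    obtain ⟨v, hv⟩ := Module.End.HasEigenvalue.exists_hasEigenvector h
    refine ⟨v, hv.2, ?_⟩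
    have h1 := hv.apply_eq_smul
    rwa [zero_smul] at h1
  · rintro ⟨v, hv, hA⟩
    refine Module.End.hasEigenvalue_of_hasEigenvector (x := v) ⟨?_, hv⟩
    rw [Module.End.mem_eigenspace_iff, zero_smul]
    exact hA

lemma velMat_mul (u : Fin 4 → ℝ → ℝ) (x : ℝ) :
    (((deriv (u 0) x : ℝ) : ℂ) • 1 -
      ((deriv (usq u) x / (2 * usq u x) : ℝ) : ℂ) • vecMat (fun α => u α x)) * velMat u x =
      ((deriv (u 0) x ^ 2 - (deriv (usq u) x / (2 * usq u x)) ^ 2 * usq u x : ℝ) : ℂ) • 1 := by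
  have h : vecMat (fun α => u α x) * vecMat (fun α => u α x) = (usq u x : ℂ) • 1 :=
    vecMat_mul_self _
  rw [velMat]
  simp only [sub_mul, mul_add, smul_mul_smul_comm, mul_one, one_mul, h, smul_smul]
  push_cast
  module

namespace IsSymbol

variable {u : Fin 4 → ℝ → ℝ} {V : Dbl MomSpace →L[ℂ] Dbl MomSpace}

/-- The product of the derivatives of the eigenvalues of the symbol is non-zero almost everywhere
for dispersive symbols. -/
lemma ae_det_velMat_ne_zero (hu : IsSymbol u) (hd : Dispersive u) :
    ∀ᵐ k ∂torusMeasure, deriv (u 0) (rep k) ^ 2 -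
      (deriv (usq u) (rep k) / (2 * usq u (rep k))) ^ 2 * usq u (rep k) ≠ 0 := by
  refine ae_rep (p := fun x => deriv (u 0) x ^ 2 -
    (deriv (usq u) x / (2 * usq u x)) ^ 2 * usq u x ≠ 0) (ae_restrict_of_ae ?_)
  rcases hd with hd | ⟨hw, h0⟩
  · filter_upwards [ae_ne_zero_of_analytic hu.analytic_discr hd,
      ae_ne_zero_of_analytic hu.analytic_usq (exists_usq_ne_zero hd)] with x h2 h3 h
    apply h2
    rw [discr]
    field_simp at h
    linarith
  · filter_upwards [ae_ne_zero_of_analytic (hu.analytic 0).deriv h0] with x hx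
    rw [hw x]
    simpa using hx

lemma zero_notMem_eig_of_dispersive (hu : IsSymbol u)
    (hV : IsMatMul V (fun k => velMat u (rep k))) (hd : Dispersive u) : (0 : ℂ) ∉ eig V := by
  rw [zero_mem_eig_iff]
  rintro ⟨Φ, hΦ, h⟩
  apply hΦ
  rw [eq_zero_iff_at] at h ⊢
  filter_upwards [h, hV.at_eq Φ, hu.ae_det_velMat_ne_zero hd] with k h1 h2 h3
  rw [h1] at h2
  have h4 := congrArg (fun v => (((deriv (u 0) (rep k) : ℝ) : ℂ) • 1 -
    ((deriv (usq u) (rep k) / (2 * usq u (rep k)) : ℝ) : ℂ) •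
      vecMat (fun α => u α (rep k))).mulVec v) h2
  simp only [Matrix.mulVec_zero, Matrix.mulVec_mulVec, velMat_mul] at h4
  rw [Matrix.smul_mulVec, Matrix.one_mulVec, eq_comm, smul_eq_zero] at h4
  exact h4.resolve_left (Complex.ofReal_ne_zero.2 h3)

lemma zero_mem_eig_of_const (hV : IsMatMul V (fun k => velMat u (rep k)))
    (h0 : ∀ x, u 0 x = 0) (hw : ∀ x, deriv (usq u) x = 0) : (0 : ℂ) ∈ eig V := by
  have h1 : u 0 = fun _ => 0 := funext h0
  have hV0 : V = 0 := hV.ext IsMatMul.zero (Eventually.of_forall fun k => by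
    simp [velMat, hw, h1])
  rw [zero_mem_eig_iff]
  refine ⟨planeWave 0 0, fun h => ?_, by rw [hV0]; rfl⟩
  have h2 : ∀ᵐ k ∂torusMeasure, (0 : ℂ) = 1 := by
    filter_upwards [planeWave_apply 0 0 0, (eq_zero_iff_at _).1 h] with k h3 h4
    have h5 := congrFun h4 0
    rw [at_, h3] at h5
    simpa using h5.symm
  exact zero_ne_one h2.exists.choose_spec

lemma zero_mem_eig_of_sq_eq (hu : IsSymbol u) (hV : IsMatMul V (fun k => velMat u (rep k)))
    (h0 : ∃ x, u 0 x ≠ 0) (hw : ∀ x, usq u x = u 0 x ^ 2) : (0 : ℂ) ∈ eig V := by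
  obtain ⟨N, hN⟩ := exists_isMatMul_kerMat hu hw
  -- the symbol of the velocity is `(u₀' / u₀)` times the symbol of the Hamiltonian
  have hVN : V * N = 0 := by
    refine (hV.mul hN).ext IsMatMul.zero ?_
    filter_upwards [ae_zero_ne hu h0] with k hk
    have h1 : deriv (usq u) (rep k) = 2 * u 0 (rep k) * deriv (u 0) (rep k) := by
      have h2 : usq u = fun x => u 0 x ^ 2 := funext hw
      rw [h2]
      refine ((hu.hasDerivAt 0 (rep k)).pow 2).deriv.trans ?_
      push_cast
      ring
    have h3 : velMat u (rep k) =
        ((deriv (u 0) (rep k) / u 0 (rep k) : ℝ) : ℂ) • symb (onTorus u k) := by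
      have hk' : u 0 (rep k) ≠ 0 := hk
      have h4 : deriv (usq u) (rep k) / (2 * usq u (rep k)) =
          deriv (u 0) (rep k) / u 0 (rep k) := by
        rw [h1, hw]
        field_simp
      have h5 : (deriv (u 0) (rep k) / u 0 (rep k)) * u 0 (rep k) = deriv (u 0) (rep k) :=
        div_mul_cancel₀ _ hk'
      rw [velMat, h4, symb_eq, smul_add, smul_smul, onTorus, ← Complex.ofReal_mul, h5]
      rfl
    rw [h3, smul_mul_assoc, symb_mul_kerMat hk (hw _), smul_zero]
  rw [zero_mem_eig_iff]
  by_contra! h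
  have hN0 : N = 0 := by
    ext1 Φ
    by_contra hne
    exact h (N Φ) hne (congrArg (fun S : Dbl MomSpace →L[ℂ] Dbl MomSpace => S Φ) hVN)
  rw [hN0] at hN
  obtain ⟨k, hk⟩ := (hN.symbol_unique IsMatMul.zero).exists
  have h1 := kerMat_trace (onTorus u k)
  rw [hk] at h1
  simp at h1

end IsSymbol

/-! ### The symbol of a translation invariant Hamiltonian of finite range -/

lemma lp_smul_apply (c : ℂ) (f : PosSpace) (x : ℤ) : ((c • f : PosSpace) : ℤ → ℂ) x = c * f x := rfl

/-- The vector `δ_x` in the component `j`. -/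
def siteVec (x : ℤ) (j : Fin 2) : Dbl PosSpace := PiLp.single 2 j (lp.single 2 x (1 : ℂ))

lemma siteVec_apply (x : ℤ) (j i : Fin 2) (y : ℤ) :
    (siteVec x j i : ℤ → ℂ) y = if i = j ∧ y = x then 1 else 0 := by
  by_cases h : i = j
  · subst h
    rw [siteVec, PiLp.single_eq_same, lp.single_apply]
    by_cases hy : y = x
    · subst hy
      simp
    · simp [hy]
  · rw [siteVec, PiLp.single_eq_of_ne (p := 2) h]
    simp [h]

lemma fourierTransform_single (x : ℤ) :
    fourierTransform (lp.single 2 x (1 : ℂ)) = fourierLp (T := 2 * π) 2 x := by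
  have h := HilbertBasis.repr_symm_single (fourierBasis (T := 2 * π)) x
  rw [coe_fourierBasis] at h
  exact h

lemma dblFourier_apply (F : Dbl PosSpace) (i : Fin 2) : dblFourier F i = fourierTransform (F i) :=
  rfl

lemma dblFourier_siteVec (x : ℤ) (j : Fin 2) : dblFourier (siteVec x j) = planeWave x j := by
  refine PiLp.ext fun i => ?_
  rw [dblFourier_apply]
  by_cases h : i = j
  · subst h
    rw [siteVec, planeWave, PiLp.single_eq_same, PiLp.single_eq_same, fourierTransform_single]
  · rw [siteVec, planeWave, PiLp.single_eq_of_ne (p := 2) h, PiLp.single_eq_of_ne (p := 2) h,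
      map_zero]

lemma Θ_siteVec (x : ℤ) (j : Fin 2) : Θ (siteVec x j) = siteVec (x + 1) j := by
  refine PiLp.ext fun i => lp.ext (funext fun y => ?_)
  rw [Θ_apply, siteVec_apply, siteVec_apply]
  simp only [sub_eq_iff_eq_add]

lemma Γ_apply_zero (F : Dbl PosSpace) (x : ℤ) : (Γ F 0 : ℤ → ℂ) x = conj ((F 1 : ℤ → ℂ) x) := rfl

lemma Γ_apply_one (F : Dbl PosSpace) (x : ℤ) : (Γ F 1 : ℤ → ℂ) x = conj ((F 0 : ℤ → ℂ) x) := rfl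

lemma Γ_apply (F : Dbl PosSpace) (i : Fin 2) (x : ℤ) :
    (Γ F i : ℤ → ℂ) x = conj ((F (1 - i) : ℤ → ℂ) x) := by
  fin_cases i
  · exact Γ_apply_zero F x
  · exact Γ_apply_one F x

lemma Γ_siteVec (x : ℤ) (j : Fin 2) : Γ (siteVec x j) = siteVec x (1 - j) := by
  refine PiLp.ext fun i => lp.ext (funext fun y => ?_)
  rw [Γ_apply, siteVec_apply, siteVec_apply]
  have : 1 - i = j ↔ i = 1 - j := by
    fin_cases i <;> fin_cases j <;> decide
  simp only [this]
  split_ifs <;> simp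

lemma inner_siteVec (F : Dbl PosSpace) (x : ℤ) (i : Fin 2) :
    ⟪siteVec x i, F⟫_ℂ = (F i : ℤ → ℂ) x := by
  rw [PiLp.inner_apply, Finset.sum_eq_single i]
  · rw [siteVec, PiLp.single_eq_same, lp.inner_single_left]
    simp
  · intro j _ hj
    rw [siteVec, PiLp.single_eq_of_ne (p := 2) hj, inner_zero_left]
  · simp

lemma Q_apply (M : Set ℤ) (F : Dbl PosSpace) (i : Fin 2) (x : ℤ) :
    (Q M F i : ℤ → ℂ) x = M.indicator (F i : ℤ → ℂ) x := by
  have h : Q M F i = q M (F i) := by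
    rw [Q, opMatrix_apply, Fin.sum_univ_two]
    fin_cases i <;> simp [pauli]
  rw [h]
  rfl

lemma Q_siteVec {M : Set ℤ} {x : ℤ} (hx : x ∈ M) (j : Fin 2) : Q M (siteVec x j) = siteVec x j := by
  refine PiLp.ext fun i => lp.ext (funext fun y => ?_)
  rw [Q_apply]
  by_cases hy : y ∈ M
  · rw [Set.indicator_of_mem hy]
  · rw [Set.indicator_of_notMem hy, siteVec_apply, if_neg]
    rintro ⟨-, rfl⟩
    exact hy hx

/-- The matrix elements of a translation invariant operator. -/
def hop (H : Dbl PosSpace →L[ℂ] Dbl PosSpace) (i j : Fin 2) (n : ℤ) : ℂ :=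
  (H (siteVec 0 j) i : ℤ → ℂ) n

/-- The entry `∑ h_{ij}(n) e^{inx}` of the symbol, where the sum extends over `|n| ≤ N`. -/
def entry (H : Dbl PosSpace →L[ℂ] Dbl PosSpace) (N : ℤ) (i j : Fin 2) (x : ℝ) : ℂ :=
  ∑ n ∈ Finset.Icc (-N) N, hop H i j n * Complex.exp (Complex.I * n * x)

/-- The Pauli coefficients of the Hermitian matrix with entries `entry H N i j`. -/
def coeffs (H : Dbl PosSpace →L[ℂ] Dbl PosSpace) (N : ℤ) : Fin 4 → ℝ → ℝ :=
  ![fun x => ((entry H N 0 0 x).re + (entry H N 1 1 x).re) / 2, fun x => (entry H N 0 1 x).re,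
    fun x => -(entry H N 0 1 x).im, fun x => ((entry H N 0 0 x).re - (entry H N 1 1 x).re) / 2]

/-- An operator is identified as a multiplication operator on the plane waves. -/
lemma IsMatMul.of_planeWave {T T' : Dbl MomSpace →L[ℂ] Dbl MomSpace}
    {M : Torus → Matrix (Fin 2) (Fin 2) ℂ} (hT' : IsMatMul T' M)
    (h : ∀ n j i, ∀ᵐ k ∂torusMeasure, T (planeWave n j) i k = M k i j * fourier n k) :
    IsMatMul T M := by
  have hTT : T = T' := by
    refine clm_ext_planeWave fun n j => PiLp.ext fun i => Lp.ext ?_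
    filter_upwards [h n j i, hT' (planeWave n j) i, planeWave_apply n 0 j,
      planeWave_apply n 1 j] with k h1 h2 h3 h4
    rw [h1, h2, Fin.sum_univ_two, h3, h4]
    fin_cases j <;> simp
  rw [hTT]
  exact hT'

namespace IsAdmissible

variable {xL xR : ℤ} {H : Dbl PosSpace →L[ℂ] Dbl PosSpace}

lemma apply_siteVec_add_one (h : IsAdmissible xL xR H) (y : ℤ) (i j : Fin 2) (x : ℤ) :
    (H (siteVec (y + 1) j) i : ℤ → ℂ) x = (H (siteVec y j) i : ℤ → ℂ) (x - 1) := by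
  have h1 : H (Θ (siteVec y j)) = Θ (H (siteVec y j)) :=
    congrArg (fun T : Dbl PosSpace →L[ℂ] Dbl PosSpace => T (siteVec y j)) h.translation
  rw [← Θ_siteVec, h1, Θ_apply]

lemma apply_siteVec (h : IsAdmissible xL xR H) (y : ℤ) (i j : Fin 2) (x : ℤ) :
    (H (siteVec y j) i : ℤ → ℂ) x = hop H i j (x - y) := by
  induction y using Int.induction_on generalizing x with
  | zero => rw [sub_zero, hop]
  | succ y ih =>
    rw [h.apply_siteVec_add_one, ih]
    congr 1
    ring
  | pred y ih =>
    have h1 := h.apply_siteVec_add_one (-(y : ℤ) - 1) i j (x + 1)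
    rw [sub_add_cancel, add_sub_cancel_right] at h1
    rw [← h1, ih]
    congr 1
    ring

lemma hop_conj (h : IsAdmissible xL xR H) (i j : Fin 2) (n : ℤ) :
    conj (hop H i j n) = hop H j i (-n) := by
  have hs : ⟪H (siteVec 0 j), siteVec n i⟫_ℂ = ⟪siteVec 0 j, H (siteVec n i)⟫_ℂ := by
    rw [← ContinuousLinearMap.adjoint_inner_left, h.hamiltonian.selfAdjoint.adjoint_eq]
  rw [← inner_conj_symm, inner_siteVec, inner_siteVec, h.apply_siteVec n, zero_sub] at hs
  exact hs

/-- The conjugation symmetry of the matrix elements. -/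
lemma hop_conjugation (h : IsAdmissible xL xR H) (i j : Fin 2) (n : ℤ) :
    conj (hop H (1 - i) (1 - j) n) = -hop H i j n := by
  have h1 := h.hamiltonian.conjugation (siteVec 0 j)
  rw [Γ_siteVec] at h1
  have h2 := congrArg (fun F : Dbl PosSpace => (F i : ℤ → ℂ) n) h1
  simp only [Γ_apply] at h2
  exact h2

lemma hop_eq_zero_of_le (h : IsAdmissible xL xR H) (i j : Fin 2) {n : ℤ} (hn : n ≤ xL - xR - 2) :
    hop H i j n = 0 := by
  have h1 : reservoirCoupling xL xR H (siteVec (xR + 1) j) = 0 := by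
    rw [h.coupling]
    rfl
  have h2 := congrArg (fun F : Dbl PosSpace => (F i : ℤ → ℂ) (n + (xR + 1))) h1
  have h3 : reservoirCoupling xL xR H (siteVec (xR + 1) j) =
      Q (Iic (xL - 1)) (H (Q (Ici (xR + 1)) (siteVec (xR + 1) j))) := rfl
  have h4 : n + (xR + 1) ∈ Iic (xL - 1) := by
    rw [mem_Iic]
    linarith
  simp only [h3, Q_siteVec (self_mem_Ici), Q_apply, Set.indicator_of_mem h4, h.apply_siteVec] at h2
  rw [add_sub_cancel_right] at h2
  exact h2

/-- The range of the Hamiltonian is finite. -/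
lemma hop_eq_zero (h : IsAdmissible xL xR H) (i j : Fin 2) {n : ℤ}
    (hn : n ∉ Finset.Icc (-(xR + 2 - xL)) (xR + 2 - xL)) : hop H i j n = 0 := by
  rw [Finset.mem_Icc, not_and_or, not_le, not_le] at hn
  rcases hn with hn | hn
  · exact h.hop_eq_zero_of_le i j (by linarith)
  · have h1 := h.hop_conj i j n
    rw [h.hop_eq_zero_of_le j i (by linarith)] at h1
    exact (map_eq_zero _).1 h1

lemma entry_conj (h : IsAdmissible xL xR H) (N : ℤ) (i j : Fin 2) (x : ℝ) :
    conj (entry H N i j x) = entry H N j i x := by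
  rw [entry, map_sum]
  refine Finset.sum_nbij' (fun n => -n) (fun n => -n) ?_ ?_ (by simp) (by simp) ?_
  · intro n hn
    rw [Finset.mem_Icc] at hn ⊢
    constructor <;> linarith
  · intro n hn
    rw [Finset.mem_Icc] at hn ⊢
    constructor <;> linarith
  · intro n _
    rw [map_mul, h.hop_conj, ← Complex.exp_conj]
    simp only [map_mul, Complex.conj_I, Complex.conj_ofReal, map_intCast]
    congr 2
    push_cast
    ring

lemma entry_conjugation (h : IsAdmissible xL xR H) (N : ℤ) (i j : Fin 2) (x : ℝ) :
    entry H N i j (-x) = -conj (entry H N (1 - i) (1 - j) x) := by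
  rw [entry, entry, map_sum, ← Finset.sum_neg_distrib]
  refine Finset.sum_congr rfl fun n _ => ?_
  rw [map_mul, h.hop_conjugation, ← Complex.exp_conj]
  simp only [map_mul, Complex.conj_I, Complex.conj_ofReal, map_intCast]
  rw [neg_mul, neg_neg]
  congr 2
  push_cast
  ring

/-- The Pauli coefficients are trigonometric polynomials; the conjugation symmetry makes `u₀`, `u₁`,
`u₂` odd and `u₃` even. -/
lemma isSymbol_coeffs (h : IsAdmissible xL xR H) (N : ℤ) : IsSymbol (coeffs H N) := by
  have hre : ∀ i j, AnalyticOnNhd ℝ (fun x => (entry H N i j x).re) univ ∧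
      AnalyticOnNhd ℝ (fun x => (entry H N i j x).im) univ := by
    intro i j
    have h1 : AnalyticOnNhd ℝ (fun x => entry H N i j x) univ := by
      intro x _
      unfold entry
      refine Finset.analyticAt_fun_sum _ fun n _ => analyticAt_const.mul ?_
      have h2 : AnalyticAt ℝ (fun x : ℝ => Complex.I * n * (x : ℂ)) x :=
        analyticAt_const.mul (Complex.ofRealCLM.analyticAt x)
      exact (analyticAt_cexp.restrictScalars (𝕜 := ℝ)).comp h2
    exact ⟨fun x hx => (Complex.reCLM.analyticAt _).comp (h1 x hx),
      fun x hx => (Complex.imCLM.analyticAt _).comp (h1 x hx)⟩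
  have hper : ∀ i j x, entry H N i j (x + 2 * π) = entry H N i j x := by
    intro i j x
    refine Finset.sum_congr rfl fun n _ => ?_
    congr 1
    have h1 : Complex.I * n * ((x + 2 * π : ℝ) : ℂ) = Complex.I * n * x + n * (2 * π * Complex.I) := by
      push_cast
      ring
    rw [h1, Complex.exp_add, Complex.exp_int_mul_two_pi_mul_I, mul_one]
  have hA : ∀ x, entry H N 0 0 (-x) = -conj (entry H N 1 1 x) := h.entry_conjugation N 0 0
  have hB : ∀ x, entry H N 1 1 (-x) = -conj (entry H N 0 0 x) := h.entry_conjugation N 1 1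
  have hC : ∀ x, entry H N 0 1 (-x) = -entry H N 0 1 x := fun x => by
    rw [h.entry_conjugation N 0 1, h.entry_conj]
    rfl
  refine ⟨fun α => ?_, fun α x => ?_, fun x => ?_, fun x => ?_⟩
  · fin_cases α
    · exact ((hre 0 0).1.add (hre 1 1).1).div analyticOnNhd_const fun _ _ => two_ne_zero
    · exact (hre 0 1).1
    · exact (hre 0 1).2.neg
    · exact ((hre 0 0).1.sub (hre 1 1).1).div analyticOnNhd_const fun _ _ => two_ne_zero
  · fin_cases α <;> simp [coeffs, hper]
  · simp [coeffs, hA, hB]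
    ring
  · simp [coeffs, vecSq, hA, hB, hC]
    ring

lemma symb_coeffs (h : IsAdmissible xL xR H) (N : ℤ) (x : ℝ) (i j : Fin 2) :
    symb (fun α => coeffs H N α x) i j = entry H N i j x := by
  have hA := Complex.conj_eq_iff_re.1 (h.entry_conj N 0 0 x)
  have hB := Complex.conj_eq_iff_re.1 (h.entry_conj N 1 1 x)
  have hC := h.entry_conj N 0 1 x
  fin_cases i <;> fin_cases j
  · simp [symb_eq, vecMat, coeffs]
    rw [← hA, ← hB]
    simp
    ring
  · simp [symb_eq, vecMat, coeffs]
  · simp [symb_eq, vecMat, coeffs, ← hC]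
    apply Complex.ext <;> simp
  · simp [symb_eq, vecMat, coeffs]
    rw [← hA, ← hB]
    simp
    ring

lemma apply_siteVec_eq_sum (h : IsAdmissible xL xR H) (y : ℤ) (i j : Fin 2) :
    H (siteVec y j) i = ∑ n ∈ Finset.Icc (-(xR + 2 - xL)) (xR + 2 - xL),
      hop H i j n • (lp.single 2 (n + y) (1 : ℂ) : PosSpace) := by
  refine lp.ext (funext fun x => ?_)
  rw [h.apply_siteVec, lp.coeFn_sum, Finset.sum_apply]
  simp only [lp_smul_apply, lp.single_apply]
  by_cases hx : x - y ∈ Finset.Icc (-(xR + 2 - xL)) (xR + 2 - xL)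
  · rw [Finset.sum_eq_single (x - y)]
    · simp
    · intro n _ hn
      have : x ≠ n + y := by
        rintro rfl
        simp at hn
      simp [this]
    · exact fun h => absurd hx h
  · rw [h.hop_eq_zero i j hx, Finset.sum_eq_zero]
    intro n hn
    have : x ≠ n + y := by
      rintro rfl
      rw [add_sub_cancel_right] at hx
      exact hx hn
    simp [this]

/-- The Fourier transformed Hamiltonian is the multiplication operator by its symbol. -/
theorem isMatMul_hat (h : IsAdmissible xL xR H) :
    IsMatMul (hat H) (fun k => symb (onTorus (coeffs H (xR + 2 - xL)) k)) := by
  set N := xR + 2 - xL with hN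
  have hu := h.isSymbol_coeffs N
  obtain ⟨T, hT⟩ : ∃ T, IsMatMul T (fun k => symb (onTorus (coeffs H N) k)) := by
    choose v hv using fun α => exists_linfty (Complex.measurable_ofReal.comp (hu.measurable α))
      (C := hu.bounded.choose) (fun k => by
        rw [Function.comp_apply, Complex.norm_real]
        exact hu.bounded.choose_spec k α)
    refine ⟨_, (isMatMul_pauliOp v).congr ?_⟩
    filter_upwards [ae_all_iff.2 hv] with k hk
    simp only [hk, symb]
    rfl
  refine hT.of_planeWave fun y j i => ?_
  have h1 : hat H (planeWave y j) i = ∑ n ∈ Finset.Icc (-N) N,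
      hop H i j n • fourierLp (T := 2 * π) 2 (n + y) := by
    rw [← dblFourier_siteVec, hat_apply, dblFourier_apply, h.apply_siteVec_eq_sum, map_sum]
    simp only [map_smul, fourierTransform_single, ← hN]
  have h2 : ∀ᵐ k ∂torusMeasure, (∑ n ∈ Finset.Icc (-N) N,
      hop H i j n • fourierLp (T := 2 * π) 2 (n + y)) k =
      ∑ n ∈ Finset.Icc (-N) N, (hop H i j n • fourierLp (T := 2 * π) 2 (n + y)) k := by
    filter_upwards [Lp.coeFn_finsetSum (Finset.Icc (-N) N) fun n =>
      hop H i j n • fourierLp (T := 2 * π) 2 (n + y)] with k hk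
    rw [hk, Finset.sum_apply]
  have h3 : ∀ᵐ k ∂torusMeasure, ∀ n : ℤ, (hop H i j n • fourierLp (T := 2 * π) 2 (n + y)) k =
      hop H i j n * fourier (n + y) k := by
    refine ae_all_iff.2 fun n => ?_
    filter_upwards [Lp.coeFn_smul (hop H i j n) (fourierLp (T := 2 * π) 2 (n + y)),
      coeFn_fourierLp (T := 2 * π) 2 (n + y)] with k h1 h2
    rw [h1, Pi.smul_apply, h2, smul_eq_mul]
  filter_upwards [h2, h3] with k h2 h3
  have h8 : ∀ n : ℤ, Complex.exp (Complex.I * n * rep k) = fourier n k := by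
    intro n
    conv_rhs => rw [← coe_rep k, fourier_coe_apply]
    congr 1
    have : (π : ℂ) ≠ 0 := by exact_mod_cast Real.pi_pos.ne'
    push_cast
    field_simp
  have h9 : symb (onTorus (coeffs H N) k) i j = entry H N i j (rep k) :=
    h.symb_coeffs N (rep k) i j
  rw [h1, h2, h9, entry, Finset.sum_mul]
  refine Finset.sum_congr rfl fun n _ => ?_
  rw [h3, h8, fourier_add, mul_assoc]

end IsAdmissible

/-! ### Continuously differentiable representatives and the six cases -/

/-- The Pauli matrices are linearly independent. -/
lemma pauli_injective {c d : Fin 4 → ℂ} (h : ∑ α, c α • pauli α = ∑ α, d α • pauli α) : c = d := by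
  have h00 := congrFun (congrFun h 0) 0
  have h01 := congrFun (congrFun h 0) 1
  have h10 := congrFun (congrFun h 1) 0
  have h11 := congrFun (congrFun h 1) 1
  simp [pauli, Fin.sum_univ_four] at h00 h01 h10 h11
  have hI := Complex.I_ne_zero
  funext α
  fin_cases α
  · change c 0 = d 0
    linear_combination (1 / 2) * h00 + (1 / 2) * h11
  · change c 1 = d 1
    linear_combination (1 / 2) * h01 + (1 / 2) * h10
  · change c 2 = d 2
    apply mul_right_cancel₀ hI
    linear_combination (1 / 2) * h10 - (1 / 2) * h01
  · change c 3 = d 3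
    linear_combination (1 / 2) * h00 - (1 / 2) * h11

lemma forall_Icc_iff {f : ℝ → ℝ} (hf : Function.Periodic f (2 * π)) :
    (∀ x ∈ Icc (-π) π, f x = 0) ↔ ∀ x, f x = 0 := by
  refine ⟨fun h x => ?_, fun h x _ => h x⟩
  obtain ⟨y, hy, hxy⟩ := hf.exists_mem_Ioc Real.two_pi_pos x (-π)
  rw [neg_pi_add] at hy
  rw [hxy]
  exact h y (Ioc_subset_Icc_self hy)

lemma periodic_deriv {f : ℝ → ℝ} {c : ℝ} (hf : Function.Periodic f c) :
    Function.Periodic (deriv f) c := by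
  intro x
  rw [← deriv_comp_add_const, funext hf]

/-- Two continuous representatives of the same class agree. -/
lemma IsC1Rep.eqOn {v : LInfty} {g g' : ℝ → ℂ} (h : IsC1Rep v g) (h' : IsC1Rep v g') :
    EqOn g g' (Icc (-π) π) := by
  refine Measure.eqOn_Icc_of_ae_eq (μ := volume) (by linarith [Real.pi_pos]) ?_
    h.contDiff.continuousOn h'.contDiff.continuousOn
  filter_upwards [h.ae_eq, h'.ae_eq] with x h1 h2
  rw [← h1, h2]

namespace IsSymbol

variable {u : Fin 4 → ℝ → ℝ}

lemma dT_ofReal (hu : IsSymbol u) (α : Fin 4) {x : ℝ} (hx : x ∈ Icc (-π) π) :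
    dT (fun y => (u α y : ℂ)) x = deriv (u α) x := by
  have h := (hu.hasDerivAt α x).ofReal_comp
  rw [dT, h.differentiableAt.derivWithin
    (uniqueDiffOn_Icc (by linarith [Real.pi_pos]) x hx), h.deriv]

lemma isC1Rep (hu : IsSymbol u) {α : Fin 4} {v : LInfty}
    (hv : ∀ᵐ k ∂torusMeasure, v k = onTorus u k α) : IsC1Rep v (fun x => (u α x : ℂ)) := by
  have hle : -π ≤ π := by linarith [Real.pi_pos]
  have hper : ∀ {f : ℝ → ℝ}, Function.Periodic f (2 * π) → f π = f (-π) := fun {f} hf => by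
    rw [← hf (-π), neg_pi_add]
  refine ⟨?_, ?_, ?_, ?_⟩
  · exact (Complex.ofRealCLM.contDiff.comp (hu.contDiff α)).contDiffOn
  · simp only [hper (hu.periodic α)]
  · rw [hu.dT_ofReal α (right_mem_Icc.2 hle), hu.dT_ofReal α (left_mem_Icc.2 hle),
      hper (periodic_deriv (hu.periodic α))]
  · filter_upwards [ae_coe hv, ae_mem_Ioc] with x h1 h2
    rw [h1, onTorus, rep_coe h2]

section Cases

variable {v : Fin 4 → LInfty} {g : Fin 4 → ℝ → ℂ}

lemma rep_eq (hu : IsSymbol u) (hv : ∀ α, ∀ᵐ k ∂torusMeasure, v α k = onTorus u k α)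
    (hg : ∀ α, IsC1Rep (v α) (g α)) (α : Fin 4) {x : ℝ} (hx : x ∈ Icc (-π) π) :
    g α x = u α x :=
  (hg α).eqOn (hu.isC1Rep (hv α)) hx

lemma dT_rep_eq (hu : IsSymbol u) (hv : ∀ α, ∀ᵐ k ∂torusMeasure, v α k = onTorus u k α)
    (hg : ∀ α, IsC1Rep (v α) (g α)) (α : Fin 4) {x : ℝ} (hx : x ∈ Icc (-π) π) :
    dT (g α) x = deriv (u α) x := by
  rw [← hu.dT_ofReal α hx]
  exact derivWithin_congr (fun y hy => hu.rep_eq hv hg α hy) (hu.rep_eq hv hg α hx)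

lemma periodic_usq (hu : IsSymbol u) : Function.Periodic (usq u) (2 * π) := fun x => by
  have h : ∀ α, u α (x + 2 * π) = u α x := fun α => hu.periodic α x
  simp only [usq, h]

lemma scalarZero_iff (hu : IsSymbol u) (hv : ∀ α, ∀ᵐ k ∂torusMeasure, v α k = onTorus u k α)
    (hg : ∀ α, IsC1Rep (v α) (g α)) : ScalarZero g ↔ ∀ x, u 0 x = 0 := by
  rw [← forall_Icc_iff (hu.periodic 0)]
  refine forall₂_congr fun x hx => ?_
  rw [hu.rep_eq hv hg 0 hx, Complex.ofReal_eq_zero]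

lemma vectorZero_iff (hu : IsSymbol u) (hv : ∀ α, ∀ᵐ k ∂torusMeasure, v α k = onTorus u k α)
    (hg : ∀ α, IsC1Rep (v α) (g α)) : VectorZero g ↔ ∀ x, usq u x = 0 := by
  rw [← forall_Icc_iff hu.periodic_usq]
  refine forall₂_congr fun x hx => ?_
  rw [hu.rep_eq hv hg 1 hx, hu.rep_eq hv hg 2 hx, hu.rep_eq hv hg 3 hx, Complex.ofReal_eq_zero,
    Complex.ofReal_eq_zero, Complex.ofReal_eq_zero, usq, vecSq]
  constructor
  · rintro ⟨h1, h2, h3⟩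
    rw [h1, h2, h3]
    norm_num
  · intro h
    refine ⟨?_, ?_, ?_⟩ <;> nlinarith [sq_nonneg (u 1 x), sq_nonneg (u 2 x), sq_nonneg (u 3 x)]

lemma dotDerivZero_iff (hu : IsSymbol u)
    (hv : ∀ α, ∀ᵐ k ∂torusMeasure, v α k = onTorus u k α) (hg : ∀ α, IsC1Rep (v α) (g α)) :
    DotDerivZero g ↔ ∀ x, deriv (usq u) x = 0 := by
  rw [← forall_Icc_iff (periodic_deriv hu.periodic_usq)]
  refine forall₂_congr fun x hx => ?_
  rw [hu.rep_eq hv hg 1 hx, hu.rep_eq hv hg 2 hx, hu.rep_eq hv hg 3 hx, hu.dT_rep_eq hv hg 1 hx,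
    hu.dT_rep_eq hv hg 2 hx, hu.dT_rep_eq hv hg 3 hx, hu.deriv_usq, mul_eq_zero,
    or_iff_right two_ne_zero]
  norm_cast

lemma squaresEq_iff (hu : IsSymbol u) (hv : ∀ α, ∀ᵐ k ∂torusMeasure, v α k = onTorus u k α)
    (hg : ∀ α, IsC1Rep (v α) (g α)) : SquaresEq g ↔ ∀ x, usq u x = u 0 x ^ 2 := by
  have hper : Function.Periodic (fun x => usq u x - u 0 x ^ 2) (2 * π) := fun x => by
    simp only [hu.periodic_usq x, hu.periodic 0 x]
  have h1 : (∀ x, usq u x = u 0 x ^ 2) ↔ ∀ x, usq u x - u 0 x ^ 2 = 0 :=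
    forall_congr' fun x => sub_eq_zero.symm
  rw [h1, ← forall_Icc_iff hper]
  refine forall₂_congr fun x hx => ?_
  rw [hu.rep_eq hv hg 0 hx, hu.rep_eq hv hg 1 hx, hu.rep_eq hv hg 2 hx, hu.rep_eq hv hg 3 hx,
    sub_eq_zero, usq, vecSq, eq_comm]
  norm_cast

/-- If `u₀² = u²` and `u²` is constant, then `u₀` is constant, hence zero because it is odd. -/
lemma eq_zero_of_sq_eq_of_deriv (hu : IsSymbol u) (hw : ∀ x, usq u x = u 0 x ^ 2)
    (hd : ∀ x, deriv (usq u) x = 0) (x : ℝ) : u 0 x = 0 := by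
  have h0 : usq u 0 = 0 := by
    have h1 := hu.odd 0
    rw [neg_zero] at h1
    rw [hw, self_eq_neg.1 h1]
    norm_num
  have h1 := is_const_of_deriv_eq_zero (fun x => (hu.hasDerivAt_usq x).differentiableAt) hd x 0
  rw [hw, h0] at h1
  exact pow_eq_zero_iff two_ne_zero |>.1 h1

/-- The cases are mutually exclusive, and they exhaust all non-zero symbols. -/
lemma existsUnique_case (hu : IsSymbol u)
    (hv : ∀ α, ∀ᵐ k ∂torusMeasure, v α k = onTorus u k α) (hg : ∀ α, IsC1Rep (v α) (g α))
    (hne : ¬((∀ x, u 0 x = 0) ∧ ∀ x, usq u x = 0)) : ∃! c, InCase g c := by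
  have hvd : (∀ x, usq u x = 0) → ∀ x, deriv (usq u) x = 0 := fun h x => by
    rw [show usq u = fun _ => 0 from funext h, deriv_const]
  have hvs : (∀ x, usq u x = 0) → (∀ x, usq u x = u 0 x ^ 2) → ∀ x, u 0 x = 0 := fun h h' x =>
    pow_eq_zero_iff two_ne_zero |>.1 ((h' x).symm.trans (h x))
  have hsd := hu.eq_zero_of_sq_eq_of_deriv
  have key : ∀ c, InCase g c ↔ (match c with
      | .one => (∀ x, u 0 x = 0) ∧ ¬(∀ x, usq u x = 0) ∧ ∀ x, deriv (usq u) x = 0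
      | .two => (∀ x, u 0 x = 0) ∧ ¬∀ x, deriv (usq u) x = 0
      | .three => ¬(∀ x, u 0 x = 0) ∧ ∀ x, usq u x = 0
      | .four => ¬(∀ x, u 0 x = 0) ∧ ¬(∀ x, usq u x = 0) ∧ ∀ x, deriv (usq u) x = 0
      | .five => ¬(∀ x, u 0 x = 0) ∧ ¬(∀ x, deriv (usq u) x = 0) ∧ ¬∀ x, usq u x = u 0 x ^ 2
      | .six => ¬(∀ x, u 0 x = 0) ∧ ∀ x, usq u x = u 0 x ^ 2) := by
    intro c
    cases c <;> simp only [InCase, hu.scalarZero_iff hv hg, hu.vectorZero_iff hv hg,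
      hu.dotDerivZero_iff hv hg, hu.squaresEq_iff hv hg]
  by_cases hs : ∀ x, u 0 x = 0
  · by_cases hd : ∀ x, deriv (usq u) x = 0
    · refine ⟨.one, (key _).2 ⟨hs, fun h => hne ⟨hs, h⟩, hd⟩, fun c hc => ?_⟩
      replace hc := (key c).1 hc
      cases c <;> simp only at hc <;> tauto
    · refine ⟨.two, (key _).2 ⟨hs, hd⟩, fun c hc => ?_⟩
      replace hc := (key c).1 hc
      cases c <;> simp only at hc <;> tauto
  · by_cases hz : ∀ x, usq u x = 0
    · refine ⟨.three, (key _).2 ⟨hs, hz⟩, fun c hc => ?_⟩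
      replace hc := (key c).1 hc
      cases c <;> simp only at hc <;> tauto
    · by_cases hd : ∀ x, deriv (usq u) x = 0
      · refine ⟨.four, (key _).2 ⟨hs, hz, hd⟩, fun c hc => ?_⟩
        replace hc := (key c).1 hc
        cases c <;> simp only at hc <;> tauto
      · by_cases hq : ∀ x, usq u x = u 0 x ^ 2
        · refine ⟨.six, (key _).2 ⟨hs, hq⟩, fun c hc => ?_⟩
          replace hc := (key c).1 hc
          cases c <;> simp only at hc <;> tauto
        · refine ⟨.five, (key _).2 ⟨hs, hd, hq⟩, fun c hc => ?_⟩
          replace hc := (key c).1 hc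
          cases c <;> simp only at hc <;> tauto

/-- The symbol is dispersive in the cases two to five. -/
lemma dispersive_of_case (hu : IsSymbol u)
    (hv : ∀ α, ∀ᵐ k ∂torusMeasure, v α k = onTorus u k α) (hg : ∀ α, IsC1Rep (v α) (g α))
    (h : InCase g .two ∨ InCase g .three ∨ InCase g .four ∨ InCase g .five) : Dispersive u := by
  by_contra hd
  have h1 := hu.not_dispersive hd
  have hs := hu.scalarZero_iff hv hg
  have hz := hu.vectorZero_iff hv hg
  have hd' := hu.dotDerivZero_iff hv hg
  have hq := hu.squaresEq_iff hv hg
  have hvs : (∀ x, usq u x = 0) → (∀ x, usq u x = u 0 x ^ 2) → ∀ x, u 0 x = 0 := fun h h' x =>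
    pow_eq_zero_iff two_ne_zero |>.1 ((h' x).symm.trans (h x))
  have hsd := hu.eq_zero_of_sq_eq_of_deriv
  have hsq : (∀ x, u 0 x = 0) → (∀ x, usq u x = u 0 x ^ 2) → ∀ x, deriv (usq u) x = 0 :=
    fun h h' x => by
      have : usq u = fun _ => 0 := funext fun y => by rw [h', h]; norm_num
      rw [this, deriv_const]
  simp only [InCase, hs, hz, hd', hq] at h
  tauto

end Cases

end IsSymbol

lemma IsPauliSymbol.ae_eq {H : Dbl PosSpace →L[ℂ] Dbl PosSpace} {u : Fin 4 → ℝ → ℝ}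
    {v : Fin 4 → LInfty} (hv : IsPauliSymbol H v)
    (hM : IsMatMul (hat H) (fun k => symb (onTorus u k))) (α : Fin 4) :
    ∀ᵐ k ∂torusMeasure, v α k = onTorus u k α := by
  have h1 := isMatMul_pauliOp v
  rw [← hv] at h1
  filter_upwards [h1.symbol_unique hM] with k hk
  exact congrFun (pauli_injective hk) α

lemma isTraceClass_zero {E : Type*} [NormedAddCommGroup E] [InnerProductSpace ℂ E]
    [CompleteSpace E] : IsTraceClass (0 : E →L[ℂ] E) := by
  intro ι e
  simp [CFC.abs_zero, summable_zero]

/-- The Pauli coefficient functions exist and are unique. -/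
lemma IsSymbol.existsUnique_isPauliSymbol {H : Dbl PosSpace →L[ℂ] Dbl PosSpace}
    {u : Fin 4 → ℝ → ℝ} (hu : IsSymbol u) (hM : IsMatMul (hat H) (fun k => symb (onTorus u k))) :
    ∃! v : Fin 4 → LInfty, IsPauliSymbol H v := by
  choose v hv using fun α => exists_linfty (Complex.measurable_ofReal.comp (hu.measurable α))
    (C := hu.bounded.choose) (fun k => by
      rw [Function.comp_apply, Complex.norm_real]
      exact hu.bounded.choose_spec k α)
  refine ⟨v, hM.ext (isMatMul_pauliOp v) ?_, fun v' hv' => funext fun α => Lp.ext ?_⟩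
  · filter_upwards [ae_all_iff.2 hv] with k hk
    simp only [hk, symb]
    rfl
  · filter_upwards [hv'.ae_eq hM α, hv α] with k h1 h2
    rw [h1, h2]
    rfl

/-- A Hamiltonian which is not a multiple of the identity has a non-zero symbol. -/
lemma symbol_ne_zero {H : Dbl PosSpace →L[ℂ] Dbl PosSpace} {u : Fin 4 → ℝ → ℝ}
    (hM : IsMatMul (hat H) (fun k => symb (onTorus u k)))
    (hH : ∀ z : ℂ, H ≠ z • (1 : Dbl PosSpace →L[ℂ] Dbl PosSpace)) :
    ¬((∀ x, u 0 x = 0) ∧ ∀ x, usq u x = 0) := by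
  rintro ⟨h0, hw⟩
  suffices h : H = 0 from hH 0 (by
    rw [h]
    ext1 ψ
    exact (zero_smul ℂ ψ).symm)
  have h1 : hat H = 0 := hM.ext IsMatMul.zero (Eventually.of_forall fun k => by
    have h2 : onTorus u k 0 = 0 := h0 _
    rw [symb_eq, h2, vecMat_eq_zero (onTorus u k) (hw (rep k))]
    simp)
  ext1 ψ
  have h2 : dblFourier (H ψ) = 0 := by
    rw [← hat_apply, h1]
    rfl
  simpa using h2

/-! ### Examples for the six cases -/

lemma isSelfAdjoint_of_symbol {H : Dbl PosSpace →L[ℂ] Dbl PosSpace}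
    {M : Torus → Matrix (Fin 2) (Fin 2) ℂ} (hH : IsMatMul (hat H) M)
    (hM : ∀ k, (M k).IsHermitian) : IsSelfAdjoint H := by
  rw [ContinuousLinearMap.isSelfAdjoint_iff_isSymmetric]
  intro ψ φ
  rw [← LinearIsometryEquiv.inner_map_map dblFourier, ← LinearIsometryEquiv.inner_map_map dblFourier]
  change ⟪dblFourier (H ψ), dblFourier φ⟫_ℂ = ⟪dblFourier ψ, dblFourier (H φ)⟫_ℂ
  rw [← hat_apply, ← hat_apply, inner_eq_integral, inner_eq_integral]
  refine integral_congr_ae ?_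
  filter_upwards [hH (dblFourier ψ) 0, hH (dblFourier ψ) 1, hH (dblFourier φ) 0,
    hH (dblFourier φ) 1] with k h1 h2 h3 h4
  have hh : ∀ i j, conj (M k i j) = M k j i := fun i j => (hM k).apply j i
  simp only [Fin.sum_univ_two, h1, h2, h3, h4, map_add, map_mul, hh]
  ring

lemma adjoint_Θ_apply (F : Dbl PosSpace) (i : Fin 2) (x : ℤ) :
    (ContinuousLinearMap.adjoint Θ F i : ℤ → ℂ) x = (F i : ℤ → ℂ) (x + 1) := by
  rw [← inner_siteVec, ContinuousLinearMap.adjoint_inner_right, Θ_siteVec, inner_siteVec]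

lemma exists_isMatMul_fourier (n : ℤ) :
    ∃ T, IsMatMul T (fun k => (fourier n k : ℂ) • (1 : Matrix (Fin 2) (Fin 2) ℂ)) := by
  refine exists_isMatMul (fun i j => ?_) (C := 1) fun k i j => ?_
  · exact (fourier n).continuous.measurable.mul_const _
  · have h1 : ‖(fourier n k : ℂ)‖ = 1 := by
      rw [fourier_apply]
      exact Circle.norm_coe _
    rw [Matrix.smul_apply, smul_eq_mul, norm_mul, h1, one_mul, Matrix.one_apply]
    split_ifs <;> simp

lemma isMatMul_hat_of_shift {T : Dbl PosSpace →L[ℂ] Dbl PosSpace} {m : ℤ}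
    (hT : ∀ x j, T (siteVec x j) = siteVec (x + m) j) :
    IsMatMul (hat T) (fun k => (fourier m k : ℂ) • 1) := by
  obtain ⟨T', hT'⟩ := exists_isMatMul_fourier m
  refine hT'.of_planeWave fun n j i => ?_
  rw [← dblFourier_siteVec, hat_apply, hT, dblFourier_siteVec]
  filter_upwards [planeWave_apply (n + m) i j] with k hk
  rw [hk, fourier_add, Matrix.smul_apply, Matrix.one_apply, smul_eq_mul]
  split_ifs
  · ring
  · ring

lemma isMatMul_hat_Θ : IsMatMul (hat Θ) (fun k => (fourier 1 k : ℂ) • 1) :=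
  isMatMul_hat_of_shift Θ_siteVec

lemma isMatMul_hat_adjoint_Θ :
    IsMatMul (hat (ContinuousLinearMap.adjoint Θ)) (fun k => (fourier (-1) k : ℂ) • 1) := by
  refine isMatMul_hat_of_shift fun x j => PiLp.ext fun i => lp.ext (funext fun y => ?_)
  rw [adjoint_Θ_apply, siteVec_apply, siteVec_apply]
  have : y + 1 = x ↔ y = x + -1 := by
    constructor <;> intro h <;> linarith
  simp only [this]

lemma isMatMul_hat_opMatrix_one (A : Matrix (Fin 2) (Fin 2) ℂ) :
    IsMatMul (hat (opMatrix 1 A)) (fun _ => A) := by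
  intro Φ i
  obtain ⟨F, rfl⟩ := dblFourier.surjective Φ
  rw [hat_apply, dblFourier_apply, opMatrix_apply, Fin.sum_univ_two, map_add, map_smul, map_smul]
  filter_upwards [Lp.coeFn_add (A i 0 • fourierTransform (F 0)) (A i 1 • fourierTransform (F 1)),
    Lp.coeFn_smul (A i 0) (fourierTransform (F 0)),
    Lp.coeFn_smul (A i 1) (fourierTransform (F 1))] with k h1 h2 h3
  rw [Fin.sum_univ_two]
  refine h1.trans ?_
  rw [Pi.add_apply, h2, h3]
  rfl

/-- The operator `(θ - θ*) / (2i)`, which acts as multiplication by `sin k` on momentum space. -/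
def sinOp : Dbl PosSpace →L[ℂ] Dbl PosSpace :=
  (-Complex.I / 2) • (Θ - ContinuousLinearMap.adjoint Θ)

/-- The operator `(θ + θ*) / 2`, which acts as multiplication by `cos k` on momentum space. -/
def cosOp : Dbl PosSpace →L[ℂ] Dbl PosSpace :=
  (1 / 2 : ℂ) • (Θ + ContinuousLinearMap.adjoint Θ)

/-- A nearest neighbour Hamiltonian of XY type, with the symbol
`a sin(k) σ₀ + b sin(k) σ₁ + (d + e cos(k)) σ₃`. -/
def chain (a b d e : ℝ) : Dbl PosSpace →L[ℂ] Dbl PosSpace :=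
  (a : ℂ) • sinOp + (b : ℂ) • (sinOp * opMatrix 1 (pauli 1)) +
    ((d : ℂ) • 1 + (e : ℂ) • cosOp) * opMatrix 1 (pauli 3)

/-- The Pauli coefficients of `chain a b d e`. -/
def chainCoeffs (a b d e : ℝ) : Fin 4 → ℝ → ℝ :=
  ![fun x => a * Real.sin x, fun x => b * Real.sin x, fun _ => 0, fun x => d + e * Real.cos x]

lemma isSymbol_chainCoeffs (a b d e : ℝ) : IsSymbol (chainCoeffs a b d e) := by
  refine ⟨fun α => ?_, fun α x => ?_, fun x => ?_, fun x => ?_⟩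
  · fin_cases α
    · exact fun x _ => analyticAt_const.mul Real.analyticAt_sin
    · exact fun x _ => analyticAt_const.mul Real.analyticAt_sin
    · exact fun x _ => analyticAt_const
    · exact fun x _ => analyticAt_const.add (analyticAt_const.mul Real.analyticAt_cos)
  · fin_cases α <;> simp [chainCoeffs]
  · simp [chainCoeffs]
  · simp [chainCoeffs, vecSq]

lemma usq_chainCoeffs (a b d e x : ℝ) :
    usq (chainCoeffs a b d e) x = (b * Real.sin x) ^ 2 + (d + e * Real.cos x) ^ 2 := by
  simp [usq, vecSq, chainCoeffs]

lemma fourier_one_eq (k : Torus) :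
    (fourier 1 k : ℂ) = Real.cos (rep k) + Real.sin (rep k) * Complex.I := by
  conv_lhs => rw [← coe_rep k, fourier_coe_apply]
  have : (π : ℂ) ≠ 0 := by exact_mod_cast Real.pi_pos.ne'
  rw [Complex.ofReal_cos, Complex.ofReal_sin, ← Complex.exp_mul_I]
  congr 1
  push_cast
  field_simp

lemma fourier_neg_one_eq (k : Torus) :
    (fourier (-1) k : ℂ) = Real.cos (rep k) - Real.sin (rep k) * Complex.I := by
  rw [fourier_neg, fourier_one_eq]
  simp only [map_add, map_mul, Complex.conj_ofReal, Complex.conj_I]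
  ring

lemma isMatMul_hat_sinOp : IsMatMul (hat sinOp) (fun k => (Real.sin (rep k) : ℂ) • 1) := by
  have h := (isMatMul_hat_Θ.sub isMatMul_hat_adjoint_Θ).smul (-Complex.I / 2)
  have h1 : hat sinOp = (-Complex.I / 2) • (hat Θ - hat (ContinuousLinearMap.adjoint Θ)) := by
    have h2 : sinOp = (-Complex.I / 2) • (Θ + (-1 : ℂ) • ContinuousLinearMap.adjoint Θ) := by
      unfold sinOp
      module
    rw [h2, hat_smul, hat_add, hat_smul]
    module
  rw [h1]
  refine h.congr (Eventually.of_forall fun k => ?_)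
  rw [fourier_one_eq, fourier_neg_one_eq, ← sub_smul, smul_smul]
  congr 1
  linear_combination (-(Real.sin (rep k) : ℂ)) * Complex.I_sq

lemma isMatMul_hat_cosOp : IsMatMul (hat cosOp) (fun k => (Real.cos (rep k) : ℂ) • 1) := by
  have h := (isMatMul_hat_Θ.add isMatMul_hat_adjoint_Θ).smul (1 / 2)
  rw [cosOp, hat_smul, hat_add]
  refine h.congr (Eventually.of_forall fun k => ?_)
  rw [fourier_one_eq, fourier_neg_one_eq, ← add_smul, smul_smul]
  congr 1
  ring

section Chain

variable (a b d e : ℝ)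

lemma isMatMul_hat_chain :
    IsMatMul (hat (chain a b d e)) (fun k => symb (onTorus (chainCoeffs a b d e) k)) := by
  have h1 := isMatMul_hat_sinOp.smul (a : ℂ)
  have h2 := (isMatMul_hat_sinOp.mul (isMatMul_hat_opMatrix_one (pauli 1))).smul (b : ℂ)
  have h3 := ((IsMatMul.one.smul (d : ℂ)).add (isMatMul_hat_cosOp.smul (e : ℂ))).mul
    (isMatMul_hat_opMatrix_one (pauli 3))
  have h4 := (h1.add h2).add h3
  simp only [chain, hat_add, hat_smul, hat_mul, hat_one]
  refine h4.congr (Eventually.of_forall fun k => ?_)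
  ext i j
  fin_cases i <;> fin_cases j <;>
    simp [symb_eq, vecMat, onTorus, chainCoeffs, pauli, Matrix.mul_apply, Fin.sum_univ_two]

lemma sinOp_apply (F : Dbl PosSpace) (i : Fin 2) (x : ℤ) : (sinOp F i : ℤ → ℂ) x =
    -Complex.I / 2 * ((F i : ℤ → ℂ) (x - 1) - (F i : ℤ → ℂ) (x + 1)) := by
  rw [← Θ_apply, ← adjoint_Θ_apply]
  rfl

lemma cosOp_apply (F : Dbl PosSpace) (i : Fin 2) (x : ℤ) : (cosOp F i : ℤ → ℂ) x =
    1 / 2 * ((F i : ℤ → ℂ) (x - 1) + (F i : ℤ → ℂ) (x + 1)) := by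
  rw [← Θ_apply, ← adjoint_Θ_apply]
  rfl

lemma chain_apply (F : Dbl PosSpace) (i : Fin 2) (x : ℤ) : (chain a b d e F i : ℤ → ℂ) x =
    a * (sinOp F i : ℤ → ℂ) x + b * (sinOp (opMatrix 1 (pauli 1) F) i : ℤ → ℂ) x +
      (d * (opMatrix 1 (pauli 3) F i : ℤ → ℂ) x +
        e * (cosOp (opMatrix 1 (pauli 3) F) i : ℤ → ℂ) x) :=
  rfl

lemma chain_apply_zero (F : Dbl PosSpace) (x : ℤ) : (chain a b d e F 0 : ℤ → ℂ) x =
    a * (-Complex.I / 2 * ((F 0 : ℤ → ℂ) (x - 1) - (F 0 : ℤ → ℂ) (x + 1))) +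
      b * (-Complex.I / 2 * ((F 1 : ℤ → ℂ) (x - 1) - (F 1 : ℤ → ℂ) (x + 1))) +
      (d * (F 0 : ℤ → ℂ) x +
        e * (1 / 2 * ((F 0 : ℤ → ℂ) (x - 1) + (F 0 : ℤ → ℂ) (x + 1)))) := by
  have h1 : opMatrix 1 (pauli 1) F 0 = F 1 := by
    rw [opMatrix_apply]
    simp [pauli]
  have h3 : opMatrix 1 (pauli 3) F 0 = F 0 := by
    rw [opMatrix_apply]
    simp [pauli]
  simp only [chain_apply, sinOp_apply, cosOp_apply, h1, h3]

lemma chain_apply_one (F : Dbl PosSpace) (x : ℤ) : (chain a b d e F 1 : ℤ → ℂ) x =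
    a * (-Complex.I / 2 * ((F 1 : ℤ → ℂ) (x - 1) - (F 1 : ℤ → ℂ) (x + 1))) +
      b * (-Complex.I / 2 * ((F 0 : ℤ → ℂ) (x - 1) - (F 0 : ℤ → ℂ) (x + 1))) -
      (d * (F 1 : ℤ → ℂ) x +
        e * (1 / 2 * ((F 1 : ℤ → ℂ) (x - 1) + (F 1 : ℤ → ℂ) (x + 1)))) := by
  have h1 : opMatrix 1 (pauli 1) F 1 = F 0 := by
    rw [opMatrix_apply]
    simp [pauli]
  have h3 : ∀ y, (opMatrix 1 (pauli 3) F 1 : ℤ → ℂ) y = -(F 1 : ℤ → ℂ) y := by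
    intro y
    have : opMatrix 1 (pauli 3) F 1 = -F 1 := by
      rw [opMatrix_apply]
      simp [pauli]
    rw [this]
    rfl
  simp only [chain_apply, sinOp_apply, cosOp_apply, h1, h3]
  ring

lemma symb_isHermitian (c : Fin 4 → ℝ) : (symb c).IsHermitian := by
  rw [symb_eq]
  refine Matrix.IsHermitian.add ?_ (vecMat_isHermitian c)
  rw [Matrix.IsHermitian, Matrix.conjTranspose_smul, Matrix.conjTranspose_one]
  simp

/-- The Hamiltonians `chain a b d e` are admissible, for every position of the reservoirs. -/
lemma isAdmissible_chain {xL xR : ℤ} (hx : xL ≤ xR) (h : a ≠ 0 ∨ b ≠ 0 ∨ d ≠ 0 ∨ e ≠ 0) :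
    IsAdmissible xL xR (chain a b d e) := by
  refine ⟨⟨isSelfAdjoint_of_symbol (isMatMul_hat_chain a b d e) fun k => symb_isHermitian _,
    fun F => ?_⟩, ?_, ?_, fun z hz => ?_⟩
  · refine PiLp.ext fun i => lp.ext (funext fun x => ?_)
    have h1 : ∀ (G : Dbl PosSpace) (i : Fin 2), ((-G) i : ℤ → ℂ) x = -(G i : ℤ → ℂ) x :=
      fun _ _ => rfl
    rw [h1]
    fin_cases i
    · simp only [Fin.zero_eta, Γ_apply_zero, chain_apply_one, chain_apply_zero, Γ_apply_one]
      simp only [map_add, map_sub, map_mul, map_div₀, map_neg, Complex.conj_ofReal, Complex.conj_I,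
        Complex.conj_conj, map_ofNat, map_one]
      ring
    · simp only [Fin.mk_one, Γ_apply_zero, chain_apply_one, chain_apply_zero, Γ_apply_one]
      simp only [map_add, map_sub, map_mul, map_div₀, map_neg, Complex.conj_ofReal, Complex.conj_I,
        Complex.conj_conj, map_ofNat, map_one]
      ring
  · ext1 F
    refine PiLp.ext fun i => lp.ext (funext fun x => ?_)
    change (chain a b d e (Θ F) i : ℤ → ℂ) x = (Θ (chain a b d e F) i : ℤ → ℂ) x
    rw [Θ_apply]
    fin_cases i
    · simp only [Fin.zero_eta, chain_apply_zero, Θ_apply]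
      ring_nf
    · simp only [Fin.mk_one, chain_apply_one, Θ_apply]
      ring_nf
  · ext1 F
    refine PiLp.ext fun i => lp.ext (funext fun x => ?_)
    change (Q (Iic (xL - 1)) (chain a b d e (Q (Ici (xR + 1)) F)) i : ℤ → ℂ) x = 0
    rw [Q_apply]
    by_cases hxm : x ∈ Iic (xL - 1)
    · rw [Set.indicator_of_mem hxm]
      rw [mem_Iic] at hxm
      have h1 : ∀ j, ∀ y ≤ x + 1, (Q (Ici (xR + 1)) F j : ℤ → ℂ) y = 0 := by
        intro j y hy
        rw [Q_apply, Set.indicator_of_notMem]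
        rw [mem_Ici]
        linarith
      fin_cases i
      · simp [chain_apply_zero, h1 _ x (by linarith), h1 _ (x - 1) (by linarith),
          h1 _ (x + 1) le_rfl]
      · simp [chain_apply_one, h1 _ x (by linarith), h1 _ (x - 1) (by linarith),
          h1 _ (x + 1) le_rfl]
    · rw [Set.indicator_of_notMem hxm]
  · have h1 : ∀ j i x, (chain a b d e (siteVec 0 j) i : ℤ → ℂ) x =
        z * (siteVec 0 j i : ℤ → ℂ) x := by
      intro j i x
      rw [hz]
      rfl
    have h2 := h1 0 0 1
    have h3 := h1 0 1 1
    have h4 := h1 0 0 0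
    have h5 := h1 1 1 0
    rw [chain_apply_zero] at h2 h4
    rw [chain_apply_one] at h3 h5
    simp only [siteVec_apply] at h2 h3 h4 h5
    norm_num at h2 h3 h4 h5
    have h6 := congrArg Complex.re h2
    have h7 := congrArg Complex.im h2
    have h8 : (d : ℂ) = 0 := by linear_combination (1 / 2) * h4 - (1 / 2) * h5
    simp at h6 h7 h8
    rcases h with h | h | h | h
    · exact h h7
    · exact h h3
    · exact h h8
    · exact h h6

end Chain

/-- All cases occur. -/
theorem exists_inCase {xL xR : ℤ} (hx : xL ≤ xR) (c : CaseLabel) :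
    ∃ (H : Dbl PosSpace →L[ℂ] Dbl PosSpace) (v : Fin 4 → LInfty) (g : Fin 4 → ℝ → ℂ),
      IsAdmissible xL xR H ∧ IsPauliSymbol H v ∧ (∀ α, IsC1Rep (v α) (g α)) ∧ InCase g c := by
  suffices h : ∃ a b d e : ℝ, (a ≠ 0 ∨ b ≠ 0 ∨ d ≠ 0 ∨ e ≠ 0) ∧
      ∀ (v : Fin 4 → LInfty) (g : Fin 4 → ℝ → ℂ),
        (∀ α, ∀ᵐ k ∂torusMeasure, v α k = onTorus (chainCoeffs a b d e) k α) →
        (∀ α, IsC1Rep (v α) (g α)) → InCase g c by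
    obtain ⟨a, b, d, e, hne, h⟩ := h
    have hu := isSymbol_chainCoeffs a b d e
    have hM := isMatMul_hat_chain a b d e
    obtain ⟨v, hv, -⟩ := hu.existsUnique_isPauliSymbol hM
    have hvu := hv.ae_eq hM
    have hg : ∀ α, IsC1Rep (v α) (fun x => (chainCoeffs a b d e α x : ℂ)) := fun α =>
      hu.isC1Rep (hvu α)
    exact ⟨_, v, _, isAdmissible_chain a b d e hx hne, hv, hg, h v _ hvu hg⟩
  have hs : ¬∀ x, (1 : ℝ) * Real.sin x = 0 := fun h => by
    have := h (π / 2)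
    simp at this
  have hconst : ∀ {u : Fin 4 → ℝ → ℝ}, IsSymbol u → usq u 0 ≠ usq u (π / 2) →
      ¬∀ x, deriv (usq u) x = 0 := fun hu hne h =>
    hne (is_const_of_deriv_eq_zero (fun x => (hu.hasDerivAt_usq x).differentiableAt) h _ _)
  have h0 : ∀ a b d e, chainCoeffs a b d e 0 = fun x => a * Real.sin x := fun _ _ _ _ => rfl
  cases c with
  | one =>
    refine ⟨0, 0, 1, 0, by norm_num, fun v g hv hg => ?_⟩
    have hu := isSymbol_chainCoeffs 0 0 1 0
    rw [InCase, hu.scalarZero_iff hv hg, hu.vectorZero_iff hv hg, hu.dotDerivZero_iff hv hg]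
    have hw : usq (chainCoeffs 0 0 1 0) = fun _ => 1 := funext fun x => by
      rw [usq_chainCoeffs]
      norm_num
    simp [hw, h0]
  | two =>
    refine ⟨0, 1, 0, 0, by norm_num, fun v g hv hg => ?_⟩
    have hu := isSymbol_chainCoeffs 0 1 0 0
    rw [InCase, hu.scalarZero_iff hv hg, hu.dotDerivZero_iff hv hg]
    refine ⟨fun x => by simp [h0], hconst hu ?_⟩
    rw [usq_chainCoeffs, usq_chainCoeffs]
    norm_num
  | three =>
    refine ⟨1, 0, 0, 0, by norm_num, fun v g hv hg => ?_⟩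
    have hu := isSymbol_chainCoeffs 1 0 0 0
    rw [InCase, hu.scalarZero_iff hv hg, hu.vectorZero_iff hv hg]
    refine ⟨hs, fun x => ?_⟩
    rw [usq_chainCoeffs]
    norm_num
  | four =>
    refine ⟨1, 0, 1, 0, by norm_num, fun v g hv hg => ?_⟩
    have hu := isSymbol_chainCoeffs 1 0 1 0
    rw [InCase, hu.scalarZero_iff hv hg, hu.vectorZero_iff hv hg, hu.dotDerivZero_iff hv hg]
    have hw : usq (chainCoeffs 1 0 1 0) = fun _ => 1 := funext fun x => by
      rw [usq_chainCoeffs]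
      norm_num
    refine ⟨hs, ?_, ?_⟩ <;> simp [hw]
  | five =>
    refine ⟨1, 0, 0, 1, by norm_num, fun v g hv hg => ?_⟩
    have hu := isSymbol_chainCoeffs 1 0 0 1
    rw [InCase, hu.scalarZero_iff hv hg, hu.dotDerivZero_iff hv hg, hu.squaresEq_iff hv hg]
    refine ⟨hs, hconst hu ?_, fun h => ?_⟩
    · rw [usq_chainCoeffs, usq_chainCoeffs]
      norm_num
    · have h1 := h 0
      rw [usq_chainCoeffs, h0] at h1
      norm_num at h1
  | six =>
    refine ⟨1, 1, 0, 0, by norm_num, fun v g hv hg => ?_⟩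
    have hu := isSymbol_chainCoeffs 1 1 0 0
    rw [InCase, hu.scalarZero_iff hv hg, hu.squaresEq_iff hv hg]
    refine ⟨hs, fun x => ?_⟩
    rw [usq_chainCoeffs, h0]
    norm_num

end RLMover

end

theorem lemma5p2 (xL xR : ℤ) (hx : xL ≤ xR) :
    (∀ H : RLMover.Dbl RLMover.PosSpace →L[ℂ] RLMover.Dbl RLMover.PosSpace,
      RLMover.IsAdmissible xL xR H →
      -- the Pauli coefficient functions exist and are unique
      (∃! u : Fin 4 → RLMover.LInfty, RLMover.IsPauliSymbol H u) ∧
      ∀ u : Fin 4 → RLMover.LInfty, RLMover.IsPauliSymbol H u →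
        -- (a)
        (RLMover.IsTraceClass (RLMover.reservoirCoupling xL xR H) ∧
          (∀ α, ∀ᵐ k ∂(RLMover.torusMeasure), (u α k).im = 0) ∧
          (∀ α, ∃ g : ℝ → ℂ, RLMover.IsC1Rep (u α) g)) ∧
        ∀ g : Fin 4 → ℝ → ℂ, (∀ α, RLMover.IsC1Rep (u α) (g α)) →
          -- the cases are mutually exclusive and exhaustive
          (∃! c, RLMover.InCase g c) ∧
          -- (b)
          (RLMover.InCase g .one →
            RLMover.ppProj H = 1 ∧ RLMover.acProj H = 0 ∧ RLMover.scProj H = 0) ∧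
          (RLMover.InCase g .two ∨ RLMover.InCase g .three ∨ RLMover.InCase g .four ∨
              RLMover.InCase g .five →
            RLMover.ppProj H = 0 ∧ RLMover.acProj H = 1 ∧ RLMover.scProj H = 0) ∧
          (RLMover.InCase g .six →
            RLMover.ppProj H = RLMover.spectralProj H {0} ∧
            RLMover.acProj H = 1 - RLMover.spectralProj H {0} ∧
            RLMover.scProj H = 0 ∧
            ¬ FiniteDimensional ℂ (RLMover.spectralProj H {0}).range ∧
            RLMover.spectralProj H {0} ≠ 1) ∧
          RLMover.scProj H = 0 ∧
          -- (c)
          (∃! V, RLMover.IsAsymptoticVelocity (RLMover.hat H) V) ∧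
          ∀ V, RLMover.IsAsymptoticVelocity (RLMover.hat H) V →
            (RLMover.InCase g .one ∨ RLMover.InCase g .six → RLMover.eig V ∩ {0} = {0}) ∧
            (RLMover.InCase g .two ∨ RLMover.InCase g .three ∨ RLMover.InCase g .four ∨
                RLMover.InCase g .five →
              RLMover.eig V ∩ {0} = ∅ ∧ (0 : ℂ) ∉ RLMover.eig V)) ∧
    -- the cases are non-empty
    (∀ c : RLMover.CaseLabel,
      ∃ (H : RLMover.Dbl RLMover.PosSpace →L[ℂ] RLMover.Dbl RLMover.PosSpace)
        (u : Fin 4 → RLMover.LInfty) (g : Fin 4 → ℝ → ℂ),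
        RLMover.IsAdmissible xL xR H ∧ RLMover.IsPauliSymbol H u ∧
          (∀ α, RLMover.IsC1Rep (u α) (g α)) ∧ RLMover.InCase g c) := by
  refine ⟨fun H hH => ?_, fun c => RLMover.exists_inCase hx c⟩
  have hu := hH.isSymbol_coeffs (xR + 2 - xL)
  have hM := hH.isMatMul_hat
  have hsa := hH.hamiltonian.selfAdjoint
  have hne := RLMover.symbol_ne_zero hM hH.nontrivial
  obtain ⟨V₀, hV₀⟩ := hu.exists_isMatMul_velMat
  have hV := hu.isAsymptoticVelocity hM hV₀
  refine ⟨hu.existsUnique_isPauliSymbol hM, fun v hv => ?_⟩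
  have hvu := hv.ae_eq hM
  refine ⟨⟨?_, fun α => ?_, fun α => ⟨_, hu.isC1Rep (hvu α)⟩⟩, fun g hg => ?_⟩
  · rw [hH.coupling]
    exact RLMover.isTraceClass_zero
  · filter_upwards [hvu α] with k hk
    rw [hk, Complex.ofReal_im]
  have hs := hu.scalarZero_iff hvu hg
  have hd := hu.dotDerivZero_iff hvu hg
  have hq := hu.squaresEq_iff hvu hg
  have h1 : RLMover.InCase g .one → RLMover.ppProj H = 1 ∧ RLMover.acProj H = 0 ∧
      RLMover.scProj H = 0 := fun h =>
    RLMover.projections_of_const hu hsa hM (hs.1 h.1) (hd.1 h.2.2)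
  have h2 : RLMover.InCase g .two ∨ RLMover.InCase g .three ∨ RLMover.InCase g .four ∨
      RLMover.InCase g .five → RLMover.ppProj H = 0 ∧ RLMover.acProj H = 1 ∧
      RLMover.scProj H = 0 := fun h =>
    RLMover.projections_of_dispersive hu hsa hM (hu.dispersive_of_case hvu hg h)
  have h6' : RLMover.InCase g .six → ∃ x, RLMover.coeffs H (xR + 2 - xL) 0 x ≠ 0 := fun h => by
    by_contra! h'
    exact h.1 (hs.2 h')
  have h6 := fun h : RLMover.InCase g .six =>
    RLMover.projections_of_sq_eq hu hsa hM hH.translation (h6' h) (hq.1 h.2)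
  have huniq := hu.existsUnique_case hvu hg hne
  refine ⟨huniq, h1, h2, h6, ?_, ⟨V₀, hV, fun V' hV' => hV'.unique hV⟩, fun V hV' => ?_⟩
  · obtain ⟨c, hc, -⟩ := huniq
    cases c with
    | one => exact (h1 hc).2.2
    | two => exact (h2 (Or.inl hc)).2.2
    | three => exact (h2 (Or.inr (Or.inl hc))).2.2
    | four => exact (h2 (Or.inr (Or.inr (Or.inl hc)))).2.2
    | five => exact (h2 (Or.inr (Or.inr (Or.inr hc)))).2.2
    | six => exact (h6 hc).2.2.1
  · rw [hV'.unique hV]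
    refine ⟨fun h => Set.inter_eq_right.2 (Set.singleton_subset_iff.2 ?_), fun h => ?_⟩
    · rcases h with h | h
      · exact RLMover.IsSymbol.zero_mem_eig_of_const hV₀ (hs.1 h.1) (hd.1 h.2.2)
      · exact hu.zero_mem_eig_of_sq_eq hV₀ (h6' h) (hq.1 h.2)
    · have h0 := hu.zero_notMem_eig_of_dispersive hV₀ (hu.dispersive_of_case hvu hg h)
      exact ⟨Set.inter_singleton_eq_empty.2 h0, h0⟩
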